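/- Work in the vocabulary $\tau$ with one ternary relation symbol $R$. A \emph{linear space} is a $\tau$-structure in which $R$ holds only of triples of distinct points, in any order, and in which $R(x,y,z)$, $R(x,y,w)$ and $z\ne w$ imply $R(x,w,z)$. A \emph{line} of a finite linear space $A$ is a set of at least two points of $A$, any three distinct ones of which are $R$-related, that contains every point of $A$ that is $R$-related to two of its points. Put $\delta(A)=|A|-\sum_{\ell}(|\ell|-2)$, the sum being over all lines $\ell$ of $A$. Let $K_0$ be the class of finite linear spaces (the empty one included) all of whose substructures $A'$ satisfy $\delta(A')\ge 0$. Let $A\le M$ mean that $A$ is a finite subset of $M$ with $\delta(X)\ge\delta(A)$ for all finite $X$ with $A\subseteq X\subseteq M$. For disjoint $B,C$ with $C\neq\emptyset$ and $BC=B\cup C\in K_0$, the pair $(B,C)$ is \emph{$0$-primitive} if $B\le BC$, $\delta(BC)=\delta(B)$, and there is no $A$ with $B\subsetneq A\subsetneq BC$ and $B\le A\le BC$; it is \emph{good} if moreover $(B',C)$ is not $0$-primitive for any $B'\subsetneq B$. Let $\boldsymbol\alpha$ be the isomorphism type of the good pair $(\{b_1,b_2\},\{a\})$ with $R(b_1,b_2,a)$.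 Let $\mathcal U$ be the set of functions $\mu$ from isomorphism types of good pairs to non-negative integers with $\mu(B,C)\ge\delta(B)$ whenever $|C|\ge 2$, and $\mu(\boldsymbol\alpha)\ge 1$. For a good pair $(B,C)$ with $B\subseteq M$, let $\chi_M(B,C)$ be the maximal number of pairwise disjoint copies of $C$ over $B$ in $M$. Let $K_\mu$ be the class of $M\in K_0$ with $\chi_M(B,C)\le\mu(B,C)$ for all good pairs $(B,C)$ with $B\subseteq M$. A \emph{generic} $\mathcal G_\mu$ for $(K_\mu,\le)$ is a countable $\tau$-structure such that all its finite substructures are in $K_\mu$, every finite subset of it is contained in some finite $Y\le\mathcal G_\mu$, and, whenever $A\le\mathcal G_\mu$ and $A\le B\in K_\mu$, there is an embedding of $B$ into $\mathcal G_\mu$ over $A$ whose image $B'$ satisfies $B'\le\mathcal G_\mu$. Then there is a set $\mathcal V\subseteq\mathcal U$ with $|\mathcal V|=2^{\aleph_0}$ such that: (1) for every $\mu\in\mathcal V$ a generic $\mathcal G_\mu$ exists, and every such $\mathcal G_\mu$ is a Steiner system with lines of length $\mu(\boldsymbol\alpha)+2$, that is, it is a linear space in which the line $\{x : x=a \text{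 or } x=b \text{ or } R(a,b,x)\}$ through any two distinct points $a,b$ has exactly $\mu(\boldsymbol\alpha)+2$ points; (2) for all $\mu\neq\nu$ in $\mathcal V$ and all generics $\mathcal G_\mu$ and $\mathcal G_\nu$, the complete first-order theories differ: $\mathrm{Th}(\mathcal G_\mu)\neq\mathrm{Th}(\mathcal G_\nu)$. -/

import Mathlib

open scoped FirstOrder

namespace SteinerGeneric

/-- The only non-logical symbol: a ternary relation symbol. -/
inductive TauRel : ℕ → Type
  | R : TauRel 3

/-- The vocabulary with a single ternary relation symbol (collinearity). -/
def tau : FirstOrder.Language.{0, 0} := ⟨fun _ => Empty, TauRel⟩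

/-- `Col a b c` is the interpretation of `R(a, b, c)` in the structure `M`. -/
def Col {M : Type*} [tau.Structure M] (a b c : M) : Prop :=
  FirstOrder.Language.Structure.RelMap (L := tau) (M := M) (n := 3) TauRel.R ![a, b, c]

/-- The class of linear spaces: `R` holds only of triples of distinct points, in any order, and
two distinct points determine at most one non-trivial line. -/
structure IsLinearSpace (M : Type*) [tau.Structure M] : Prop where
  distinct : ∀ a b c : M, Col a b c → a ≠ b ∧ a ≠ c ∧ b ≠ c
  swap : ∀ a b c : M, Col a b c → Col b a c
  rotate : ∀ a b c : M, Col a b c → Col b c a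
  unique_line : ∀ a b c d : M, c ≠ d → Col a b c → Col a b d → Col a c d

section Predimension

variable {M : Type*} [tau.Structure M]

/-- `l` is a line of the finite substructure `A`: it has at least two points, all its points are
collinear, and it contains every point of `A` collinear with two of its points. -/
def IsLineOf (A l : Finset M) : Prop :=
  l ⊆ A ∧ 2 ≤ l.card ∧
    (∀ a ∈ l, ∀ b ∈ l, ∀ c ∈ l, a ≠ b → a ≠ c → b ≠ c → Col a b c) ∧
    (∀ a ∈ l, ∀ b ∈ l, ∀ c ∈ A, Col a b c → c ∈ l)

open scoped Classical in
/-- The set `L(A)` of lines of the finite substructure `A`. -/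
noncomputable def lines (A : Finset M) : Finset (Finset M) :=
  A.powerset.filter (fun l => IsLineOf A l)

/-- The predimension `δ(A) = |A| - ∑ (|l| - 2)`, the sum being over the lines `l` of `A`. -/
noncomputable def delta (A : Finset M) : ℤ :=
  (A.card : ℤ) - ∑ l ∈ lines A, ((l.card : ℤ) - 2)

/-- `A ≤ S`: the finite set `A` is a strong substructure of `S`. -/
def Strong (A : Finset M) (S : Set M) : Prop :=
  (A : Set M) ⊆ S ∧ ∀ X : Finset M, A ⊆ X → (X : Set M) ⊆ S → delta A ≤ delta X

open scoped Classical in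
/-- The pair of disjoint finite sets `(B, C)` is `0`-primitive: `C` is non-empty, `B ≤ B ∪ C`,
nothing lies strictly between `B` and `B ∪ C` in the sense of `≤`, and `δ(B ∪ C) = δ(B)`. -/
def IsZeroPrimitive (B C : Finset M) : Prop :=
  C.Nonempty ∧ Disjoint B C ∧ Strong B ((B ∪ C : Finset M) : Set M) ∧
    (¬ ∃ A : Finset M, B ⊂ A ∧ A ⊂ B ∪ C ∧
      Strong B (A : Set M) ∧ Strong A ((B ∪ C : Finset M) : Set M)) ∧
    delta (B ∪ C) = delta B

/-- The pair `(B, C)` is good: it is `0`-primitive, and `C` is not `0`-primitive over any proper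
subset of `B`. -/
def IsGood (B C : Finset M) : Prop :=
  IsZeroPrimitive B C ∧ ∀ B' : Finset M, B' ⊂ B → ¬ IsZeroPrimitive B' C

end Predimension

/-- The class `K₀`: finite linear spaces all of whose subsets have non-negative predimension. -/
structure InK0 (M : Type*) [tau.Structure M] : Prop where
  finite : Finite M
  linear : IsLinearSpace M
  delta_nonneg : ∀ A : Finset M, 0 ≤ delta A

/-- A good pair in `K₀`, on a standard carrier: a structure on `Fin n` which belongs to `K₀`
together with a set `base` such that `(base, baseᶜ)` is a good pair. Every good pair `(B, C)` in
a member of `K₀` is isomorphic to one of these (number the points of `B ∪ C`). -/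
structure GoodPair where
  n : ℕ
  [str : tau.Structure (Fin n)]
  base : Finset (Fin n)
  inK0 : InK0 (Fin n)
  good : IsGood base baseᶜ

instance (P : GoodPair) : tau.Structure (Fin P.n) := P.str

namespace GoodPair

/-- The extension part `C` of the good pair `(B, C)`. -/
def ext (P : GoodPair) : Finset (Fin P.n) := P.baseᶜ

/-- Isomorphism of good pairs: an isomorphism of structures which maps base onto base (hence
extension part onto extension part). -/
def Iso (P Q : GoodPair) : Prop :=
  ∃ e : Fin P.n ≃[tau] Fin Q.n, ∀ x, x ∈ P.base ↔ e x ∈ Q.base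

instance isoSetoid : Setoid GoodPair where
  r := Iso
  iseqv :=
    { refl := fun P => ⟨FirstOrder.Language.Equiv.refl tau (Fin P.n), fun _ => Iff.rfl⟩
      symm := by
        rintro P Q ⟨e, he⟩
        refine ⟨e.symm, fun x => ?_⟩
        rw [he (e.symm x), FirstOrder.Language.Equiv.apply_symm_apply]
      trans := by
        rintro P Q S ⟨e, he⟩ ⟨f, hf⟩
        exact ⟨f.comp e, fun x => (he x).trans (hf (e x))⟩ }

/-- The pair is of the form `({b₁, b₂}, {a})` with `R(b₁, b₂, a)`; all such pairs are isomorphic,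
and their isomorphism type is usually called `α`. -/
def IsAlpha (P : GoodPair) : Prop :=
  ∃ b₁ b₂ a : Fin P.n, P.base = {b₁, b₂} ∧ P.ext = {a} ∧ Col b₁ b₂ a

end GoodPair

/-- Isomorphism types of good pairs in `K₀`. -/
def GoodPairType : Type := Quotient GoodPair.isoSetoid

/-- The isomorphism type of a good pair. -/
def GoodPair.type (P : GoodPair) : GoodPairType := Quotient.mk GoodPair.isoSetoid P

/-- The collection `𝒰` of functions `μ` on isomorphism types of good pairs with
`μ(B, C) ≥ δ(B)` if `C` has at least two points, and `μ(α) ≥ 1`. -/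
def admissible : Set (GoodPairType → ℕ) :=
  {μ | ∀ P : GoodPair,
    (2 ≤ P.ext.card → delta P.base ≤ (μ P.type : ℤ)) ∧ (P.IsAlpha → 1 ≤ μ P.type)}

/-- The sets which are copies in `M` of the extension part of the good pair `P` over its base,
when the base is placed in `M` by `f`: images of the extension part under embeddings of the pair
which extend `f`. (There are none unless `f` is itself an embedding.) -/
def copies (P : GoodPair) {M : Type*} [tau.Structure M] (f : P.base → M) : Set (Set M) :=
  {D | ∃ g : Fin P.n ↪[tau] M, (∀ x : P.base, g x = f x) ∧ D = g '' (P.ext : Set (Fin P.n))}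

/-- `χ_M(B, C)`: the (maximal) number of pairwise disjoint copies of `C` over `B` in `M`. -/
noncomputable def chi (P : GoodPair) {M : Type*} [tau.Structure M] (f : P.base → M) : ℕ∞ :=
  ⨆ S : {S : Set (Set M) // S ⊆ copies P f ∧ S.PairwiseDisjoint id}, (S : Set (Set M)).encard

/-- The class `K_μ`: members `M` of `K₀` with `χ_M(B, C) ≤ μ(B, C)` for every good pair. -/
def InK (μ : GoodPairType → ℕ) (M : Type*) [tau.Structure M] : Prop :=
  InK0 M ∧ ∀ (P : GoodPair) (f : P.base → M), chi P f ≤ (μ P.type : ℕ∞)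

/-- The universal class generated by `K_μ`: every finite substructure is in `K_μ`. -/
def InHatK (μ : GoodPairType → ℕ) (M : Type*) [tau.Structure M] : Prop :=
  ∀ S : tau.Substructure M, Finite S → InK μ S

/-- An embedding of a finite structure is strong if its image is a strong substructure. -/
def IsStrongEmbedding {A M : Type*} [tau.Structure A] [tau.Structure M] [Fintype A]
    (i : A ↪[tau] M) : Prop :=
  Strong (Finset.univ.map i.toEmbedding) Set.univ

/-- `G` is a generic structure for `(K_μ, ≤)`: it is countable, lies in the universal class
generated by `K_μ`, is the union of its finite strong substructures (in the directed sense), and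
if `A ≤ G` is finite and `A ≤ B ∈ K_μ` then `B` embeds strongly into `G` over `A`. -/
structure IsGeneric (μ : GoodPairType → ℕ) (G : Type*) [tau.Structure G] : Prop where
  countable : Countable G
  inHatK : InHatK μ G
  exhausted : ∀ X : Finset G, ∃ Y : Finset G, X ⊆ Y ∧ Strong Y Set.univ
  extension : ∀ (A B : Type) [Fintype A] [Fintype B] [tau.Structure A] [tau.Structure B],
    InK μ B → ∀ (i : A ↪[tau] B) (f : A ↪[tau] G),
      IsStrongEmbedding i → IsStrongEmbedding f →
        ∃ g : B ↪[tau] G, IsStrongEmbedding g ∧ ∀ a, g (i a) = f a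

/-- `M` is a Steiner `k`-system: a linear space in which the line through any two distinct points
`a`, `b` has exactly `k` points. -/
def IsSteinerSystem (k : ℕ) (M : Type*) [tau.Structure M] : Prop :=
  IsLinearSpace M ∧ ∀ a b : M, a ≠ b → {x : M | x = a ∨ x = b ∨ Col a b x}.encard = (k : ℕ∞)

end SteinerGeneric

/-!
The functions `μ` in the family satisfy `μ(α) = 1`. Then two points of a member of `K_μ` lie in at
most one collinear triple, so the members of `K_μ` are partial Steiner triple systems, and the
predimension is `δ(X) = |X| - #{blocks in X}` (`IsTripleSystem.delta_eq`). This function is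
submodular, and a free amalgam over a common part is modular for it.

*Amalgamation.* It is enough to amalgamate `F` with a minimal strong extension `E` of a common
strong part `D`. If a block of `E` and a block of `F` share two points of `D`, then `E` has just one
point outside `D`, and it is identified with a point of `F`. Otherwise take the free amalgam. If it
is not in `K_μ`, some good pair `(A, B)` has more than `μ(A, B) ≥ δ(A)` disjoint copies `Bᵢ` over a
fixed `A`. The bound `IsTripleSystem.card_le_of_not_subset`, a computation with submodularity,
limits the number of copies by `δ(A)` when `A` is not contained in a strong set which all copies
meet. Hence `A ⊆ D`; one of the copies is `E \ D`, and another one is disjoint from `E`, so that `E`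
embeds into `F` over `D` (`amalgamation_minimal`).

*Generic structures.* A generic structure is the union of an ideal, in the countable set of finite
members of `K_μ` on initial segments of `ℕ` ordered by strong extension, which meets the countably
many cofinal sets given by the extension problems (`exists_generic`). If some two points of a
generic structure were in no block, then a new point completing a block with them could be added to
a finite strong subset without leaving `K_μ` (`exists_extend_block`), and realizing this extension
would give a contradiction; so generic structures are Steiner triple systems.

*Different theories.* For each `k` a cycle of length `2 (k + 2)` whose edges are completed to blocks
alternately by two base points is a good pair, `cyclePair k`. For a set `S` of natural numbers the
function `bound S` allows one more copy of `cyclePair k` exactly when `k ∈ S`, and is larger than `4`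
on the other types with at least two points in the extension part. In a family of `m` disjoint
cycles over the same base points, every packing of more than four copies is one of cycles
(`cyc_packing`), because each point of a cycle lies in two blocks only. Hence a suitable finite
structure `Witness k` is in the class given by `bound S` if and only if `k ∈ S`, that is, if and
only if it embeds into the corresponding generic structure, and this is a first-order property.
-/

namespace SteinerGeneric
open FirstOrder
open scoped Classical

/-! ### Partial Steiner triple systems -/

section TripleSystems

variable {M N : Type*} [tau.Structure M] [tau.Structure N]

/-- A partial Steiner triple system: a linear space in which all lines have at most three points. -/
structure IsTripleSystem (M : Type*) [tau.Structure M] : Prop extends IsLinearSpace M where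
  third : ∀ a b c d : M, Col a b c → Col a b d → c = d

/-- A block: the set of points of a collinear triple. -/
def IsBlock (s : Finset M) : Prop := ∃ a b c : M, Col a b c ∧ s = {a, b, c}

/-- The blocks contained in `X`. -/
noncomputable def blocks (X : Finset M) : Finset (Finset M) := X.powerset.filter IsBlock

theorem mem_blocks {X s : Finset M} : s ∈ blocks X ↔ s ⊆ X ∧ IsBlock s := by
  simp [blocks]

theorem IsLinearSpace.block_card (h : IsLinearSpace M) {s : Finset M} (hs : IsBlock s) :
    s.card = 3 := by
  obtain ⟨a, b, c, hc, rfl⟩ := hs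
  obtain ⟨h1, h2, h3⟩ := h.distinct a b c hc
  exact Finset.card_eq_three.2 ⟨a, b, c, h1, h2, h3, rfl⟩

theorem IsLinearSpace.col_of_mem (h : IsLinearSpace M) {s : Finset M} (hs : IsBlock s)
    {a b c : M} (ha : a ∈ s) (hb : b ∈ s) (hc : c ∈ s) (hab : a ≠ b) (hac : a ≠ c)
    (hbc : b ≠ c) : Col a b c := by
  obtain ⟨x, y, z, hx, rfl⟩ := hs
  have h1 := h.rotate _ _ _ hx
  have h2 := h.rotate _ _ _ h1
  have h3 := h.swap _ _ _ hx
  have h4 := h.swap _ _ _ h1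
  have h5 := h.swap _ _ _ h2
  simp only [Finset.mem_insert, Finset.mem_singleton] at ha hb hc
  rcases ha with rfl | rfl | rfl <;> rcases hb with rfl | rfl | rfl <;>
    rcases hc with rfl | rfl | rfl <;> first | assumption | exact absurd rfl ‹_›

theorem IsLinearSpace.col_iff_isBlock (h : IsLinearSpace M) {a b c : M} :
    Col a b c ↔ IsBlock ({a, b, c} : Finset M) := by
  refine ⟨fun hc => ⟨a, b, c, hc, rfl⟩, fun hb => ?_⟩
  have h3 := h.block_card hb
  have hab : a ≠ b := by
    rintro rfl
    have := Finset.card_le_two (a := a) (b := c)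
    simp at h3; omega
  have hac : a ≠ c := by
    rintro rfl
    have := Finset.card_le_two (a := b) (b := a)
    simp at h3; omega
  have hbc : b ≠ c := by
    rintro rfl
    have := Finset.card_le_two (a := a) (b := b)
    simp at h3; omega
  exact h.col_of_mem hb (by simp) (by simp) (by simp) hab hac hbc

/-- Two points lie in at most one block. -/
theorem IsTripleSystem.block_eq (h : IsTripleSystem M) {s t : Finset M} (hs : IsBlock s)
    (ht : IsBlock t) {a b : M} (hab : a ≠ b) (has : a ∈ s) (hbs : b ∈ s) (hat : a ∈ t)
    (hbt : b ∈ t) : s = t := by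
  refine Finset.eq_of_subset_of_card_le (fun c hc => ?_)
    (by rw [h.block_card hs, h.block_card ht])
  by_contra hct
  have hac : a ≠ c := fun e => hct (e ▸ hat)
  have hbc : b ≠ c := fun e => hct (e ▸ hbt)
  have h2 : 0 < ((t.erase a).erase b).card := by
    rw [Finset.card_erase_of_mem (by simp [hab.symm, hbt]), Finset.card_erase_of_mem hat,
      h.block_card ht]; norm_num
  obtain ⟨d, hd⟩ := Finset.card_pos.1 h2
  simp only [Finset.mem_erase] at hd
  have := h.third a b c d (h.col_of_mem hs has hbs hc hab hac hbc)
    (h.col_of_mem ht hat hbt hd.2.2 hab hd.2.1.symm hd.1.symm)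
  exact hct (this ▸ hd.2.2)

theorem IsTripleSystem.line_card_le (h : IsTripleSystem M) {X l : Finset M} (hl : IsLineOf X l) :
    l.card ≤ 3 := by
  by_contra! h4
  obtain ⟨a, ha, b, hb, c, hc, d, hd, hab, hac, had, hbc, hbd, hcd⟩ :=
    Finset.three_lt_card.1 h4
  exact hcd (h.third a b c d (hl.2.2.1 a ha b hb c hc hab hac hbc)
    (hl.2.2.1 a ha b hb d hd hab had hbd))

theorem IsTripleSystem.blocks_eq (h : IsTripleSystem M) (X : Finset M) :
    blocks X = (lines X).filter (fun l => l.card = 3) := by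
  ext s
  simp only [mem_blocks, lines, Finset.mem_filter, Finset.mem_powerset]
  constructor
  · rintro ⟨hX, hs⟩
    refine ⟨⟨hX, hX, by rw [h.block_card hs]; norm_num,
      fun a ha b hb c hc => h.col_of_mem hs ha hb hc, ?_⟩, h.block_card hs⟩
    intro a ha b hb c _ hcol
    have := h.block_eq hs (h.col_iff_isBlock.1 hcol) (h.distinct _ _ _ hcol).1 ha hb
      (by simp) (by simp)
    simp [this]
  · rintro ⟨⟨hX, hl⟩, h3⟩
    obtain ⟨a, b, c, hab, hac, hbc, rfl⟩ := Finset.card_eq_three.1 h3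
    exact ⟨hX, a, b, c, hl.2.2.1 a (by simp) b (by simp) c (by simp) hab hac hbc, rfl⟩

/-- In a partial triple system the predimension is the number of points minus the number of
blocks: two-point lines do not contribute. -/
theorem IsTripleSystem.delta_eq (h : IsTripleSystem M) (X : Finset M) :
    delta X = (X.card : ℤ) - (blocks X).card := by
  rw [delta, h.blocks_eq, Finset.card_filter]
  push_cast
  congr 1
  refine Finset.sum_congr rfl fun l hl => ?_
  have hl' : IsLineOf X l := (Finset.mem_filter.1 hl).2
  have h3 := h.line_card_le hl'
  have h2 := hl'.2.1
  split_ifs with h0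
  · simp [h0]
  · have : l.card = 2 := by omega
    simp [this]

theorem delta_le_card (X : Finset M) : delta X ≤ X.card := by
  rw [delta]
  have : (0 : ℤ) ≤ ∑ l ∈ lines X, ((l.card : ℤ) - 2) := by
    refine Finset.sum_nonneg fun l hl => ?_
    have hl' : IsLineOf X l := (Finset.mem_filter.1 hl).2
    have := hl'.2.1
    omega
  linarith

theorem blocks_mono {X Y : Finset M} (h : X ⊆ Y) : blocks X ⊆ blocks Y := fun _ hs =>
  mem_blocks.2 ⟨(mem_blocks.1 hs).1.trans h, (mem_blocks.1 hs).2⟩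

theorem blocks_inter (X Y : Finset M) : blocks (X ∩ Y) = blocks X ∩ blocks Y := by
  ext s
  simp only [mem_blocks, Finset.mem_inter, Finset.subset_inter_iff]
  tauto

/-- The predimension is submodular. -/
theorem IsTripleSystem.delta_union_add_inter_le (h : IsTripleSystem M) (X Y : Finset M) :
    delta (X ∪ Y) + delta (X ∩ Y) ≤ delta X + delta Y := by
  have h1 := Finset.card_union_add_card_inter X Y
  have h2 := Finset.card_union_add_card_inter (blocks X) (blocks Y)
  have h3 : (blocks X ∪ blocks Y).card ≤ (blocks (X ∪ Y)).card :=
    Finset.card_le_card (Finset.union_subset (blocks_mono Finset.subset_union_left)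
      (blocks_mono Finset.subset_union_right))
  rw [← blocks_inter] at h2
  simp only [h.delta_eq]
  omega

/-- The predimension is modular on a free amalgam. -/
theorem IsTripleSystem.delta_union_add_inter_eq (h : IsTripleSystem M) {X Y : Finset M}
    (hf : ∀ s ∈ blocks (X ∪ Y), s ⊆ X ∨ s ⊆ Y) :
    delta (X ∪ Y) + delta (X ∩ Y) = delta X + delta Y := by
  have h1 := Finset.card_union_add_card_inter X Y
  have h2 := Finset.card_union_add_card_inter (blocks X) (blocks Y)
  have h3 : (blocks X ∪ blocks Y) = blocks (X ∪ Y) := by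
    refine (Finset.union_subset (blocks_mono Finset.subset_union_left)
      (blocks_mono Finset.subset_union_right)).antisymm fun s hs => ?_
    rcases hf s hs with h' | h'
    · exact Finset.mem_union_left _ (mem_blocks.2 ⟨h', (mem_blocks.1 hs).2⟩)
    · exact Finset.mem_union_right _ (mem_blocks.2 ⟨h', (mem_blocks.1 hs).2⟩)
  rw [← blocks_inter, h3] at h2
  simp only [h.delta_eq]
  omega

/-- For disjoint `X` and `Y`, the relative predimension of `Y` over `X` is the number of points of
`Y` minus the number of blocks of `X ∪ Y` not contained in `X`. -/
theorem IsTripleSystem.delta_union_eq (h : IsTripleSystem M) {X Y : Finset M}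
    (hd : Disjoint X Y) :
    delta (X ∪ Y) = delta X + Y.card - ((blocks (X ∪ Y)).filter (fun s => ¬ s ⊆ X)).card := by
  have h1 := Finset.card_union_of_disjoint hd
  have h2 := Finset.card_filter_add_card_filter_not (s := blocks (X ∪ Y)) (fun s => s ⊆ X)
  have h3 : (blocks (X ∪ Y)).filter (fun s => s ⊆ X) = blocks X := by
    ext s
    simp only [Finset.mem_filter, mem_blocks]
    constructor
    · rintro ⟨⟨_, h⟩, h'⟩; exact ⟨h', h⟩
    · rintro ⟨h', h⟩; exact ⟨⟨h'.trans Finset.subset_union_left, h⟩, h'⟩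
  rw [h3] at h2
  simp only [h.delta_eq]
  omega

@[simp] theorem IsTripleSystem.delta_empty (h : IsTripleSystem M) :
    delta (∅ : Finset M) = 0 := by
  have : blocks (∅ : Finset M) = ∅ := by
    refine Finset.eq_empty_of_forall_notMem fun s hs => ?_
    obtain ⟨h1, h2⟩ := mem_blocks.1 hs
    have := h.block_card h2
    simp [Finset.subset_empty.1 h1] at this
  simp [h.delta_eq, this]

/-! ### Embeddings -/

@[simp] theorem toEmbedding_apply (g : M ↪[tau] N) (a : M) : g.toEmbedding a = g a := rfl

theorem col_map (g : M ↪[tau] N) {a b c : M} : Col (g a) (g b) (g c) ↔ Col a b c := by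
  have := g.map_rel (n := 3) TauRel.R ![a, b, c]
  unfold Col
  rw [← this]
  congr! 1
  funext i
  fin_cases i <;> rfl

/-- An injective map which preserves and reflects collinearity is an embedding. -/
def embeddingOfCol (g : M → N) (hg : Function.Injective g)
    (hc : ∀ a b c, Col (g a) (g b) (g c) ↔ Col a b c) : M ↪[tau] N where
  toFun := g
  inj' := hg
  map_fun' := fun f => nomatch f
  map_rel' := by
    intro n r x
    cases r
    have := hc (x 0) (x 1) (x 2)
    unfold Col at this
    convert this using 2
    · funext i; fin_cases i <;> rfl
    · funext i; fin_cases i <;> rfl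

theorem IsLinearSpace.of_embedding (h : IsLinearSpace N) (g : M ↪[tau] N) : IsLinearSpace M where
  distinct a b c hc := by
    have := h.distinct _ _ _ ((col_map g).2 hc)
    exact ⟨fun e => this.1 (e ▸ rfl), fun e => this.2.1 (e ▸ rfl), fun e => this.2.2 (e ▸ rfl)⟩
  swap a b c hc := (col_map g).1 (h.swap _ _ _ ((col_map g).2 hc))
  rotate a b c hc := (col_map g).1 (h.rotate _ _ _ ((col_map g).2 hc))
  unique_line _ _ _ _ hn h1 h2 := (col_map g).1
    (h.unique_line _ _ _ _ (g.injective.ne hn) ((col_map g).2 h1) ((col_map g).2 h2))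

theorem IsTripleSystem.of_embedding (h : IsTripleSystem N) (g : M ↪[tau] N) :
    IsTripleSystem M where
  toIsLinearSpace := h.toIsLinearSpace.of_embedding g
  third _ _ _ _ h1 h2 := g.injective (h.third _ _ _ _ ((col_map g).2 h1) ((col_map g).2 h2))

theorem isBlock_map (g : M ↪[tau] N) {s : Finset M} :
    IsBlock (s.map g.toEmbedding) ↔ IsBlock s := by
  constructor
  · rintro ⟨a, b, c, hc, hs⟩
    have hmem : ∀ x ∈ ({a, b, c} : Finset N), ∃ y ∈ s, g y = x := by
      intro x hx
      rw [← hs] at hx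
      simpa using hx
    obtain ⟨a', _, rfl⟩ := hmem a (by simp)
    obtain ⟨b', _, rfl⟩ := hmem b (by simp)
    obtain ⟨c', _, rfl⟩ := hmem c (by simp)
    refine ⟨a', b', c', (col_map g).1 hc, Finset.map_injective g.toEmbedding ?_⟩
    rw [hs]
    ext x
    simp
  · rintro ⟨a, b, c, hc, rfl⟩
    exact ⟨g a, g b, g c, (col_map g).2 hc, by ext x; simp⟩

theorem exists_map_eq_of_subset {α β : Type*} {f : α ↪ β} {X : Finset α} {Y : Finset β}
    (h : Y ⊆ X.map f) : ∃ Z ⊆ X, Z.map f = Y := by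
  obtain ⟨Z, hZ, rfl⟩ := Finset.subset_map_iff.1 h
  exact ⟨Z, hZ, rfl⟩

theorem blocks_map (g : M ↪[tau] N) (X : Finset M) :
    blocks (X.map g.toEmbedding) =
      (blocks X).map (Finset.mapEmbedding g.toEmbedding).toEmbedding := by
  ext s
  simp only [mem_blocks, Finset.mem_map]
  constructor
  · rintro ⟨h1, h2⟩
    obtain ⟨t, ht, rfl⟩ := exists_map_eq_of_subset h1
    exact ⟨t, ⟨ht, (isBlock_map g).1 h2⟩, rfl⟩
  · rintro ⟨t, ⟨h1, h2⟩, rfl⟩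
    exact ⟨Finset.map_subset_map.2 h1, (isBlock_map g).2 h2⟩

theorem IsTripleSystem.delta_map (h : IsTripleSystem N) (g : M ↪[tau] N) (X : Finset M) :
    delta (X.map g.toEmbedding) = delta X := by
  rw [h.delta_eq, (h.of_embedding g).delta_eq, blocks_map, Finset.card_map, Finset.card_map]

/-- An embedding whose image lies in the image of `i` factors through `i`. -/
theorem exists_factor {K : Type*} [tau.Structure K] (i : N ↪[tau] M) (g : K ↪[tau] M)
    (h : ∀ x, ∃ y, i y = g x) : ∃ g' : K ↪[tau] N, ∀ x, i (g' x) = g x := by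
  choose g' hg' using h
  refine ⟨embeddingOfCol g' (fun a b hab => g.injective ?_) (fun a b c => ?_), hg'⟩
  · rw [← hg', ← hg', hab]
  · rw [← col_map i, hg', hg', hg', col_map g]

/-- The induced substructure on a set of points. -/
def sub (U : Set M) : tau.Substructure M := ⟨U, fun f => nomatch f⟩

/-! ### Structures given by their blocks -/

/-- The structure on `X` whose collinear triples are those with point set in `T`. -/
@[reducible] def structureOfBlocks {X : Type*} (T : Set (Finset X)) : tau.Structure X where
  funMap f := nomatch f
  RelMap {n} r v := match n, r, v with
    | _, TauRel.R, v => ({v 0, v 1, v 2} : Finset X) ∈ T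

theorem col_structureOfBlocks {X : Type*} (T : Set (Finset X)) {a b c : X} :
    @Col X (structureOfBlocks T) a b c ↔ ({a, b, c} : Finset X) ∈ T := Iff.rfl

/-- A family of three-element sets, any two of which share at most one point, is the family of
blocks of a partial triple system. -/
theorem isTripleSystem_structureOfBlocks {X : Type*} (T : Set (Finset X))
    (h3 : ∀ s ∈ T, s.card = 3)
    (h1 : ∀ s ∈ T, ∀ t ∈ T, ∀ a b, a ≠ b → a ∈ s → b ∈ s → a ∈ t → b ∈ t → s = t) :
    @IsTripleSystem X (structureOfBlocks T) := by
  let := structureOfBlocks T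
  have hd : ∀ a b c : X, Col a b c → a ≠ b ∧ a ≠ c ∧ b ≠ c := by
    intro a b c h
    have h' := h3 _ ((col_structureOfBlocks T).1 h)
    refine ⟨?_, ?_, ?_⟩
    · rintro rfl
      have := Finset.card_le_two (a := a) (b := c)
      simp at h'; omega
    · rintro rfl
      have := Finset.card_le_two (a := b) (b := a)
      simp at h'; omega
    · rintro rfl
      have := Finset.card_le_two (a := a) (b := b)
      simp at h'; omega
  have hthird : ∀ a b c d : X, Col a b c → Col a b d → c = d := by
    intro a b c d hc hd'
    have h := h1 _ ((col_structureOfBlocks T).1 hc) _ ((col_structureOfBlocks T).1 hd') a b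
      (hd _ _ _ hc).1 (by simp) (by simp) (by simp) (by simp)
    have hc' : c ∈ ({a, b, d} : Finset X) := by rw [← h]; simp
    have := hd _ _ _ hc
    simp only [Finset.mem_insert, Finset.mem_singleton] at hc'
    rcases hc' with h | h | h
    · exact absurd h.symm this.2.1
    · exact absurd h.symm this.2.2
    · exact h
  refine ⟨⟨hd, fun a b c h => ?_, fun a b c h => ?_, fun a b c d hn h h' => ?_⟩, hthird⟩
  · rw [col_structureOfBlocks] at h ⊢
    convert h using 1
    ext; simp; tauto
  · rw [col_structureOfBlocks] at h ⊢
    convert h using 1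
    ext; simp; tauto
  · exact absurd (hthird _ _ _ _ h h') hn

theorem isBlock_structureOfBlocks {X : Type*} (T : Set (Finset X))
    (h3 : ∀ s ∈ T, s.card = 3) {s : Finset X} :
    @IsBlock X (structureOfBlocks T) s ↔ s ∈ T := by
  let := structureOfBlocks T
  constructor
  · rintro ⟨a, b, c, h, rfl⟩
    exact h
  · intro h
    obtain ⟨a, b, c, _, _, _, rfl⟩ := Finset.card_eq_three.1 (h3 s h)
    exact ⟨a, b, c, h, rfl⟩

end TripleSystems

section Primitive

variable {M N : Type*} [tau.Structure M] [tau.Structure N]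

/-! ### Strong subsets and good pairs -/

theorem strong_univ_iff {E : Finset M} :
    Strong E Set.univ ↔ ∀ X, E ⊆ X → delta E ≤ delta X :=
  ⟨fun h X hX => h.2 X hX (Set.subset_univ _),
    fun h => ⟨Set.subset_univ _, fun X hX _ => h X hX⟩⟩

/-- Intersecting with a strong set does not increase the predimension. -/
theorem IsTripleSystem.delta_inter_le (h : IsTripleSystem M) {E : Finset M}
    (hE : Strong E Set.univ) (X : Finset M) : delta (X ∩ E) ≤ delta X := by
  have h1 := h.delta_union_add_inter_le X E
  have h2 := strong_univ_iff.1 hE (X ∪ E) Finset.subset_union_right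
  linarith

/-- A reformulation of `IsZeroPrimitive` in terms of the predimension only: `B` adds nothing to
the predimension of `A`, but every non-empty proper part of `B` increases it. -/
structure Prim (A B : Finset M) : Prop where
  nonempty : B.Nonempty
  disjoint : Disjoint A B
  delta_eq : delta (A ∪ B) = delta A
  lt : ∀ Y ⊆ B, Y.Nonempty → Y ≠ B → delta A < delta (A ∪ Y)

theorem Prim.le {A B : Finset M} (h : Prim A B) {Y : Finset M} (hY : Y ⊆ B) :
    delta A ≤ delta (A ∪ Y) := by
  rcases Y.eq_empty_or_nonempty with rfl | hne
  · simp
  · by_cases hB : Y = B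
    · rw [hB, h.delta_eq]
    · exact (h.lt Y hY hne hB).le

theorem isZeroPrimitive_iff {A B : Finset M} : IsZeroPrimitive A B ↔ Prim A B := by
  have key : ∀ X : Finset M, A ⊆ X → X ⊆ A ∪ B → ∃ Y ⊆ B, X = A ∪ Y := by
    intro X h1 h2
    refine ⟨X ∩ B, Finset.inter_subset_right, ?_⟩
    rw [Finset.union_inter_distrib_left, Finset.union_eq_right.2 h1,
      Finset.inter_eq_left.2 h2]
  constructor
  · rintro ⟨h1, h2, h3, h4, h5⟩
    refine ⟨h1, h2, h5, fun Y hY hne hYB => ?_⟩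
    have hle := h3.2 (A ∪ Y) Finset.subset_union_left
      (Finset.coe_subset.2 (Finset.union_subset_union_right hY))
    refine lt_of_le_of_ne hle fun heq => h4 ⟨A ∪ Y, ?_, ?_, ?_, ?_⟩
    · refine Finset.ssubset_iff_subset_ne.2 ⟨Finset.subset_union_left, fun e => ?_⟩
      obtain ⟨y, hy⟩ := hne
      exact Finset.disjoint_left.1 h2 (e ▸ Finset.mem_union_right A hy) (hY hy)
    · refine Finset.ssubset_iff_subset_ne.2 ⟨Finset.union_subset_union_right hY, fun e => ?_⟩
      refine hYB (hY.antisymm fun b hb => ?_)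
      have : b ∈ A ∪ Y := e ▸ Finset.mem_union_right A hb
      exact (Finset.mem_union.1 this).resolve_left (Finset.disjoint_right.1 h2 hb)
    · exact ⟨Finset.coe_subset.2 Finset.subset_union_left, fun X hX hX' => h3.2 X hX
        (hX'.trans (Finset.coe_subset.2 (Finset.union_subset_union_right hY)))⟩
    · exact ⟨Finset.coe_subset.2 (Finset.union_subset_union_right hY),
        fun X hX hX' => heq ▸ h3.2 X (Finset.subset_union_left.trans hX) hX'⟩
  · intro h
    refine ⟨h.nonempty, h.disjoint, ⟨Finset.coe_subset.2 Finset.subset_union_left, ?_⟩, ?_,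
      h.delta_eq⟩
    · intro X h1 h2
      obtain ⟨Y, hY, rfl⟩ := key X h1 (Finset.coe_subset.1 h2)
      exact h.le hY
    · rintro ⟨X, h1, h2, -, h4⟩
      obtain ⟨Y, hY, rfl⟩ := key X h1.subset h2.subset
      have hYB : Y ≠ B := fun e => h2.ne (by rw [e])
      have hne : Y.Nonempty := by
        rw [Finset.nonempty_iff_ne_empty]
        rintro rfl
        simp at h1
      have h5 := h.lt Y hY hne hYB
      have h6 := h4.2 (A ∪ B) h2.subset subset_rfl
      rw [h.delta_eq] at h6
      omega

/-- What the argument uses about a good pair: it is primitive, and each point of the base lies in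
a block which meets the extension part. -/
structure GoodIn (A B : Finset M) : Prop extends Prim A B where
  touches : ∀ a ∈ A, ∃ s ∈ blocks (A ∪ B), a ∈ s ∧ ¬ Disjoint s B

theorem IsTripleSystem.goodIn (h : IsTripleSystem M) {A B : Finset M} (hg : IsGood A B) :
    GoodIn A B := by
  have hp := isZeroPrimitive_iff.1 hg.1
  refine ⟨hp, fun a ha => ?_⟩
  by_contra! hcon
  -- a point of the base in no such block can be dropped from the base
  have key : ∀ Y ⊆ B, delta (A.erase a ∪ Y) - delta (A.erase a) = delta (A ∪ Y) - delta A := by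
    intro Y hY
    have hd : Disjoint A Y := hp.disjoint.mono_right hY
    have hd' : Disjoint (A.erase a) Y := hd.mono_left (Finset.erase_subset _ _)
    rw [h.delta_union_eq hd, h.delta_union_eq hd']
    have : (blocks (A.erase a ∪ Y)).filter (fun s => ¬ s ⊆ A.erase a) =
        (blocks (A ∪ Y)).filter (fun s => ¬ s ⊆ A) := by
      ext s
      simp only [Finset.mem_filter, mem_blocks]
      constructor
      · rintro ⟨⟨h1, h2⟩, h3⟩
        refine ⟨⟨h1.trans (Finset.union_subset_union_left (Finset.erase_subset _ _)), h2⟩,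
          fun h4 => h3 fun x hx => ?_⟩
        exact (Finset.mem_union.1 (h1 hx)).resolve_right (Finset.disjoint_left.1 hd (h4 hx))
      · rintro ⟨⟨h1, h2⟩, h3⟩
        obtain ⟨y, hys, hyA⟩ := Finset.not_subset.1 h3
        have hyY := (Finset.mem_union.1 (h1 hys)).resolve_left hyA
        have has : a ∉ s := fun has => by
          have := hcon s (mem_blocks.2 ⟨h1.trans (Finset.union_subset_union_right hY), h2⟩) has
          exact Finset.disjoint_left.1 this hys (hY hyY)
        refine ⟨⟨fun x hx => ?_, h2⟩, fun h4 => h3 (h4.trans (Finset.erase_subset _ _))⟩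
        rcases Finset.mem_union.1 (h1 hx) with h5 | h5
        · exact Finset.mem_union_left _ (Finset.mem_erase.2 ⟨fun e => has (e ▸ hx), h5⟩)
        · exact Finset.mem_union_right _ h5
    rw [this]
    ring
  refine hg.2 (A.erase a) (Finset.erase_ssubset ha) (isZeroPrimitive_iff.2 ⟨hp.nonempty,
    hp.disjoint.mono_left (Finset.erase_subset _ _), ?_, fun Y hY hne hYB => ?_⟩)
  · have := key B subset_rfl
    rw [hp.delta_eq] at this
    linarith
  · have := key Y hY
    have := hp.lt Y hY hne hYB
    linarith

theorem IsTripleSystem.prim_map (h : IsTripleSystem N) (g : M ↪[tau] N) {A B : Finset M} :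
    Prim (A.map g.toEmbedding) (B.map g.toEmbedding) ↔ Prim A B := by
  have hu : ∀ Y : Finset M, delta (A.map g.toEmbedding ∪ Y.map g.toEmbedding) =
      delta (A ∪ Y) := fun Y => by rw [← Finset.map_union, h.delta_map g]
  constructor
  · intro hp
    refine ⟨Finset.map_nonempty.1 hp.nonempty, (Finset.disjoint_map _).1 hp.disjoint, ?_, ?_⟩
    · rw [← hu, hp.delta_eq, h.delta_map g]
    · intro Y hY hne hYB
      have := hp.lt (Y.map g.toEmbedding) (Finset.map_subset_map.2 hY) (hne.map)
        (fun e => hYB (Finset.map_injective _ e))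
      rwa [hu, h.delta_map g] at this
  · intro hp
    refine ⟨hp.nonempty.map, (Finset.disjoint_map _).2 hp.disjoint, ?_, ?_⟩
    · rw [hu, hp.delta_eq, h.delta_map g]
    · intro Y hY hne hYB
      obtain ⟨Z, hZ, rfl⟩ := exists_map_eq_of_subset hY
      rw [hu, h.delta_map g]
      exact hp.lt Z hZ (Finset.map_nonempty.1 hne) (fun e => hYB (by rw [e]))

theorem IsTripleSystem.goodIn_map (h : IsTripleSystem N) (g : M ↪[tau] N) {A B : Finset M}
    (hg : GoodIn A B) : GoodIn (A.map g.toEmbedding) (B.map g.toEmbedding) := by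
  refine ⟨(h.prim_map g).2 hg.toPrim, fun a ha => ?_⟩
  obtain ⟨a, ha', rfl⟩ := Finset.mem_map.1 ha
  obtain ⟨s, hs, has, hsB⟩ := hg.touches a ha'
  refine ⟨s.map g.toEmbedding, ?_, Finset.mem_map_of_mem _ has, ?_⟩
  · rw [← Finset.map_union, blocks_map]
    exact Finset.mem_map_of_mem _ hs
  · rwa [Finset.disjoint_map]

/-- Every point of the extension part of a primitive pair lies in a block which is not contained
in the base: otherwise deleting it would lower the predimension. -/
theorem IsTripleSystem.exists_block_of_prim (h : IsTripleSystem M) {A B : Finset M}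
    (hp : Prim A B) {b : M} (hb : b ∈ B) : ∃ s ∈ blocks (A ∪ B), b ∈ s := by
  by_contra! hcon
  have hbl : blocks (A ∪ B) = blocks (A ∪ B.erase b) := by
    refine Finset.Subset.antisymm (fun s hs => ?_)
      (blocks_mono (Finset.union_subset_union_right (Finset.erase_subset _ _)))
    have h1 := mem_blocks.1 hs
    refine mem_blocks.2 ⟨fun x hx => ?_, h1.2⟩
    rcases Finset.mem_union.1 (h1.1 hx) with h2 | h2
    · exact Finset.mem_union_left _ h2
    · exact Finset.mem_union_right _ (Finset.mem_erase.2 ⟨fun e => hcon s hs (e ▸ hx), h2⟩)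
  have h1 := hp.le (Finset.erase_subset b B)
  rw [← hp.delta_eq, h.delta_eq, h.delta_eq, hbl, Finset.card_union_of_disjoint hp.disjoint,
    Finset.card_union_of_disjoint (hp.disjoint.mono_right (Finset.erase_subset _ _)),
    Finset.card_erase_of_mem hb] at h1
  have := Finset.card_pos.2 ⟨b, hb⟩
  omega

/-- A primitive extension of a subset of a strong set is inside that set or disjoint from it. -/
theorem IsTripleSystem.subset_or_disjoint (h : IsTripleSystem M) {E A B : Finset M}
    (hE : Strong E Set.univ) (hp : Prim A B) (hA : A ⊆ E) : B ⊆ E ∨ Disjoint B E := by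
  by_contra! hcon
  have h1 := h.delta_inter_le hE (A ∪ B)
  rw [Finset.union_inter_distrib_right, Finset.inter_eq_left.2 hA, hp.delta_eq] at h1
  have := hp.lt (B ∩ E) Finset.inter_subset_left
    (Finset.not_disjoint_iff_nonempty_inter.1 hcon.2)
    (fun e => hcon.1 (Finset.inter_eq_left.1 e))
  omega

/-- If `B` adds nothing to `A` and does not lower the predimension of a larger set `D`, then `B`
is in no block with points of `D` outside `A`. -/
theorem IsTripleSystem.subset_union_of_block (h : IsTripleSystem M) {A B D s : Finset M}
    (hAD : A ⊆ D) (hd : Disjoint D B) (hAB : delta (A ∪ B) = delta A)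
    (hD : delta D ≤ delta (D ∪ B)) (hs : s ∈ blocks (D ∪ B)) (hsB : ¬ Disjoint s B) :
    s ⊆ A ∪ B := by
  have h1 := h.delta_union_eq hd
  have h2 := h.delta_union_eq (hd.mono_left hAD)
  have hsub : (blocks (A ∪ B)).filter (fun s => ¬ s ⊆ A) ⊆
      (blocks (D ∪ B)).filter (fun s => ¬ s ⊆ D) := by
    intro t ht
    obtain ⟨ht1, ht2⟩ := Finset.mem_filter.1 ht
    refine Finset.mem_filter.2 ⟨blocks_mono (Finset.union_subset_union_left hAD) ht1,
      fun h3 => ht2 fun x hx => ?_⟩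
    exact (Finset.mem_union.1 ((mem_blocks.1 ht1).1 hx)).resolve_right
      (Finset.disjoint_left.1 hd (h3 hx))
  have heq := Finset.eq_of_subset_of_card_le hsub (by omega)
  have hs' : s ∈ (blocks (D ∪ B)).filter (fun s => ¬ s ⊆ D) := by
    refine Finset.mem_filter.2 ⟨hs, fun h3 => hsB ?_⟩
    exact hd.mono_left h3
  rw [← heq] at hs'
  exact (mem_blocks.1 (Finset.mem_filter.1 hs').1).1

/-- The counting bound: if the base `A` of a good pair is not contained in the strong set `E`, then
at most `δ(A)` disjoint copies of the extension part meet `E`. Indeed, copies inside `E` contribute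
pairwise different blocks between `E` and `A`, and every further copy lowers the predimension over
`E ∪ A`, which cannot drop below `δ(E)`. -/
theorem IsTripleSystem.card_le_of_not_subset (h : IsTripleSystem M) {E A : Finset M}
    (hE : Strong E Set.univ) (hpos : 0 ≤ delta (A ∩ E)) {ι : Type*} [Fintype ι]
    {B : ι → Finset M} (hB : ∀ i, GoodIn A (B i))
    (hdis : ∀ i j, i ≠ j → Disjoint (B i) (B j)) (hA : ¬ A ⊆ E)
    (hBE : ∀ i, ¬ Disjoint (B i) E) : (Fintype.card ι : ℤ) ≤ delta A := by
  obtain ⟨a, haA, haE⟩ := Finset.not_subset.1 hA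
  choose s hs has hsB using fun i => (hB i).touches a haA
  set I : Finset ι := Finset.univ.filter (fun i => B i ⊆ E) with hI
  set J : Finset ι := Finset.univ.filter (fun i => ¬ B i ⊆ E) with hJ
  have hIJ : I.card + J.card = Fintype.card ι := by
    rw [hI, hJ, Finset.card_filter_add_card_filter_not, Finset.card_univ]
  have hmeet : ∀ i, ∃ x ∈ s i, x ∈ B i := fun i => Finset.not_disjoint_iff.1 (hsB i)
  -- the copies inside `E`
  have h1 : delta (E ∪ A) + delta (A ∩ E) + I.card ≤ delta E + delta A := by
    have hinj : Set.InjOn s I := by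
      intro i _ j _ hij
      by_contra hne
      obtain ⟨x, hx, hxB⟩ := hmeet i
      have hx' := (mem_blocks.1 (hs j)).1 (hij ▸ hx)
      rcases Finset.mem_union.1 hx' with h2 | h2
      · exact Finset.disjoint_left.1 (hB i).disjoint h2 hxB
      · exact Finset.disjoint_left.1 (hdis i j hne) hxB h2
    have hd : Disjoint (blocks E ∪ blocks A) (I.image s) := by
      rw [Finset.disjoint_right]
      intro t ht ht'
      obtain ⟨i, hi, rfl⟩ := Finset.mem_image.1 ht
      rcases Finset.mem_union.1 ht' with h2 | h2
      · exact haE ((mem_blocks.1 h2).1 (has i))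
      · obtain ⟨x, hx, hxB⟩ := hmeet i
        exact Finset.disjoint_left.1 (hB i).disjoint ((mem_blocks.1 h2).1 hx) hxB
    have hsub : (blocks E ∪ blocks A) ∪ I.image s ⊆ blocks (E ∪ A) := by
      refine Finset.union_subset (Finset.union_subset (blocks_mono Finset.subset_union_left)
        (blocks_mono Finset.subset_union_right)) fun t ht => ?_
      obtain ⟨i, hi, rfl⟩ := Finset.mem_image.1 ht
      have h2 := mem_blocks.1 (hs i)
      refine mem_blocks.2 ⟨h2.1.trans ?_, h2.2⟩
      exact Finset.union_subset Finset.subset_union_right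
        ((Finset.mem_filter.1 hi).2.trans Finset.subset_union_left)
    have h2 := Finset.card_le_card hsub
    rw [Finset.card_union_of_disjoint hd, Finset.card_image_of_injOn hinj] at h2
    have h3 := Finset.card_union_add_card_inter (blocks E) (blocks A)
    have h4 := Finset.card_union_add_card_inter E A
    rw [← blocks_inter] at h3
    rw [Finset.inter_comm A E]
    simp only [h.delta_eq]
    omega
  -- the copies not inside `E`
  have h2 : ∀ T : Finset ι, T ⊆ J →
      delta (E ∪ A ∪ T.biUnion B) + T.card ≤ delta (E ∪ A) := by
    intro T
    induction T using Finset.induction_on with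
    | empty => simp
    | insert i T hi ih =>
      intro hT
      have ih' := ih ((Finset.subset_insert _ _).trans hT)
      have hiJ : ¬ B i ⊆ E := (Finset.mem_filter.1 (hT (Finset.mem_insert_self _ _))).2
      have hsm := h.delta_union_add_inter_le (E ∪ A ∪ T.biUnion B) (A ∪ B i)
      have hU : E ∪ A ∪ T.biUnion B ∪ (A ∪ B i) = E ∪ A ∪ (insert i T).biUnion B := by
        rw [Finset.biUnion_insert]
        ext x; simp only [Finset.mem_union]; tauto
      have hi' : (E ∪ A ∪ T.biUnion B) ∩ (A ∪ B i) = A ∪ (B i ∩ E) := by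
        ext x
        simp only [Finset.mem_union, Finset.mem_inter, Finset.mem_biUnion]
        constructor
        · rintro ⟨(h3 | h3) | ⟨j, hj, h3⟩, h4 | h4⟩
          · exact Or.inl h4
          · exact Or.inr ⟨h4, h3⟩
          · exact Or.inl h4
          · exact Or.inl h3
          · exact Or.inl h4
          · exact absurd h4 (Finset.disjoint_left.1 (hdis j i (fun e => hi (e ▸ hj))) h3)
        · rintro (h3 | h3)
          · exact ⟨Or.inl (Or.inr h3), Or.inl h3⟩
          · exact ⟨Or.inl (Or.inl h3.2), Or.inr h3.1⟩
      rw [hU, hi', (hB i).delta_eq] at hsm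
      have := (hB i).lt (B i ∩ E) Finset.inter_subset_left
        (Finset.not_disjoint_iff_nonempty_inter.1 (hBE i))
        (fun e => hiJ (Finset.inter_eq_left.1 e))
      rw [Finset.card_insert_of_notMem hi]
      push_cast
      linarith
  have h3 := h2 J subset_rfl
  have h4 := strong_univ_iff.1 hE (E ∪ A ∪ J.biUnion B)
    (Finset.subset_union_left.trans Finset.subset_union_left)
  have h5 : ((I.card : ℤ) + J.card) = Fintype.card ι := by exact_mod_cast hIJ
  linarith

end Primitive

/-! ### Packings of copies of a good pair -/

section Packings

variable {M N : Type} [tau.Structure M] [tau.Structure N]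

/-- A family of embeddings of a good pair which agree on the base and map the extension part to
pairwise disjoint sets. The size of such families is what `chi` measures. -/
structure IsPacking (P : GoodPair) {ι : Type} (g : ι → (Fin P.n ↪[tau] M)) : Prop where
  agree : ∀ i j, ∀ x ∈ P.base, g i x = g j x
  disjoint : ∀ i j, i ≠ j →
    Disjoint (P.ext.map (g i).toEmbedding) (P.ext.map (g j).toEmbedding)

theorem GoodPair.ext_nonempty (P : GoodPair) : P.ext.Nonempty := P.good.1.1

theorem chi_le_iff (P : GoodPair) (m : ℕ) :
    (∀ f : P.base → M, chi P f ≤ (m : ℕ∞)) ↔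
      ∀ (ι : Type) [Fintype ι] (g : ι → (Fin P.n ↪[tau] M)), IsPacking P g →
        Fintype.card ι ≤ m := by
  constructor
  · intro h ι _ g hg
    rcases isEmpty_or_nonempty ι with hι | ⟨⟨i₀⟩⟩
    · simp [Fintype.card_eq_zero]
    have h1 := h (fun x => g i₀ x)
    set F : ι → Set M := fun i => g i '' (P.ext : Set (Fin P.n)) with hF
    have hdis : ∀ i j, i ≠ j → Disjoint (F i) (F j) := by
      intro i j hij
      have := hg.disjoint i j hij
      rw [← Finset.disjoint_coe] at this
      simpa [hF] using this
    have hinj : Function.Injective F := by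
      intro i j hij
      by_contra hne
      have h2 := hdis i j hne
      rw [hij, disjoint_self] at h2
      obtain ⟨x, hx⟩ := P.ext_nonempty
      have : g j x ∈ F j := ⟨x, hx, rfl⟩
      rw [h2] at this
      exact this
    have h2 : (Set.range F).encard ≤ chi P (fun x : P.base => g i₀ x) := by
      refine le_iSup (fun S : {S : Set (Set M) // S ⊆ copies P (fun x : P.base => g i₀ x) ∧
        S.PairwiseDisjoint id} => (S : Set (Set M)).encard) ⟨Set.range F, ?_, ?_⟩
      · rintro _ ⟨i, rfl⟩
        exact ⟨g i, fun x => hg.agree i i₀ x x.2, rfl⟩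
      · rintro _ ⟨i, rfl⟩ _ ⟨j, rfl⟩ hne
        exact hdis i j (fun e => hne (by rw [e]))
    have h3 : (Set.range F).encard = Fintype.card ι := by
      rw [← Set.image_univ, hinj.encard_image, Set.encard_univ, ENat.card_eq_coe_fintype_card]
    have h4 := h2.trans h1
    rw [h3] at h4
    exact_mod_cast h4
  · intro h f
    refine iSup_le ?_
    rintro ⟨S, hS, hdis⟩
    by_contra! hlt
    have h1 : ((m + 1 : ℕ) : ℕ∞) ≤ S.encard := by
      have := Order.add_one_le_of_lt hlt
      exact_mod_cast this
    obtain ⟨T, hT, hTc⟩ := Set.exists_subset_encard_eq h1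
    have hfin : T.Finite := Set.finite_of_encard_eq_coe hTc
    have := hfin.fintype
    choose g hg hgD using fun D : T => hS (hT D.2)
    have h2 := h T g ⟨fun D E x hx => ?_, fun D E hne => ?_⟩
    · rw [← Set.coe_fintypeCard] at hTc
      have : Fintype.card T = m + 1 := by exact_mod_cast hTc
      omega
    · exact (hg D ⟨x, hx⟩).trans (hg E ⟨x, hx⟩).symm
    · have h3 := hdis (hT D.2) (hT E.2) (fun e => hne (Subtype.ext e))
      rw [← Finset.disjoint_coe]
      simp only [Function.onFun, id] at h3
      rw [hgD D, hgD E] at h3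
      simpa using h3

theorem IsTripleSystem.goodIn_pair (h : IsTripleSystem M) (P : GoodPair)
    (g : Fin P.n ↪[tau] M) :
    GoodIn (P.base.map g.toEmbedding) (P.ext.map g.toEmbedding) :=
  h.goodIn_map g ((h.of_embedding g).goodIn P.good)

theorem IsPacking.base_eq {P : GoodPair} {ι : Type} {g : ι → (Fin P.n ↪[tau] M)}
    (hg : IsPacking P g) (i j : ι) :
    P.base.map (g i).toEmbedding = P.base.map (g j).toEmbedding := by
  ext x
  simp only [Finset.mem_map, toEmbedding_apply]
  constructor
  · rintro ⟨y, hy, rfl⟩; exact ⟨y, hy, hg.agree j i y hy⟩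
  · rintro ⟨y, hy, rfl⟩; exact ⟨y, hy, hg.agree i j y hy⟩

theorem IsTripleSystem.exists_col_of_prim_singleton {K : Type*} [tau.Structure K]
    (h : IsTripleSystem K) {A : Finset K} {c : K} (hp : Prim A {c}) :
    ∃ x ∈ A, ∃ y ∈ A, Col x y c := by
  obtain ⟨s, hs, hcs⟩ := h.exists_block_of_prim hp (Finset.mem_singleton_self c)
  obtain ⟨hs1, hs2⟩ := mem_blocks.1 hs
  have h2 : (s.erase c).card = 2 := by
    rw [Finset.card_erase_of_mem hcs, h.block_card hs2]
  obtain ⟨x, y, hxy, hse⟩ := Finset.card_eq_two.1 h2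
  have hx : x ∈ s.erase c := by simp [hse]
  have hy : y ∈ s.erase c := by simp [hse]
  have hmem : ∀ z ∈ s.erase c, z ∈ A := by
    intro z hz
    obtain ⟨hz1, hz2⟩ := Finset.mem_erase.1 hz
    exact (Finset.mem_union.1 (hs1 hz2)).resolve_right fun hz3 => hz1 (Finset.mem_singleton.1 hz3)
  exact ⟨x, hmem x hx, y, hmem y hy, h.col_of_mem hs2 (Finset.mem_of_mem_erase hx)
    (Finset.mem_of_mem_erase hy) hcs hxy (Finset.ne_of_mem_erase hx) (Finset.ne_of_mem_erase hy)⟩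

/-- In a triple system, a single point can be added to a given base in one way only. -/
theorem IsPacking.card_le_one {P : GoodPair} (h : IsTripleSystem M) {ι : Type} [Fintype ι]
    {g : ι → (Fin P.n ↪[tau] M)} (hg : IsPacking P g) (h1 : P.ext.card = 1) :
    Fintype.card ι ≤ 1 := by
  rw [Fintype.card_le_one_iff]
  intro i j
  by_contra hij
  have hP := h.of_embedding (g i)
  have hgood := hP.goodIn P.good
  obtain ⟨c, hc⟩ := Finset.card_eq_one.1 h1
  have hc' : c ∈ P.ext := by simp [hc]
  change GoodIn P.base P.ext at hgood
  rw [hc] at hgood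
  obtain ⟨x, hx, y, hy, hcol⟩ := hP.exists_col_of_prim_singleton hgood.toPrim
  have hi := (col_map (g i)).2 hcol
  have hj := (col_map (g j)).2 hcol
  rw [hg.agree j i x hx, hg.agree j i y hy] at hj
  have heq := h.third _ _ _ _ hi hj
  refine Finset.disjoint_left.1 (hg.disjoint i j hij) (Finset.mem_map_of_mem _ hc') ?_
  have := Finset.mem_map_of_mem (g j).toEmbedding hc'
  simp only [toEmbedding_apply] at this ⊢
  rwa [heq]

/-! ### The one-point pair `α` and the classes of triple systems -/

/-- The structure on three points consisting of a single block. -/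
@[reducible] def alphaStructure : tau.Structure (Fin 3) := structureOfBlocks {Finset.univ}

theorem alpha_isTripleSystem : @IsTripleSystem (Fin 3) alphaStructure := by
  refine isTripleSystem_structureOfBlocks _ ?_ ?_
  · rintro _ rfl; simp
  · rintro _ rfl _ rfl; simp

theorem alpha_col {x y z : Fin 3} :
    @Col (Fin 3) alphaStructure x y z ↔ x ≠ y ∧ x ≠ z ∧ y ≠ z := by
  let := alphaStructure
  refine ⟨alpha_isTripleSystem.distinct x y z, fun ⟨h1, h2, h3⟩ => ?_⟩
  rw [col_structureOfBlocks, Set.mem_singleton_iff]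
  refine Finset.eq_univ_of_card _ ?_
  rw [Fintype.card_fin]
  simp [h1, h2, h3]

theorem alpha_blocks_univ : @blocks (Fin 3) alphaStructure Finset.univ = {Finset.univ} := by
  let := alphaStructure
  ext s
  rw [mem_blocks, isBlock_structureOfBlocks _ (by rintro _ rfl; simp)]
  simp

theorem alpha_blocks_of_ne {X : Finset (Fin 3)} (hX : X ≠ Finset.univ) :
    @blocks (Fin 3) alphaStructure X = ∅ := by
  let := alphaStructure
  refine Finset.eq_empty_of_forall_notMem fun s hs => ?_
  rw [mem_blocks, isBlock_structureOfBlocks _ (by rintro _ rfl; simp)] at hs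
  rw [Set.mem_singleton_iff] at hs
  exact hX (Finset.univ_subset_iff.1 (hs.2 ▸ hs.1))

theorem alpha_delta (X : Finset (Fin 3)) : @delta (Fin 3) alphaStructure X =
    if X = Finset.univ then 2 else (X.card : ℤ) := by
  let := alphaStructure
  rw [alpha_isTripleSystem.delta_eq]
  split_ifs with h
  · rw [h, alpha_blocks_univ]; simp
  · rw [alpha_blocks_of_ne h]; simp

theorem alpha_isGood : @IsGood (Fin 3) alphaStructure {0, 1} {0, 1}ᶜ := by
  let := alphaStructure
  have hc : ({0, 1}ᶜ : Finset (Fin 3)) = {2} := by decide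
  rw [hc]
  constructor
  · rw [isZeroPrimitive_iff]
    refine ⟨by simp, by decide, ?_, ?_⟩
    · have h1 : ({0, 1} : Finset (Fin 3)) ≠ Finset.univ := by decide
      have h2 : ∀ x : Fin 3, x = 0 ∨ x = 1 ∨ x = 2 := by decide
      rw [alpha_delta, alpha_delta, if_pos, if_neg h1]
      · simp
      · ext x
        have := h2 x
        simp
        tauto
    · intro Y hY hne hY2
      exact absurd ((Finset.subset_singleton_iff.1 hY).resolve_left hne.ne_empty) hY2
  · intro B hB hp
    rw [isZeroPrimitive_iff] at hp
    obtain ⟨x, hx, y, hy, hcol⟩ := alpha_isTripleSystem.exists_col_of_prim_singleton hp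
    have hcard : B.card < 2 := by
      have := Finset.card_lt_card hB
      simpa using this
    have := Finset.one_lt_card.2 ⟨x, hx, y, hy, (alpha_col.1 hcol).1⟩
    omega

theorem alpha_delta_nonneg (X : Finset (Fin 3)) : 0 ≤ @delta (Fin 3) alphaStructure X := by
  rw [alpha_delta]
  split_ifs
  · norm_num
  · positivity

/-- The good pair `α` on the standard carrier. -/
def alphaPair : GoodPair where
  n := 3
  str := alphaStructure
  base := {0, 1}
  inK0 := @InK0.mk (Fin 3) alphaStructure inferInstance
    (@IsTripleSystem.toIsLinearSpace _ alphaStructure alpha_isTripleSystem)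
    alpha_delta_nonneg
  good := alpha_isGood

theorem alphaPair_isAlpha : alphaPair.IsAlpha :=
  ⟨(0 : Fin 3), (1 : Fin 3), (2 : Fin 3), rfl,
    (by decide : ({0, 1}ᶜ : Finset (Fin 3)) = {2}), alpha_col.2 (by decide)⟩

/-- A collinear triple gives an embedding of `α`. -/
theorem IsLinearSpace.exists_alpha (h : IsLinearSpace M) {a b c : M} (hc : Col a b c) :
    ∃ g : Fin alphaPair.n ↪[tau] M, g (0 : Fin 3) = a ∧ g (1 : Fin 3) = b ∧
      g (2 : Fin 3) = c := by
  obtain ⟨h1, h2, h3⟩ := h.distinct _ _ _ hc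
  let v : Fin 3 → M := ![a, b, c]
  have hv : Function.Injective v := by
    intro x y hxy
    fin_cases x <;> fin_cases y <;> simp_all [v]
  have hmem : ∀ x, v x ∈ ({a, b, c} : Finset M) := by
    intro x; fin_cases x <;> simp [v]
  refine ⟨@embeddingOfCol (Fin 3) M alphaStructure _ v hv fun x y z => ?_, rfl, rfl, rfl⟩
  rw [alpha_col]
  constructor
  · intro h4
    obtain ⟨h5, h6, h7⟩ := h.distinct _ _ _ h4
    exact ⟨fun e => h5 (by rw [e]), fun e => h6 (by rw [e]), fun e => h7 (by rw [e])⟩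
  · rintro ⟨h5, h6, h7⟩
    exact h.col_of_mem (h.col_iff_isBlock.1 hc) (hmem x) (hmem y) (hmem z) (hv.ne h5) (hv.ne h6)
      (hv.ne h7)

/-- The conditions on `μ` used for amalgamation: `μ(α) = 1`, so that all lines have at most three
points, together with the lower bounds required in `𝒰`. -/
structure TripleBound (μ : GoodPairType → ℕ) : Prop where
  alpha : μ alphaPair.type = 1
  pos : ∀ P : GoodPair, 1 ≤ μ P.type
  delta_le : ∀ P : GoodPair, 2 ≤ P.ext.card → delta P.base ≤ (μ P.type : ℤ)

/-- Every packing in `M` obeys the bound given by `μ`. -/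
def PackingBound (μ : GoodPairType → ℕ) (M : Type) [tau.Structure M] : Prop :=
  ∀ P : GoodPair, 2 ≤ P.ext.card → ∀ (ι : Type) [Fintype ι] (g : ι → (Fin P.n ↪[tau] M)),
    IsPacking P g → Fintype.card ι ≤ μ P.type

/-- For `μ(α) = 1` the class `K_μ` consists of triple systems. -/
theorem InK.isTripleSystem {μ : GoodPairType → ℕ} (hμ : TripleBound μ) (h : InK μ M) :
    IsTripleSystem M := by
  refine ⟨h.1.linear, fun a b c d hc hd => ?_⟩
  by_contra hcd
  obtain ⟨g, hg0, hg1, hg2⟩ := h.1.linear.exists_alpha hc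
  obtain ⟨k, hk0, hk1, hk2⟩ := h.1.linear.exists_alpha hd
  have h1 := (chi_le_iff alphaPair _).1 (h.2 alphaPair) Bool (fun i => if i then g else k)
  rw [hμ.alpha] at h1
  have hext : ∀ x, x ∈ alphaPair.ext → x = (2 : Fin 3) := by
    change ∀ x : Fin 3, x ∈ ({0, 1}ᶜ : Finset (Fin 3)) → x = 2
    decide
  have hbase : ∀ x, x ∈ alphaPair.base → x = (0 : Fin 3) ∨ x = (1 : Fin 3) := by
    change ∀ x : Fin 3, x ∈ ({0, 1} : Finset (Fin 3)) → x = 0 ∨ x = 1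
    decide
  have hgk : ∀ x ∈ alphaPair.base, g x = k x := by
    intro x hx
    rcases hbase x hx with rfl | rfl
    · rw [hg0, hk0]
    · rw [hg1, hk1]
  have hd : Disjoint (alphaPair.ext.map g.toEmbedding) (alphaPair.ext.map k.toEmbedding) := by
    rw [Finset.disjoint_left]
    intro x hx hx'
    obtain ⟨y, hy, rfl⟩ := Finset.mem_map.1 hx
    obtain ⟨z, hz, hzy⟩ := Finset.mem_map.1 hx'
    rw [hext y hy, hext z hz] at hzy
    exact hcd (by rw [← hg2, ← hk2]; exact hzy.symm)
  have h2 := h1 ⟨fun i j x hx => ?_, fun i j hij => ?_⟩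
  · simp at h2
  · cases i <;> cases j <;> simp [hgk x hx]
  · cases i <;> cases j <;> simp_all
    exact hd.symm

theorem inK_iff {μ : GoodPairType → ℕ} (hμ : TripleBound μ) :
    InK μ M ↔ Finite M ∧ IsTripleSystem M ∧ (∀ A : Finset M, 0 ≤ delta A) ∧ PackingBound μ M := by
  constructor
  · intro h
    exact ⟨h.1.finite, h.isTripleSystem hμ, h.1.delta_nonneg,
      fun P _ => (chi_le_iff P _).1 (h.2 P)⟩
  · rintro ⟨h1, h2, h3, h4⟩
    refine ⟨⟨h1, h2.toIsLinearSpace, h3⟩, fun P => (chi_le_iff P _).2 fun ι _ g hg => ?_⟩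
    by_cases hP : 2 ≤ P.ext.card
    · exact h4 P hP ι g hg
    · have := P.ext_nonempty.card_pos
      exact (hg.card_le_one h2 (by omega)).trans (hμ.pos P)

theorem IsPacking.of_comp {P : GoodPair} {ι : Type} {g : ι → (Fin P.n ↪[tau] M)}
    {g' : ι → (Fin P.n ↪[tau] N)} (i : M ↪[tau] N) (h : ∀ k x, i (g k x) = g' k x)
    (hg : IsPacking P g') : IsPacking P g := by
  refine ⟨fun k l x hx => i.injective (by rw [h, h, hg.agree k l x hx]), fun k l hkl => ?_⟩
  rw [Finset.disjoint_left]
  intro x hx hx'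
  obtain ⟨y, hy, rfl⟩ := Finset.mem_map.1 hx
  obtain ⟨z, hz, hzy⟩ := Finset.mem_map.1 hx'
  refine Finset.disjoint_left.1 (hg.disjoint k l hkl) (Finset.mem_map_of_mem _ hy) ?_
  have := Finset.mem_map_of_mem (g' l).toEmbedding hz
  simp only [toEmbedding_apply] at this hzy ⊢
  rwa [← h k y, ← hzy, h l z]

theorem IsPacking.comp {P : GoodPair} {ι : Type} {g : ι → (Fin P.n ↪[tau] M)}
    {g' : ι → (Fin P.n ↪[tau] N)} (i : M ↪[tau] N) (h : ∀ k x, i (g k x) = g' k x)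
    (hg : IsPacking P g) : IsPacking P g' := by
  refine ⟨fun k l x hx => by rw [← h, ← h, hg.agree k l x hx], fun k l hkl => ?_⟩
  rw [Finset.disjoint_left]
  intro x hx hx'
  obtain ⟨y, hy, rfl⟩ := Finset.mem_map.1 hx
  obtain ⟨z, hz, hzy⟩ := Finset.mem_map.1 hx'
  simp only [toEmbedding_apply] at hzy
  rw [← h, ← h] at hzy
  refine Finset.disjoint_left.1 (hg.disjoint k l hkl) (Finset.mem_map_of_mem _ hy) ?_
  have := Finset.mem_map_of_mem (g l).toEmbedding hz
  simp only [toEmbedding_apply] at this ⊢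
  rwa [← i.injective hzy]

/-- A packing inside the image of a member of `K_μ` obeys the bound. -/
theorem PackingBound.card_le {μ : GoodPairType → ℕ} (h : PackingBound μ N) (i : N ↪[tau] M)
    {P : GoodPair} (hP : 2 ≤ P.ext.card) {ι : Type} [Fintype ι] {g : ι → (Fin P.n ↪[tau] M)}
    (hg : IsPacking P g) (hi : ∀ k x, ∃ y, i y = g k x) : Fintype.card ι ≤ μ P.type := by
  choose g' hg' using fun k => exists_factor i (g k) (hi k)
  exact h P hP ι g' (hg.of_comp i hg')

/-- The class `K_μ` is closed under substructures. -/
theorem InK.of_embedding {μ : GoodPairType → ℕ} (hμ : TripleBound μ) (h : InK μ N)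
    (i : M ↪[tau] N) : InK μ M := by
  obtain ⟨h1, h2, h3, h4⟩ := (inK_iff hμ).1 h
  refine (inK_iff hμ).2 ⟨Finite.of_injective i i.injective, h2.of_embedding i, fun A => ?_,
    fun P hP ι _ g hg => ?_⟩
  · rw [← h2.delta_map i]; exact h3 _
  · exact h4 P hP ι (fun k => i.comp (g k)) (hg.comp i fun _ _ => rfl)

end Packings

/-! ### Strong embeddings -/

section StrongEmbeddings

variable {A M N : Type} [tau.Structure A] [tau.Structure M] [tau.Structure N]

/-- An embedding whose range is a finite strong subset. -/
def StrongEmb (i : A ↪[tau] M) : Prop :=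
  ∃ E : Finset M, (∀ x, x ∈ E ↔ ∃ a, i a = x) ∧ Strong E Set.univ

theorem isStrongEmbedding_iff [Fintype A] (i : A ↪[tau] M) :
    IsStrongEmbedding i ↔ StrongEmb i := by
  constructor
  · intro h
    exact ⟨_, fun x => by simp, h⟩
  · rintro ⟨E, hE, h⟩
    have : E = Finset.univ.map i.toEmbedding := by ext x; simp [hE]
    rw [this] at h
    exact h

theorem StrongEmb.strong {i : A ↪[tau] M} (h : StrongEmb i) {E : Finset M}
    (hE : ∀ x, x ∈ E ↔ ∃ a, i a = x) : Strong E Set.univ := by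
  obtain ⟨E', hE', h'⟩ := h
  have : E = E' := by ext x; rw [hE, hE']
  rwa [this]

theorem IsTripleSystem.strong_map (h : IsTripleSystem N) {j : M ↪[tau] N} (hj : StrongEmb j)
    {E : Finset M} (hE : Strong E Set.univ) : Strong (E.map j.toEmbedding) Set.univ := by
  obtain ⟨R, hR, hRs⟩ := hj
  rw [strong_univ_iff] at hE ⊢
  intro X hX
  refine le_trans ?_ (h.delta_inter_le hRs X)
  obtain ⟨Y, hY⟩ : ∃ Y : Finset M, Y.map j.toEmbedding = X ∩ R := by
    refine ⟨(X ∩ R).preimage j j.injective.injOn, ?_⟩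
    ext x
    simp only [Finset.mem_map, Finset.mem_preimage, toEmbedding_apply, Finset.mem_inter]
    constructor
    · rintro ⟨y, hy, rfl⟩; exact hy
    · rintro ⟨hx, hxR⟩
      obtain ⟨y, rfl⟩ := (hR x).1 hxR
      exact ⟨y, ⟨hx, hxR⟩, rfl⟩
  rw [← hY, h.delta_map, h.delta_map]
  refine hE Y fun y hy => ?_
  have : j y ∈ X ∩ R := Finset.mem_inter.2
    ⟨hX (Finset.mem_map_of_mem j.toEmbedding hy), (hR _).2 ⟨y, rfl⟩⟩
  rw [← hY] at this
  simpa using this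

theorem IsTripleSystem.strongEmb_comp (h : IsTripleSystem N) {j : M ↪[tau] N}
    {i : A ↪[tau] M} (hj : StrongEmb j) (hi : StrongEmb i) : StrongEmb (j.comp i) := by
  obtain ⟨E, hE, hEs⟩ := hi
  refine ⟨E.map j.toEmbedding, fun x => ?_, h.strong_map hj hEs⟩
  simp [hE]

theorem strongEmb_of_surjective [Finite M] (i : A ↪[tau] M) (h : Function.Surjective i) :
    StrongEmb i := by
  have := Fintype.ofFinite M
  refine ⟨Finset.univ, fun x => by simpa using h x, strong_univ_iff.2 fun X hX => ?_⟩
  rw [Finset.univ_subset_iff.1 hX]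

/-- An embedding which is strong into `N` is strong into any intermediate structure. -/
theorem IsTripleSystem.strongEmb_of_comp (h : IsTripleSystem N) {j : M ↪[tau] N}
    {i : A ↪[tau] M} (hji : StrongEmb (j.comp i)) : StrongEmb i := by
  obtain ⟨E, hE, hEs⟩ := hji
  have hEi : ∀ a, j (i a) ∈ E := fun a => (hE _).2 ⟨a, rfl⟩
  have hE' : (E.preimage j j.injective.injOn).map j.toEmbedding = E := by
    ext x
    simp only [Finset.mem_map, Finset.mem_preimage, toEmbedding_apply]
    constructor
    · rintro ⟨y, hy, rfl⟩; exact hy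
    · intro hx
      obtain ⟨a, rfl⟩ := (hE x).1 hx
      exact ⟨i a, hx, rfl⟩
  refine ⟨E.preimage j j.injective.injOn, fun x => ?_, strong_univ_iff.2 fun X hX => ?_⟩
  · rw [Finset.mem_preimage, hE]
    exact ⟨fun ⟨a, ha⟩ => ⟨a, j.injective ha⟩, fun ⟨a, ha⟩ => ⟨a, congrArg j ha⟩⟩
  · rw [← h.delta_map j, ← h.delta_map j, hE']
    refine strong_univ_iff.1 hEs _ ?_
    rw [← hE']
    exact Finset.map_subset_map.2 hX

/-- Isomorphic parts have the same predimension. -/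
theorem IsTripleSystem.delta_image (hM : IsTripleSystem M) (hN : IsTripleSystem N) {X : Finset M}
    {f : M → N} (hf : Set.InjOn f X)
    (hc : ∀ a ∈ X, ∀ b ∈ X, ∀ c ∈ X, (Col (f a) (f b) (f c) ↔ Col a b c)) :
    delta (X.image f) = delta X := by
  let g : sub (X : Set M) ↪[tau] M := (sub (X : Set M)).subtype
  let k : sub (X : Set M) ↪[tau] N := embeddingOfCol (fun x => f x.1)
    (fun x y hxy => Subtype.ext (hf x.2 y.2 hxy))
    (fun a b c => (hc _ a.2 _ b.2 _ c.2).trans (col_map g))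
  have hfin : Finite (sub (X : Set M)) := X.finite_toSet
  have := Fintype.ofFinite (sub (X : Set M))
  have h1 := hM.delta_map g Finset.univ
  have h2 := hN.delta_map k Finset.univ
  have e1 : Finset.univ.map g.toEmbedding = X := by
    ext x
    simp only [Finset.mem_map, Finset.mem_univ, true_and]
    exact ⟨fun ⟨y, hy⟩ => hy ▸ y.2, fun hx => ⟨⟨x, hx⟩, rfl⟩⟩
  have e2 : Finset.univ.map k.toEmbedding = X.image f := by
    ext x
    simp only [Finset.mem_map, Finset.mem_univ, true_and, Finset.mem_image]
    exact ⟨fun ⟨y, hy⟩ => ⟨y.1, y.2, hy⟩, fun ⟨y, hy, hx⟩ => ⟨⟨y, hy⟩, hx⟩⟩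
  rw [← e1, h1, ← h2, e2, e1]

theorem IsTripleSystem.delta_of_card_le_two (h : IsTripleSystem M) {X : Finset M}
    (hX : X.card ≤ 2) : delta X = X.card := by
  have : blocks X = ∅ := by
    refine Finset.eq_empty_of_forall_notMem fun s hs => ?_
    obtain ⟨h1, h2⟩ := mem_blocks.1 hs
    have := h.block_card h2
    have := Finset.card_le_card h1
    omega
  simp [h.delta_eq, this]

theorem IsTripleSystem.delta_of_isBlock (h : IsTripleSystem M) {X : Finset M}
    (hX : IsBlock X) : delta X = 2 := by
  have h3 := h.block_card hX
  have : blocks X = {X} := by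
    ext s
    rw [mem_blocks, Finset.mem_singleton]
    constructor
    · rintro ⟨h1, h2⟩
      exact Finset.eq_of_subset_of_card_le h1 (by rw [h3, h.block_card h2])
    · rintro rfl; exact ⟨subset_rfl, hX⟩
  rw [h.delta_eq, h3, this]
  simp

theorem IsLinearSpace.col_iff_of_mem (h : IsLinearSpace M) {s : Finset M} (hs : IsBlock s)
    {a b c : M} (ha : a ∈ s) (hb : b ∈ s) (hc : c ∈ s) :
    Col a b c ↔ a ≠ b ∧ a ≠ c ∧ b ≠ c :=
  ⟨h.distinct a b c, fun h' => h.col_of_mem hs ha hb hc h'.1 h'.2.1 h'.2.2⟩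

end StrongEmbeddings

/-! ### Free amalgams -/

section FreeAmalgam

variable {A E F : Type} [tau.Structure A] [tau.Structure E] [tau.Structure F]

theorem map_triple {α β : Type*} (k : α ↪ β) (a b c : α) :
    ({a, b, c} : Finset α).map k = {k a, k b, k c} := by
  simp [Finset.map_insert]

/-- Two triple systems have a free amalgam over a common substructure unless two blocks, one of
each of them, would have to share exactly two points. -/
theorem exists_free_amalgam (hE : IsTripleSystem E) (hF : IsTripleSystem F) (i : A ↪[tau] E)
    (f : A ↪[tau] F)
    (hnc : ∀ (t : Finset E) (u : Finset F) (a b : A), IsBlock t → IsBlock u → a ≠ b → i a ∈ t →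
      i b ∈ t → f a ∈ u → f b ∈ u → ∀ x ∈ t, ∃ d, i d = x) :
    ∃ (M : Type) (_ : tau.Structure M) (jF : F ↪[tau] M) (jE : E ↪[tau] M),
      IsTripleSystem M ∧ (∀ a, jF (f a) = jE (i a)) ∧
      (∀ m, (∃ x, jF x = m) ∨ ∃ x, jE x = m) ∧
      (∀ x y, jF x = jE y → ∃ a, f a = x ∧ i a = y) ∧
      ∀ s : Finset M, IsBlock s → (∀ m ∈ s, ∃ x, jF x = m) ∨ (∀ m ∈ s, ∃ x, jE x = m) := by
  let M := F ⊕ {x : E // ¬ ∃ a, i a = x}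
  let kF : F ↪ M := Function.Embedding.inl
  let k : E → M := fun x =>
    if h : ∃ a, i a = x then Sum.inl (f h.choose) else Sum.inr ⟨x, h⟩
  have hk1 : ∀ a, k (i a) = Sum.inl (f a) := by
    intro a
    have h : ∃ b, i b = i a := ⟨a, rfl⟩
    have h' : h.choose = a := i.injective h.choose_spec
    simp only [k, dif_pos h, h']
  have hk2 : ∀ x (h : ¬ ∃ a, i a = x), k x = Sum.inr ⟨x, h⟩ := fun x h => dif_neg h
  have hkF : ∀ x y, kF x = k y → ∃ a, f a = x ∧ i a = y := by
    intro x y hxy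
    by_cases h : ∃ a, i a = y
    · obtain ⟨a, rfl⟩ := h
      rw [hk1] at hxy
      exact ⟨a, (Sum.inl_injective hxy).symm, rfl⟩
    · rw [hk2 y h] at hxy
      exact absurd hxy Sum.inl_ne_inr
  have hkinj : Function.Injective k := by
    intro x y hxy
    by_cases hx : ∃ a, i a = x
    · obtain ⟨a, rfl⟩ := hx
      rw [hk1] at hxy
      obtain ⟨b, hb, rfl⟩ := hkF _ _ hxy
      rw [f.injective hb]
    · by_cases hy : ∃ a, i a = y
      · obtain ⟨a, rfl⟩ := hy
        rw [hk1] at hxy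
        obtain ⟨b, hb, rfl⟩ := hkF _ _ hxy.symm
        exact absurd ⟨b, rfl⟩ hx
      · rw [hk2 x hx, hk2 y hy] at hxy
        simpa using Sum.inr_injective hxy
  let kE : E ↪ M := ⟨k, hkinj⟩
  have hkE : ∀ x y, kF x = kE y → ∃ a, f a = x ∧ i a = y := hkF
  have hcomm : ∀ a, kE (i a) = kF (f a) := hk1
  -- a block of `E` inside the common part is also a block of `F`, and conversely
  have htrans : ∀ (t : Finset E) (u : Finset F),
      t.map kE = u.map kF → ∃ v : Finset A, v.map i.toEmbedding = t ∧ v.map f.toEmbedding = u := by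
    intro t u htu
    have h1 : ∀ x ∈ t, ∃ a, i a = x ∧ f a ∈ u := by
      intro x hx
      have : kE x ∈ u.map kF := htu ▸ Finset.mem_map_of_mem _ hx
      obtain ⟨y, hy, hyx⟩ := Finset.mem_map.1 this
      obtain ⟨a, rfl, rfl⟩ := hkE _ _ hyx
      exact ⟨a, rfl, hy⟩
    have h2 : ∀ y ∈ u, ∃ a, f a = y ∧ i a ∈ t := by
      intro y hy
      have : kF y ∈ t.map kE := htu ▸ Finset.mem_map_of_mem _ hy
      obtain ⟨x, hx, hxy⟩ := Finset.mem_map.1 this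
      obtain ⟨a, rfl, rfl⟩ := hkE _ _ hxy.symm
      exact ⟨a, rfl, hx⟩
    refine ⟨t.preimage i i.injective.injOn, ?_, ?_⟩
    · ext x
      simp only [Finset.mem_map, Finset.mem_preimage, toEmbedding_apply]
      constructor
      · rintro ⟨a, ha, rfl⟩; exact ha
      · intro hx
        obtain ⟨a, rfl, _⟩ := h1 x hx
        exact ⟨a, hx, rfl⟩
    · ext y
      simp only [Finset.mem_map, Finset.mem_preimage, toEmbedding_apply]
      constructor
      · rintro ⟨a, ha, rfl⟩
        obtain ⟨b, hb, hb'⟩ := h1 _ ha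
        rwa [i.injective hb] at hb'
      · intro hy
        obtain ⟨a, rfl, ha⟩ := h2 y hy
        exact ⟨a, ha, rfl⟩
  let T : Set (Finset M) := {s | (∃ t : Finset F, IsBlock t ∧ t.map kF = s) ∨
    ∃ t : Finset E, IsBlock t ∧ t.map kE = s}
  have hT3 : ∀ s ∈ T, s.card = 3 := by
    rintro s (⟨t, ht, rfl⟩ | ⟨t, ht, rfl⟩)
    · rw [Finset.card_map, hF.block_card ht]
    · rw [Finset.card_map, hE.block_card ht]
  have hmix : ∀ (t : Finset F) (u : Finset E) p q, IsBlock t → IsBlock u → p ≠ q →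
      p ∈ t.map kF → q ∈ t.map kF → p ∈ u.map kE → q ∈ u.map kE → t.map kF = u.map kE := by
    intro t u p q ht hu hpq hpt hqt hpu hqu
    obtain ⟨x, hx, rfl⟩ := Finset.mem_map.1 hpt
    obtain ⟨y, hy, rfl⟩ := Finset.mem_map.1 hqt
    obtain ⟨x', hx', hxx⟩ := Finset.mem_map.1 hpu
    obtain ⟨y', hy', hyy⟩ := Finset.mem_map.1 hqu
    obtain ⟨a, rfl, rfl⟩ := hkE _ _ hxx.symm
    obtain ⟨b, rfl, rfl⟩ := hkE _ _ hyy.symm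
    have hab : a ≠ b := fun e => hpq (by rw [e])
    have hu' := hnc u t a b hu ht hab hx' hy' hx hy
    obtain ⟨v, hv⟩ : ∃ v : Finset A, v.map i.toEmbedding = u := by
      refine ⟨u.preimage i i.injective.injOn, ?_⟩
      ext x
      simp only [Finset.mem_map, Finset.mem_preimage, toEmbedding_apply]
      constructor
      · rintro ⟨a, ha, rfl⟩; exact ha
      · intro hx
        obtain ⟨a, rfl⟩ := hu' x hx
        exact ⟨a, hx, rfl⟩
    have hvf : v.map f.toEmbedding = t := by
      subst hv
      refine hF.block_eq ((isBlock_map f).2 ((isBlock_map i).1 hu)) ht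
        (f.injective.ne hab) ?_ ?_ hx hy
      · simpa using hx'
      · simpa using hy'
    rw [← hv, ← hvf]
    ext m
    simp only [Finset.map_map, Finset.mem_map, Function.Embedding.trans_apply, toEmbedding_apply,
      hcomm]
  have hT1 : ∀ s ∈ T, ∀ t ∈ T, ∀ p q, p ≠ q → p ∈ s → q ∈ s → p ∈ t → q ∈ t → s = t := by
    rintro s (⟨t, ht, rfl⟩ | ⟨t, ht, rfl⟩) s' (⟨u, hu, rfl⟩ | ⟨u, hu, rfl⟩) p q hpq hp hq hp' hq'
    · obtain ⟨x, hx, rfl⟩ := Finset.mem_map.1 hp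
      obtain ⟨y, hy, rfl⟩ := Finset.mem_map.1 hq
      rw [hF.block_eq ht hu (fun e => hpq (by rw [e])) hx hy ((Finset.mem_map' _).1 hp')
        ((Finset.mem_map' _).1 hq')]
    · exact hmix t u p q ht hu hpq hp hq hp' hq'
    · exact (hmix u t p q hu ht hpq hp' hq' hp hq).symm
    · obtain ⟨x, hx, rfl⟩ := Finset.mem_map.1 hp
      obtain ⟨y, hy, rfl⟩ := Finset.mem_map.1 hq
      rw [hE.block_eq ht hu (fun e => hpq (by rw [e])) hx hy ((Finset.mem_map' _).1 hp')
        ((Finset.mem_map' _).1 hq')]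
  let := structureOfBlocks T
  have hM : IsTripleSystem M := isTripleSystem_structureOfBlocks T hT3 hT1
  have hblock : ∀ s : Finset M, IsBlock s ↔ s ∈ T := fun s => isBlock_structureOfBlocks T hT3
  have hcF : ∀ a b c, Col (kF a) (kF b) (kF c) ↔ Col a b c := by
    intro a b c
    rw [hM.col_iff_isBlock, hF.col_iff_isBlock, hblock, ← map_triple]
    constructor
    · rintro (⟨t, ht, h⟩ | ⟨t, ht, h⟩)
      · rwa [← Finset.map_injective _ h]
      · obtain ⟨v, rfl, h2⟩ := htrans _ _ h
        rw [← h2, isBlock_map]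
        exact (isBlock_map i).1 ht
    · intro h
      exact Or.inl ⟨_, h, rfl⟩
  have hcE : ∀ a b c, Col (kE a) (kE b) (kE c) ↔ Col a b c := by
    intro a b c
    rw [hM.col_iff_isBlock, hE.col_iff_isBlock, hblock, ← map_triple]
    constructor
    · rintro (⟨t, ht, h⟩ | ⟨t, ht, h⟩)
      · obtain ⟨v, h2, rfl⟩ := htrans _ _ h.symm
        rw [← h2, isBlock_map]
        exact (isBlock_map f).1 ht
      · rwa [← Finset.map_injective _ h]
    · intro h
      exact Or.inr ⟨_, h, rfl⟩
  refine ⟨M, inferInstance, embeddingOfCol kF kF.injective hcF,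
    embeddingOfCol kE kE.injective hcE, hM, fun a => (hcomm a).symm, ?_, hkE, ?_⟩
  · rintro (x | ⟨x, hx⟩)
    · exact Or.inl ⟨x, rfl⟩
    · exact Or.inr ⟨x, hk2 x hx⟩
  · intro s hs
    rcases (hblock s).1 hs with ⟨t, _, rfl⟩ | ⟨t, _, rfl⟩
    · refine Or.inl fun m hm => ?_
      obtain ⟨x, _, rfl⟩ := Finset.mem_map.1 hm
      exact ⟨x, rfl⟩
    · refine Or.inr fun m hm => ?_
      obtain ⟨x, _, rfl⟩ := Finset.mem_map.1 hm
      exact ⟨x, rfl⟩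

variable {M : Type} [tau.Structure M]

/-- In a free amalgam of `F` and `E` over a set which is strong in `E`, the set `F` is strong. -/
theorem IsTripleSystem.strong_of_free (h : IsTripleSystem M) {F E : Finset M}
    (hcover : ∀ m, m ∈ F ∨ m ∈ E) (hfree : ∀ s, IsBlock s → s ⊆ F ∨ s ⊆ E)
    (hD : ∀ X, F ∩ E ⊆ X → X ⊆ E → delta (F ∩ E) ≤ delta X) : Strong F Set.univ := by
  rw [strong_univ_iff]
  intro X hX
  have hU : F ∪ (X ∩ E) = X := by
    ext x
    simp only [Finset.mem_union, Finset.mem_inter]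
    constructor
    · rintro (h1 | h1)
      · exact hX h1
      · exact h1.1
    · intro h1
      rcases hcover x with h2 | h2
      · exact Or.inl h2
      · exact Or.inr ⟨h1, h2⟩
  have hI : F ∩ (X ∩ E) = F ∩ E := by
    ext x
    simp only [Finset.mem_inter]
    exact ⟨fun h1 => ⟨h1.1, h1.2.2⟩, fun h1 => ⟨h1.1, hX h1.1, h1.2⟩⟩
  have h1 := h.delta_union_add_inter_eq (X := F) (Y := X ∩ E) fun s hs => by
    rw [hU] at hs
    obtain ⟨h1, h2⟩ := mem_blocks.1 hs
    exact (hfree s h2).imp id fun h3 => Finset.subset_inter h1 h3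
  rw [hU, hI] at h1
  have := hD (X ∩ E) (fun x hx => Finset.mem_inter.2
    ⟨hX (Finset.mem_inter.1 hx).1, (Finset.mem_inter.1 hx).2⟩) Finset.inter_subset_right
  linarith

/-- If a good pair is packed too often in a free amalgam of `F` with a minimal strong extension
`E` of `F ∩ E`, then its base lies in `F ∩ E`, one of the copies of its extension part is `E \ F`,
and another one lies outside `E`. -/
theorem IsTripleSystem.exists_of_card_lt (h : IsTripleSystem M) {F E : Finset M}
    (hF : Strong F Set.univ) (hE : Strong E Set.univ) (hpos : ∀ X : Finset M, 0 ≤ delta X)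
    (hcover : ∀ m, m ∈ F ∨ m ∈ E) (hfree : ∀ s, IsBlock s → s ⊆ F ∨ s ⊆ E)
    (hmin : ∀ Y ⊆ E \ F, Y.Nonempty → Y ≠ E \ F → delta (F ∩ E) < delta (F ∩ E ∪ Y))
    {P : GoodPair} {ι : Type} [Fintype ι] {g : ι → (Fin P.n ↪[tau] M)} (hg : IsPacking P g)
    {m : ℕ} (hm : delta P.base ≤ m) (hcard : m < Fintype.card ι)
    (hmF : (∀ k x, g k x ∈ F) → Fintype.card ι ≤ m)
    (hmE : (∀ k x, g k x ∈ E) → Fintype.card ι ≤ m) :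
    ∃ k l, P.base.map (g k).toEmbedding ⊆ F ∩ E ∧ P.ext.map (g k).toEmbedding = E \ F ∧
      Disjoint (P.ext.map (g l).toEmbedding) E := by
  obtain ⟨k₀⟩ : Nonempty ι := Fintype.card_pos_iff.1 (by omega)
  set B : ι → Finset M := fun k => P.ext.map (g k).toEmbedding with hB
  obtain ⟨A, hA⟩ : ∃ A, ∀ k, P.base.map (g k).toEmbedding = A :=
    ⟨_, fun k => hg.base_eq k k₀⟩
  have hgood : ∀ k, GoodIn A (B k) := fun k => hA k ▸ h.goodIn_pair P (g k)
  have hrange : ∀ (S : Finset M) k, A ⊆ S → B k ⊆ S → ∀ x, g k x ∈ S := by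
    intro S k h1 h2 x
    by_cases hx : x ∈ P.base
    · exact h1 (hA k ▸ Finset.mem_map_of_mem (g k).toEmbedding hx)
    · exact h2 (Finset.mem_map_of_mem (g k).toEmbedding (Finset.mem_compl.2 hx))
  have hout : ∀ S : Finset M, Strong S Set.univ → A ⊆ S →
      ((∀ k x, g k x ∈ S) → Fintype.card ι ≤ m) → ∃ k, Disjoint (B k) S := by
    intro S hS hAS hmS
    have : ∃ k, ¬ B k ⊆ S := by
      by_contra! hcon
      exact absurd (hmS fun k => hrange S k hAS (hcon k)) (by omega)
    obtain ⟨k, hk⟩ := this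
    exact ⟨k, (h.subset_or_disjoint hS (hgood k).toPrim hAS).resolve_left hk⟩
  by_cases hAF : A ⊆ F
  · obtain ⟨k, hk⟩ := hout F hF hAF hmF
    have hkE : B k ⊆ E \ F := fun x hx => by
      have hxF := Finset.disjoint_left.1 hk hx
      exact Finset.mem_sdiff.2 ⟨(hcover x).resolve_left hxF, hxF⟩
    have hkeq : B k = E \ F := by
      by_contra hne
      have h1 := hmin (B k) hkE (hgood k).nonempty hne
      have h2 := h.delta_union_add_inter_le F (A ∪ B k)
      have e1 : F ∪ (A ∪ B k) = F ∪ B k := by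
        rw [← Finset.union_assoc, Finset.union_eq_left.2 hAF]
      have e2 : F ∩ (A ∪ B k) = A := by
        rw [Finset.inter_union_distrib_left, Finset.inter_eq_right.2 hAF,
          Finset.disjoint_iff_inter_eq_empty.1 hk.symm, Finset.union_empty]
      rw [e1, e2, (hgood k).delta_eq] at h2
      have e3 : F ∪ (F ∩ E ∪ B k) = F ∪ B k := by
        rw [← Finset.union_assoc, Finset.union_eq_left.2 Finset.inter_subset_left]
      have e4 : F ∩ (F ∩ E ∪ B k) = F ∩ E := by
        rw [Finset.inter_union_distrib_left, Finset.disjoint_iff_inter_eq_empty.1 hk.symm,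
          Finset.union_empty, Finset.inter_eq_right.2 Finset.inter_subset_left]
      have h3 := h.delta_union_add_inter_eq (X := F) (Y := F ∩ E ∪ B k) fun s hs => by
        obtain ⟨hs1, hs2⟩ := mem_blocks.1 hs
        rw [e3] at hs1
        refine (hfree s hs2).imp id fun hsE x hx => ?_
        rcases Finset.mem_union.1 (hs1 hx) with hx' | hx'
        · exact Finset.mem_union_left _ (Finset.mem_inter.2 ⟨hx', hsE hx⟩)
        · exact Finset.mem_union_right _ hx'
      rw [e3, e4] at h3
      linarith
    have hAE : A ⊆ E := by
      intro a ha
      obtain ⟨s, hs, has, hsB⟩ := (hgood k).touches a ha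
      obtain ⟨x, hxs, hxB⟩ := Finset.not_disjoint_iff.1 hsB
      rcases hfree s (mem_blocks.1 hs).2 with hs' | hs'
      · exact absurd (hs' hxs) (Finset.disjoint_left.1 hk hxB)
      · exact hs' has
    obtain ⟨l, hl⟩ := hout E hE hAE hmE
    exact ⟨k, l, hA k ▸ Finset.subset_inter hAF hAE, hkeq, hl⟩
  · exfalso
    obtain ⟨a, haA, haF⟩ := Finset.not_subset.1 hAF
    have hmeet : ∀ k, ¬ Disjoint (B k) E := by
      intro k
      obtain ⟨s, hs, has, hsB⟩ := (hgood k).touches a haA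
      obtain ⟨x, hxs, hxB⟩ := Finset.not_disjoint_iff.1 hsB
      refine Finset.not_disjoint_iff.2 ⟨x, hxB, ?_⟩
      rcases hfree s (mem_blocks.1 hs).2 with hs' | hs'
      · exact absurd (hs' has) haF
      · exact hs' hxs
    by_cases hAE : A ⊆ E
    · obtain ⟨l, hl⟩ := hout E hE hAE hmE
      exact hmeet l hl
    · have h1 := h.card_le_of_not_subset hE (hpos _) hgood hg.disjoint hAE hmeet
      rw [← hA k₀, h.delta_map] at h1
      omega

/-- A minimal strong extension `E` of `A` can be moved into `F` over `A` if a part of `A` which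
supports it has a second copy of `E \ A` over it. -/
theorem IsTripleSystem.exists_strongEmb_of_copy (hE : IsTripleSystem E) (hF : IsTripleSystem F)
    [Fintype A] [Fintype E] {i : A ↪[tau] E} {f : A ↪[tau] F} (hi : StrongEmb i)
    (hf : StrongEmb f) (ψ : E → F) (hψ : Function.Injective ψ) (hψi : ∀ a, ψ (i a) = f a)
    (A₀ : Finset A) (C : Finset E) (hC : ∀ x, x ∈ C ↔ ¬ ∃ a, i a = x)
    (hδ : delta (A₀.map i.toEmbedding ∪ C) = delta (A₀.map i.toEmbedding))
    (hcol : ∀ x ∈ A₀.map i.toEmbedding ∪ C, ∀ y ∈ A₀.map i.toEmbedding ∪ C,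
      ∀ z ∈ A₀.map i.toEmbedding ∪ C, (Col (ψ x) (ψ y) (ψ z) ↔ Col x y z)) :
    ∃ j : E ↪[tau] F, StrongEmb j ∧ ∀ a, j (i a) = f a := by
  set D : Finset E := Finset.univ.map i.toEmbedding with hD
  set D' : Finset F := Finset.univ.map f.toEmbedding with hD'
  set B : Finset E := A₀.map i.toEmbedding with hB
  set B' : Finset F := A₀.map f.toEmbedding with hB'
  set C' : Finset F := C.image ψ with hC'
  have hDs : Strong D Set.univ := hi.strong (by simp [hD])
  have hDs' : Strong D' Set.univ := hf.strong (by simp [hD'])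
  have hDC : Disjoint D C := by
    rw [Finset.disjoint_left]
    intro x hx hxC
    exact (hC x).1 hxC (by simpa [hD] using hx)
  have hcover : ∀ x, x ∈ D ∪ C := by
    intro x
    rw [Finset.mem_union, hC]
    simp only [hD, Finset.mem_map, Finset.mem_univ, true_and, toEmbedding_apply]
    exact em _
  have hBD : B ⊆ D := Finset.map_subset_map.2 (Finset.subset_univ _)
  have hBD' : B' ⊆ D' := Finset.map_subset_map.2 (Finset.subset_univ _)
  have himD : ∀ A₁ : Finset A,
      (A₁.map i.toEmbedding).image ψ = A₁.map f.toEmbedding := by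
    intro A₁
    ext x
    simp [hψi]
  have hDC' : Disjoint D' C' := by
    rw [hD', ← himD, hC', ← hD]
    exact (Finset.disjoint_image hψ).2 hDC
  have hBC : (B ∪ C).image ψ = B' ∪ C' := by rw [Finset.image_union, hB, himD]
  have hδ' : delta (B' ∪ C') = delta B' := by
    rw [← hBC, hE.delta_image hF hψ.injOn hcol, hδ, hB, hB', hE.delta_map, hF.delta_map]
  have hsub : ∀ s, IsBlock s → ¬ Disjoint s C → s ⊆ B ∪ C := fun s hs hsC =>
    hE.subset_union_of_block hBD hDC hδ (strong_univ_iff.1 hDs _ Finset.subset_union_left)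
      (mem_blocks.2 ⟨fun x _ => hcover x, hs⟩) hsC
  have hsub' : ∀ s, IsBlock s → s ⊆ D' ∪ C' → ¬ Disjoint s C' → s ⊆ B' ∪ C' :=
    fun s hs hs' hsC => hF.subset_union_of_block hBD' hDC' hδ'
      (strong_univ_iff.1 hDs' _ Finset.subset_union_left) (mem_blocks.2 ⟨hs', hs⟩) hsC
  have himg : ∀ x, ψ x ∈ D' ∪ C' := by
    intro x
    rcases Finset.mem_union.1 (hcover x) with h | h
    · refine Finset.mem_union_left _ ?_
      rw [hD', ← himD]
      exact Finset.mem_image_of_mem _ h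
    · exact Finset.mem_union_right _ (Finset.mem_image_of_mem _ h)
  have hBCmem : ∀ x, ψ x ∈ B' ∪ C' → x ∈ B ∪ C := by
    intro x hx
    rw [← hBC] at hx
    obtain ⟨y, hy, hyx⟩ := Finset.mem_image.1 hx
    rwa [← hψ hyx]
  have hall : ∀ x y z, Col (ψ x) (ψ y) (ψ z) ↔ Col x y z := by
    intro x y z
    by_cases hxyz : x ∈ C ∨ y ∈ C ∨ z ∈ C
    · constructor
      · intro hc
        have hb := hF.col_iff_isBlock.1 hc
        have h1 := hsub' _ hb (by
          intro w hw
          simp only [Finset.mem_insert, Finset.mem_singleton] at hw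
          rcases hw with rfl | rfl | rfl <;> exact himg _) (by
          rw [Finset.not_disjoint_iff]
          rcases hxyz with h | h | h
          · exact ⟨ψ x, by simp, Finset.mem_image_of_mem _ h⟩
          · exact ⟨ψ y, by simp, Finset.mem_image_of_mem _ h⟩
          · exact ⟨ψ z, by simp, Finset.mem_image_of_mem _ h⟩)
        exact (hcol x (hBCmem x (h1 (by simp))) y (hBCmem y (h1 (by simp))) z
          (hBCmem z (h1 (by simp)))).1 hc
      · intro hc
        have hb := hE.col_iff_isBlock.1 hc
        have h1 := hsub _ hb (by
          rw [Finset.not_disjoint_iff]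
          rcases hxyz with h | h | h
          · exact ⟨x, by simp, h⟩
          · exact ⟨y, by simp, h⟩
          · exact ⟨z, by simp, h⟩)
        exact (hcol x (h1 (by simp)) y (h1 (by simp)) z (h1 (by simp))).2 hc
    · simp only [not_or, hC, not_not] at hxyz
      obtain ⟨⟨a, rfl⟩, ⟨b, rfl⟩, ⟨c, rfl⟩⟩ := hxyz
      rw [hψi, hψi, hψi, col_map, col_map]
  refine ⟨embeddingOfCol ψ hψ hall, ⟨D' ∪ C', fun x => ?_, ?_⟩, hψi⟩
  · constructor
    · intro hx
      rcases Finset.mem_union.1 hx with h | h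
      · obtain ⟨a, _, rfl⟩ := Finset.mem_map.1 h
        exact ⟨i a, hψi a⟩
      · obtain ⟨y, _, rfl⟩ := Finset.mem_image.1 h
        exact ⟨y, rfl⟩
    · rintro ⟨y, rfl⟩
      exact himg y
  · rw [strong_univ_iff]
    intro X hX
    refine le_trans ?_ (strong_univ_iff.1 hDs' X (Finset.subset_union_left.trans hX))
    have h1 := hF.delta_union_add_inter_le D' (B' ∪ C')
    have e1 : D' ∪ (B' ∪ C') = D' ∪ C' := by
      rw [← Finset.union_assoc, Finset.union_eq_left.2 hBD']
    have e2 : D' ∩ (B' ∪ C') = B' := by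
      rw [Finset.inter_union_distrib_left, Finset.inter_eq_right.2 hBD',
        Finset.disjoint_iff_inter_eq_empty.1 hDC', Finset.union_empty]
    rw [e1, e2, hδ'] at h1
    linarith

end FreeAmalgam

/-! ### Amalgamation in `K_μ` -/

section Amalgamation

variable {A E F : Type} [tau.Structure A] [tau.Structure E] [tau.Structure F]

theorem exists_finset_map_eq {α β : Type*} (k : α ↪ β) {X : Finset β}
    (h : ∀ x ∈ X, ∃ y, k y = x) : ∃ Z : Finset α, Z.map k = X := by
  refine ⟨X.preimage k k.injective.injOn, ?_⟩
  ext x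
  simp only [Finset.mem_map, Finset.mem_preimage]
  constructor
  · rintro ⟨a, ha, rfl⟩; exact ha
  · intro hx
    obtain ⟨a, rfl⟩ := h x hx
    exact ⟨a, hx, rfl⟩

/-- If a block of `E` and a block of `F` share two points of `A`, then a minimal strong extension
`E` of `A` has only one further point, and it is identified with a point of `F`. -/
theorem exists_strongEmb_of_conflict [Fintype A] [Fintype E] (hE : IsTripleSystem E)
    (hF : IsTripleSystem F) {i : A ↪[tau] E} {f : A ↪[tau] F} (hi : StrongEmb i)
    (hf : StrongEmb f)
    (hmin : ∀ Y : Finset E, (∀ x ∈ Y, ¬ ∃ a, i a = x) → Y.Nonempty →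
      (∃ x, (¬ ∃ a, i a = x) ∧ x ∉ Y) →
      delta (Finset.univ.map i.toEmbedding) < delta (Finset.univ.map i.toEmbedding ∪ Y))
    {t : Finset E} {u : Finset F} {a b : A} {x : E} (ht : IsBlock t) (hu : IsBlock u)
    (hab : a ≠ b) (hat : i a ∈ t) (hbt : i b ∈ t) (hau : f a ∈ u) (hbu : f b ∈ u) (hxt : x ∈ t)
    (hx : ¬ ∃ d, i d = x) :
    ∃ j : E ↪[tau] F, StrongEmb j ∧ ∀ a, j (i a) = f a := by
  have hiab : i a ≠ i b := i.injective.ne hab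
  have hax : i a ≠ x := fun e => hx ⟨a, e⟩
  have hbx : i b ≠ x := fun e => hx ⟨b, e⟩
  have hA₀ : ({a, b} : Finset A).map i.toEmbedding = {i a, i b} := by
    simp [Finset.map_insert]
  have hteq : ({a, b} : Finset A).map i.toEmbedding ∪ {x} = t := by
    refine Finset.eq_of_subset_of_card_le ?_ ?_
    · rw [hA₀]
      intro y hy
      simp only [Finset.mem_union, Finset.mem_insert, Finset.mem_singleton] at hy
      rcases hy with (rfl | rfl) | rfl <;> assumption
    · rw [hE.block_card ht, hA₀]
      refine (Finset.card_eq_three.2 ⟨i a, i b, x, hiab, hax, hbx, ?_⟩).ge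
      ext y; simp
  have hδ : delta (({a, b} : Finset A).map i.toEmbedding ∪ {x}) =
      delta (({a, b} : Finset A).map i.toEmbedding) := by
    rw [hteq, hE.delta_of_isBlock ht, hE.delta_of_card_le_two] <;>
      rw [Finset.card_map, Finset.card_pair hab]
    norm_num
  have hone : ∀ z, (¬ ∃ d, i d = z) → z = x := by
    intro z hz
    by_contra hzx
    have h1 := hmin {x} (by simpa using hx) (by simp) ⟨z, hz, by simpa using hzx⟩
    have h2 := hE.delta_union_add_inter_le (Finset.univ.map i.toEmbedding)
      (({a, b} : Finset A).map i.toEmbedding ∪ {x})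
    have hsub : ({a, b} : Finset A).map i.toEmbedding ⊆ Finset.univ.map i.toEmbedding :=
      Finset.map_subset_map.2 (Finset.subset_univ _)
    have hdisj : Disjoint (Finset.univ.map i.toEmbedding) {x} := by
      simpa using hx
    rw [← Finset.union_assoc, Finset.union_eq_left.2 hsub, Finset.inter_union_distrib_left,
      Finset.inter_eq_right.2 hsub, Finset.disjoint_iff_inter_eq_empty.1 hdisj,
      Finset.union_empty, hδ] at h2
    linarith
  obtain ⟨c, hc⟩ : ((u.erase (f a)).erase (f b)).Nonempty := by
    rw [← Finset.card_pos, Finset.card_erase_of_mem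
      (Finset.mem_erase.2 ⟨(f.injective.ne hab).symm, hbu⟩), Finset.card_erase_of_mem hau,
      hF.block_card hu]
    norm_num
  obtain ⟨hcb, hc⟩ := Finset.mem_erase.1 hc
  obtain ⟨hca, hcu⟩ := Finset.mem_erase.1 hc
  have hcf : ¬ ∃ d, f d = c := by
    rintro ⟨d, rfl⟩
    have h1 : Col a b d := (col_map f).1 (hF.col_of_mem hu hau hbu hcu (f.injective.ne hab)
      hca.symm hcb.symm)
    have h2 := hE.col_of_mem ht hat hbt hxt hiab hax hbx
    exact hx ⟨d, hE.third _ _ _ _ ((col_map i).2 h1) h2⟩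
  let ψ : E → F := fun y => if h : ∃ d, i d = y then f h.choose else c
  have hψ1 : ∀ d, ψ (i d) = f d := by
    intro d
    have h : ∃ e, i e = i d := ⟨d, rfl⟩
    have h' : h.choose = d := i.injective h.choose_spec
    simp only [ψ, dif_pos h, h']
  have hψ2 : ψ x = c := dif_neg hx
  have hinj : Function.Injective ψ := by
    intro y z hyz
    by_cases hy : ∃ d, i d = y
    · obtain ⟨d, rfl⟩ := hy
      by_cases hz : ∃ d, i d = z
      · obtain ⟨e, rfl⟩ := hz
        rw [hψ1, hψ1] at hyz
        rw [f.injective hyz]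
      · rw [hone z hz, hψ1, hψ2] at hyz
        exact absurd ⟨d, hyz⟩ hcf
    · by_cases hz : ∃ d, i d = z
      · obtain ⟨e, rfl⟩ := hz
        rw [hone y hy, hψ1, hψ2] at hyz
        exact absurd ⟨e, hyz.symm⟩ hcf
      · rw [hone y hy, hone z hz]
  have hmem : ∀ y ∈ t, ψ y ∈ u := by
    intro y hy
    rw [← hteq, hA₀] at hy
    simp only [Finset.mem_union, Finset.mem_insert, Finset.mem_singleton] at hy
    rcases hy with (rfl | rfl) | rfl
    · rwa [hψ1]
    · rwa [hψ1]
    · rwa [hψ2]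
  refine hE.exists_strongEmb_of_copy hF hi hf ψ hinj hψ1 {a, b} {x}
    (fun y => ⟨fun hy => ?_, fun hy => ?_⟩) hδ ?_
  · rw [Finset.mem_singleton.1 hy]; exact hx
  · exact Finset.mem_singleton.2 (hone y hy)
  · rw [hteq]
    intro p hp q hq r hr
    rw [hF.col_iff_of_mem hu (hmem p hp) (hmem q hq) (hmem r hr), hE.col_iff_of_mem ht hp hq hr,
      hinj.ne_iff, hinj.ne_iff, hinj.ne_iff]

/-- Amalgamation of `F` with a minimal strong extension `E` of `A`: either the free amalgam is in
`K_μ`, or `E` embeds into `F` over `A`. -/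
theorem amalgamation_minimal {μ : GoodPairType → ℕ} (hμ : TripleBound μ) [Fintype A] [Fintype E]
    (hE : InK μ E) (hF : InK μ F) {i : A ↪[tau] E} {f : A ↪[tau] F} (hi : StrongEmb i)
    (hf : StrongEmb f)
    (hmin : ∀ Y : Finset E, (∀ x ∈ Y, ¬ ∃ a, i a = x) → Y.Nonempty →
      (∃ x, (¬ ∃ a, i a = x) ∧ x ∉ Y) →
      delta (Finset.univ.map i.toEmbedding) < delta (Finset.univ.map i.toEmbedding ∪ Y)) :
    ∃ (M : Type) (_ : tau.Structure M) (jF : F ↪[tau] M) (jE : E ↪[tau] M),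
      InK μ M ∧ StrongEmb jF ∧ StrongEmb jE ∧ ∀ a, jF (f a) = jE (i a) := by
  obtain ⟨hEfin, hE3, hEpos, hEpack⟩ := (inK_iff hμ).1 hE
  obtain ⟨hFfin, hF3, hFpos, hFpack⟩ := (inK_iff hμ).1 hF
  have := Fintype.ofFinite F
  have hdone : (∃ j : E ↪[tau] F, StrongEmb j ∧ ∀ a, j (i a) = f a) →
      ∃ (M : Type) (_ : tau.Structure M) (jF : F ↪[tau] M) (jE : E ↪[tau] M),
        InK μ M ∧ StrongEmb jF ∧ StrongEmb jE ∧ ∀ a, jF (f a) = jE (i a) := by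
    rintro ⟨j, hj, hji⟩
    exact ⟨F, inferInstance, Language.Embedding.refl tau F, j, hF,
      strongEmb_of_surjective _ (fun x => ⟨x, rfl⟩), hj, fun a => (hji a).symm⟩
  by_cases hnc : ∀ (t : Finset E) (u : Finset F) (a b : A), IsBlock t → IsBlock u → a ≠ b →
      i a ∈ t → i b ∈ t → f a ∈ u → f b ∈ u → ∀ x ∈ t, ∃ d, i d = x
  swap
  · push Not at hnc
    obtain ⟨t, u, a, b, ht, hu, hab, h1, h2, h3, h4, x, hx, hx'⟩ := hnc
    exact hdone (exists_strongEmb_of_conflict hE3 hF3 hi hf hmin ht hu hab h1 h2 h3 h4 hx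
      (fun ⟨d, hd⟩ => hx' d hd))
  obtain ⟨M, sM, jF, jE, hM, hcomm, hcov, hint, hfree⟩ := exists_free_amalgam hE3 hF3 i f hnc
  have hMfin : Finite M := by
    have : Function.Surjective (Sum.elim jF jE) := by
      intro m
      rcases hcov m with ⟨x, hx⟩ | ⟨x, hx⟩
      · exact ⟨Sum.inl x, hx⟩
      · exact ⟨Sum.inr x, hx⟩
    exact Finite.of_surjective _ this
  set F' : Finset M := Finset.univ.map jF.toEmbedding with hF'
  set E' : Finset M := Finset.univ.map jE.toEmbedding with hE'
  set D : Finset E := Finset.univ.map i.toEmbedding with hD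
  set C : Finset E := Finset.univ.filter (fun x => ¬ ∃ a, i a = x) with hC
  have hmF : ∀ m, m ∈ F' ↔ ∃ x, jF x = m := fun m => by simp [hF']
  have hmE : ∀ m, m ∈ E' ↔ ∃ x, jE x = m := fun m => by simp [hE']
  have hmD : ∀ x, x ∈ D ↔ ∃ a, i a = x := fun x => by simp [hD]
  have hmC : ∀ x, x ∈ C ↔ ¬ ∃ a, i a = x := fun x => by simp [hC]
  have hFE : F' ∩ E' = D.map jE.toEmbedding := by
    ext m
    simp only [Finset.mem_inter, hmF, hmE, Finset.mem_map, hmD, toEmbedding_apply]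
    constructor
    · rintro ⟨⟨x, rfl⟩, ⟨y, hy⟩⟩
      obtain ⟨a, rfl, rfl⟩ := hint x y hy.symm
      exact ⟨i a, ⟨a, rfl⟩, hy⟩
    · rintro ⟨_, ⟨a, rfl⟩, rfl⟩
      exact ⟨⟨f a, hcomm a⟩, ⟨i a, rfl⟩⟩
  have hFE' : F' ∩ E' = (Finset.univ.map f.toEmbedding).map jF.toEmbedding := by
    rw [hFE]
    ext m
    simp [hD, ← hcomm]
  have hEF : E' \ F' = C.map jE.toEmbedding := by
    ext m
    simp only [Finset.mem_sdiff, hmF, hmE, Finset.mem_map, hmC, toEmbedding_apply]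
    constructor
    · rintro ⟨⟨x, rfl⟩, h2⟩
      exact ⟨x, fun ⟨a, ha⟩ => h2 ⟨f a, by rw [hcomm, ha]⟩, rfl⟩
    · rintro ⟨x, hx, rfl⟩
      refine ⟨⟨x, rfl⟩, fun ⟨y, hy⟩ => hx ?_⟩
      obtain ⟨a, _, ha⟩ := hint y x hy
      exact ⟨a, ha⟩
  have hcover : ∀ m, m ∈ F' ∨ m ∈ E' := fun m => by rw [hmF, hmE]; exact hcov m
  have hfree' : ∀ s, IsBlock s → s ⊆ F' ∨ s ⊆ E' := fun s hs =>
    (hfree s hs).imp (fun h m hm => (hmF m).2 (h m hm)) (fun h m hm => (hmE m).2 (h m hm))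
  have hFs : Strong F' Set.univ := by
    refine hM.strong_of_free hcover hfree' fun X h1 h2 => ?_
    obtain ⟨Z, -, rfl⟩ := exists_map_eq_of_subset h2
    rw [hFE] at h1 ⊢
    rw [hM.delta_map, hM.delta_map]
    exact strong_univ_iff.1 (hi.strong hmD) _ (Finset.map_subset_map.1 h1)
  have hEs : Strong E' Set.univ := by
    refine hM.strong_of_free (fun m => (hcover m).symm) (fun s hs => (hfree' s hs).symm)
      fun X h1 h2 => ?_
    obtain ⟨Z, -, rfl⟩ := exists_map_eq_of_subset h2
    rw [Finset.inter_comm, hFE'] at h1 ⊢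
    rw [hM.delta_map, hM.delta_map]
    exact strong_univ_iff.1 (hf.strong (by simp)) _ (Finset.map_subset_map.1 h1)
  have hpos : ∀ X : Finset M, 0 ≤ delta X := by
    intro X
    refine le_trans ?_ (hM.delta_inter_le hFs X)
    obtain ⟨Z, hZ⟩ := exists_map_eq_of_subset (Finset.inter_subset_right (s₁ := X) (s₂ := F'))
    rw [← hZ.2, hM.delta_map]
    exact hFpos Z
  by_cases hpack : PackingBound μ M
  · exact ⟨M, sM, jF, jE, (inK_iff hμ).2 ⟨hMfin, hM, hpos, hpack⟩, ⟨F', hmF, hFs⟩,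
      ⟨E', hmE, hEs⟩, hcomm⟩
  -- a good pair which is packed too often shows that `E` has a copy over `A` in `F`
  refine hdone ?_
  simp only [PackingBound, not_forall, not_le] at hpack
  obtain ⟨P, hP, ι, _, g, hg, hcard⟩ := hpack
  obtain ⟨k, l, hbase, hext, hdisj⟩ := hM.exists_of_card_lt hFs hEs hpos hcover hfree'
    (by
      intro Y hY hne hYne
      rw [hEF] at hY hYne
      obtain ⟨Z, hZ, rfl⟩ := exists_map_eq_of_subset hY
      rw [hFE, ← Finset.map_union, hM.delta_map, hM.delta_map]
      refine hmin Z (fun x hx => (hmC x).1 (hZ hx)) (Finset.map_nonempty.1 hne) ?_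
      by_contra! hcon
      exact hYne (by rw [hZ.antisymm fun x hx => hcon x (by simpa using (hmC x).1 hx)]))
    hg (hμ.delta_le P hP) hcard
    (fun h => hFpack.card_le jF hP hg (fun k x => (hmF _).1 (h k x)))
    (fun h => hEpack.card_le jE hP hg (fun k x => (hmE _).1 (h k x)))
  obtain ⟨A₀, hA₀⟩ : ∃ A₀ : Finset A,
      (A₀.map i.toEmbedding).map jE.toEmbedding = P.base.map (g k).toEmbedding := by
    rw [hFE] at hbase
    obtain ⟨Z, hZ, hZ'⟩ := exists_map_eq_of_subset hbase
    obtain ⟨A₀, -, hA₀⟩ := exists_map_eq_of_subset hZ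
    exact ⟨A₀, by rw [hA₀, hZ']⟩
  have hC' : C.map jE.toEmbedding = P.ext.map (g k).toEmbedding := by rw [hext, hEF]
  have hprim := (hM.goodIn_pair P (g k)).toPrim
  have hψ : ∀ x : E, ∃ y : F, (∀ a, i a = x → y = f a) ∧
      ((¬ ∃ a, i a = x) → ∃ p ∈ P.ext, g k p = jE x ∧ g l p = jF y) := by
    intro x
    by_cases hx : ∃ a, i a = x
    · obtain ⟨a, rfl⟩ := hx
      exact ⟨f a, fun b hb => by rw [i.injective hb], fun h => absurd ⟨a, rfl⟩ h⟩
    · have h1 : jE x ∈ P.ext.map (g k).toEmbedding := by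
        rw [← hC']
        exact Finset.mem_map_of_mem jE.toEmbedding ((hmC x).2 hx)
      obtain ⟨p, hp, hpx⟩ := Finset.mem_map.1 h1
      have h2 : g l p ∉ E' :=
        Finset.disjoint_left.1 hdisj (Finset.mem_map_of_mem (g l).toEmbedding hp)
      obtain ⟨y, hy⟩ := (hmF _).1 ((hcover (g l p)).resolve_right h2)
      exact ⟨y, fun a ha => absurd ⟨a, ha⟩ hx, fun _ => ⟨p, hp, hpx, hy.symm⟩⟩
  choose ψ hψ1 hψ2 using hψ
  have hψi : ∀ a, ψ (i a) = f a := fun a => hψ1 _ a rfl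
  have hnot : ∀ a p, p ∈ P.ext → g l p ≠ jF (f a) := by
    intro a p hp h1
    refine Finset.disjoint_left.1 hdisj (Finset.mem_map_of_mem (g l).toEmbedding hp) ?_
    rw [toEmbedding_apply, h1, hcomm, hmE]
    exact ⟨_, rfl⟩
  have hinj : Function.Injective ψ := by
    intro x y hxy
    by_cases hx : ∃ a, i a = x <;> by_cases hy : ∃ a, i a = y
    · obtain ⟨a, rfl⟩ := hx
      obtain ⟨b, rfl⟩ := hy
      rw [hψi, hψi] at hxy
      rw [f.injective hxy]
    · obtain ⟨a, rfl⟩ := hx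
      obtain ⟨p, hp, -, h2⟩ := hψ2 y hy
      rw [← hxy, hψi] at h2
      exact absurd h2 (hnot a p hp)
    · obtain ⟨b, rfl⟩ := hy
      obtain ⟨p, hp, -, h2⟩ := hψ2 x hx
      rw [hxy, hψi] at h2
      exact absurd h2 (hnot b p hp)
    · obtain ⟨p, hp, h1, h2⟩ := hψ2 x hx
      obtain ⟨q, hq, h3, h4⟩ := hψ2 y hy
      rw [hxy, ← h4] at h2
      have := (g l).injective h2
      rw [this, h3] at h1
      exact (jE.injective h1).symm
  have hpt : ∀ x ∈ A₀.map i.toEmbedding ∪ C, ∃ p, g k p = jE x ∧ g l p = jF (ψ x) := by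
    intro x hx
    rcases Finset.mem_union.1 hx with hx | hx
    · have h1 := Finset.mem_map_of_mem jE.toEmbedding hx
      rw [hA₀] at h1
      obtain ⟨p, hp, hpx⟩ := Finset.mem_map.1 h1
      obtain ⟨a, _, rfl⟩ := Finset.mem_map.1 hx
      refine ⟨p, hpx, ?_⟩
      rw [toEmbedding_apply, hψi, hcomm, ← hg.agree k l p hp]
      exact hpx
    · obtain ⟨p, -, h1, h2⟩ := hψ2 x ((hmC x).1 hx)
      exact ⟨p, h1, h2⟩
  refine hE3.exists_strongEmb_of_copy hF3 hi hf ψ hinj hψi A₀ C hmC ?_ ?_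
  · rw [← hM.delta_map jE, ← hM.delta_map jE, Finset.map_union, hA₀, hC', hprim.delta_eq]
  · intro x hx y hy z hz
    obtain ⟨p, hp1, hp2⟩ := hpt x hx
    obtain ⟨q, hq1, hq2⟩ := hpt y hy
    obtain ⟨r, hr1, hr2⟩ := hpt z hz
    rw [← col_map jF, ← hp2, ← hq2, ← hr2, col_map, ← col_map (g k), hp1, hq1, hr1, col_map]

/-- The class `K_μ` has the amalgamation property for strong embeddings. -/
theorem amalgamation {μ : GoodPairType → ℕ} (hμ : TripleBound μ) (n : ℕ) :
    ∀ (A E F : Type) [tau.Structure A] [tau.Structure E] [tau.Structure F],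
      InK μ E → InK μ F → ∀ (i : A ↪[tau] E) (f : A ↪[tau] F), StrongEmb i → StrongEmb f →
        Nat.card E - Nat.card A = n →
        ∃ (M : Type) (_ : tau.Structure M) (jF : F ↪[tau] M) (jE : E ↪[tau] M),
          InK μ M ∧ StrongEmb jF ∧ StrongEmb jE ∧ ∀ a, jF (f a) = jE (i a) := by
  induction n using Nat.strong_induction_on with
  | _ n ih =>
    intro A E F _ _ _ hE hF i f hi hf hn
    have hEfin := hE.1.finite
    have hFfin := hF.1.finite
    have hE3 := hE.isTripleSystem hμ
    have hF3 := hF.isTripleSystem hμ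
    have hAfin : Finite A := Finite.of_injective i i.injective
    have := Fintype.ofFinite A
    have := Fintype.ofFinite E
    by_cases hsurj : Function.Surjective i
    · obtain ⟨k, hk⟩ := exists_factor i (Language.Embedding.refl tau E) hsurj
      have hk' : ∀ x, i (k x) = x := hk
      refine ⟨F, inferInstance, Language.Embedding.refl tau F, f.comp k, hF,
        strongEmb_of_surjective _ (fun x => ⟨x, rfl⟩), hF3.strongEmb_comp hf
        (strongEmb_of_surjective _ fun a => ⟨i a, i.injective (hk' _)⟩), fun a => ?_⟩
      change f a = f (k (i a))
      rw [i.injective (hk' (i a))]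
    -- the least strong subset of `E` properly extending `A`
    set D : Finset E := Finset.univ.map i.toEmbedding with hD
    have hmD : ∀ x, x ∈ D ↔ ∃ a, i a = x := fun x => by simp [hD]
    have hDs : Strong D Set.univ := hi.strong hmD
    obtain ⟨U, hU, hUmin⟩ := Finset.exists_min_image
      (Finset.univ.filter (fun U : Finset E => D ⊂ U ∧ Strong U Set.univ)) Finset.card
      ⟨Finset.univ, by
        rw [Finset.mem_filter]
        refine ⟨Finset.mem_univ _, ?_, ?_⟩
        · rw [Finset.ssubset_univ_iff]
          intro h
          exact hsurj fun x => (hmD x).1 (h ▸ Finset.mem_univ x)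
        · exact strong_univ_iff.2 fun X hX => by rw [Finset.univ_subset_iff.1 hX]⟩
    obtain ⟨-, hDU, hUs⟩ := Finset.mem_filter.1 hU
    let E₁ := sub (U : Set E)
    let inc : E₁ ↪[tau] E := E₁.subtype
    have hincr : ∀ x, x ∈ U ↔ ∃ y, inc y = x := fun x =>
      ⟨fun hx => ⟨⟨x, hx⟩, rfl⟩, fun ⟨y, hy⟩ => hy ▸ y.2⟩
    have hinc : StrongEmb inc := ⟨U, hincr, hUs⟩
    obtain ⟨i₁, hi₁⟩ := exists_factor inc i fun a =>
      (hincr _).1 (hDU.subset ((hmD _).2 ⟨a, rfl⟩))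
    have hcomp : inc.comp i₁ = i := by ext a; exact hi₁ a
    have hi₁s : StrongEmb i₁ := hE3.strongEmb_of_comp (j := inc) (by rw [hcomp]; exact hi)
    have hE₁ : InK μ E₁ := hE.of_embedding hμ inc
    have hE₁fin : Finite E₁ := hE₁.1.finite
    have := Fintype.ofFinite E₁
    have hDinc : (Finset.univ.map i₁.toEmbedding).map inc.toEmbedding = D := by
      ext x
      simp [hD, hi₁]
    obtain ⟨M₁, _, jF, jE, hM₁, hjF, hjE, hcomm⟩ := amalgamation_minimal hμ hE₁ hF hi₁s hf (by
      intro Y hY hYne ⟨z, hz, hzY⟩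
      by_contra! hle
      set W := (Finset.univ.map i₁.toEmbedding ∪ Y).map inc.toEmbedding with hW
      have hDW : D ⊆ W := by
        rw [← hDinc]
        exact Finset.map_subset_map.2 Finset.subset_union_left
      have h1 := hUmin W (Finset.mem_filter.2 ⟨Finset.mem_univ _, ?_, ?_⟩)
      · have hWU : W ⊂ U := by
          refine Finset.ssubset_iff_subset_ne.2 ⟨fun x hx => ?_, fun he => ?_⟩
          · obtain ⟨y, _, rfl⟩ := Finset.mem_map.1 hx
            exact y.2
          · have : inc z ∈ W := he ▸ z.2
            rw [hW] at this
            have := (Finset.mem_map' inc.toEmbedding).1 this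
            rcases Finset.mem_union.1 this with h | h
            · exact hz (by simpa using h)
            · exact hzY h
        exact absurd (Finset.card_lt_card hWU) (by omega)
      · refine Finset.ssubset_iff_subset_ne.2 ⟨hDW, fun he => ?_⟩
        obtain ⟨y, hy⟩ := hYne
        have : inc y ∈ D := by
          rw [he]
          exact Finset.mem_map_of_mem inc.toEmbedding (Finset.mem_union_right _ hy)
        obtain ⟨a, ha⟩ := (hmD _).1 this
        exact hY y hy ⟨a, inc.injective (by rw [hi₁, ha])⟩
      · rw [strong_univ_iff]
        intro X hX
        have h2 := strong_univ_iff.1 hDs X (hDW.trans hX)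
        rw [hW, hE3.delta_map]
        rw [← hDinc, hE3.delta_map] at h2
        refine le_of_eq_of_le ?_ (hle.trans h2)
        congr!)
    have hcard : Nat.card E - Nat.card E₁ < n := by
      have h1 : Nat.card E₁ = U.card := by
        rw [Nat.card_eq_fintype_card, ← Fintype.card_coe U]
        exact Fintype.card_congr (Equiv.refl _)
      have h2 : D.card = Nat.card A := by
        rw [hD, Finset.card_map, Finset.card_univ, Nat.card_eq_fintype_card]
      have h3 := Finset.card_lt_card hDU
      have h4 : U.card ≤ Nat.card E := by
        rw [Nat.card_eq_fintype_card]; exact Finset.card_le_univ U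
      omega
    obtain ⟨M, sM, kF, kE, hM, hkF, hkE, hcomm'⟩ :=
      ih _ hcard E₁ E M₁ hE hM₁ inc jE hinc hjE rfl
    refine ⟨M, sM, kF.comp jF, kE, hM, (hM.isTripleSystem hμ).strongEmb_comp hkF hjF, hkE,
      fun a => ?_⟩
    change kF (jF (f a)) = _
    rw [hcomm, hcomm', hi₁]

/-! ### Completing a block -/

/-- If no block of `F` contains the points `a` and `b`, a new point completing a block with them
can be added without leaving `K_μ`. -/
theorem exists_extend_block {μ : GoodPairType → ℕ} (hμ : TripleBound μ) (hF : InK μ F) {a b : F}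
    (hab : a ≠ b) (hno : ∀ c, ¬ Col a b c) :
    ∃ (M : Type) (_ : tau.Structure M) (jF : F ↪[tau] M),
      InK μ M ∧ StrongEmb jF ∧ ∃ m, Col (jF a) (jF b) m := by
  obtain ⟨hFfin, hF3, hFpos, hFpack⟩ := (inK_iff hμ).1 hF
  have := Fintype.ofFinite F
  let := alphaStructure
  let B : tau.Substructure (Fin 3) := sub {0, 1}
  let i : B ↪[tau] Fin 3 := B.subtype
  have hB : ∀ x : B, x.1 = 0 ∨ x.1 = 1 := fun x => x.2
  let f₀ : B → F := fun x => if x.1 = 0 then a else b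
  have hf₀ : ∀ x, f₀ x = a ∨ f₀ x = b := fun x => by
    simp only [f₀]; split_ifs <;> simp
  have hfinj : Function.Injective f₀ := by
    intro x y hxy
    apply Subtype.ext
    rcases hB x with hx | hx <;> rcases hB y with hy | hy <;> simp_all [f₀]
  have hnoB : ∀ x y z : B, ¬ Col x y z := by
    intro x y z h
    obtain ⟨h1, h2, h3⟩ := alpha_col.1 ((col_map i).2 h)
    change x.1 ≠ y.1 at h1
    change x.1 ≠ z.1 at h2
    change y.1 ≠ z.1 at h3
    rcases hB x with hx | hx <;> rcases hB y with hy | hy <;> rcases hB z with hz | hz <;>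
      simp_all
  let f : B ↪[tau] F := embeddingOfCol f₀ hfinj (by
    intro x y z
    refine ⟨fun h => ?_, fun h => absurd h (hnoB x y z)⟩
    obtain ⟨h1, h2, h3⟩ := hF3.distinct _ _ _ h
    rcases hf₀ x with hx | hx <;> rcases hf₀ y with hy | hy <;> rcases hf₀ z with hz | hz <;>
      simp_all)
  have hnb : ∀ u : Finset F, IsBlock u → a ∈ u → b ∈ u → False := by
    intro u hu ha hb
    have h1 : ((u.erase a).erase b).Nonempty := by
      rw [← Finset.card_pos, Finset.card_erase_of_mem (Finset.mem_erase.2 ⟨hab.symm, hb⟩),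
        Finset.card_erase_of_mem ha, hF3.block_card hu]
      norm_num
    obtain ⟨c, hc⟩ := h1
    simp only [Finset.mem_erase] at hc
    exact hno c (hF3.col_of_mem hu ha hb hc.2.2 hab hc.2.1.symm hc.1.symm)
  obtain ⟨M, sM, jF, jE, hM, hcomm, hcov, hint, hfree⟩ :=
    exists_free_amalgam alpha_isTripleSystem hF3 i f (by
      intro t u x y _ hu hxy _ _ hxu hyu
      exfalso
      have hxu' : f₀ x ∈ u := hxu
      have hyu' : f₀ y ∈ u := hyu
      have hne := hfinj.ne hxy
      rcases hf₀ x with h1 | h1 <;> rcases hf₀ y with h2 | h2 <;> rw [h1] at hxu' hne <;>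
        rw [h2] at hyu' hne
      · exact hne rfl
      · exact hnb u hu hxu' hyu'
      · exact hnb u hu hyu' hxu'
      · exact hne rfl)
  have h0 : jF a = jE 0 := hcomm ⟨0, Or.inl rfl⟩
  have h1 : jF b = jE 1 := by
    have := hcomm ⟨1, Or.inr rfl⟩
    have h2 : f₀ ⟨1, Or.inr rfl⟩ = b := by simp [f₀]
    change jF (f₀ ⟨1, Or.inr rfl⟩) = _ at this
    rwa [h2] at this
  have h2 : ∀ x, jF x ≠ jE 2 := by
    intro x hx
    obtain ⟨y, _, hy⟩ := hint x 2 hx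
    have hy' : y.1 = 2 := hy
    rcases hB y with h | h <;> rw [h] at hy' <;> revert hy' <;> decide
  have hcol : Col (jF a) (jF b) (jE 2) := by
    rw [h0, h1, col_map, alpha_col]
    decide
  have hall : ∀ m, (∃ x, jF x = m) ∨ m = jE 2 := by
    intro m
    rcases hcov m with h | ⟨x, rfl⟩
    · exact Or.inl h
    · have : x = 0 ∨ x = 1 ∨ x = 2 := by revert x; decide
      rcases this with rfl | rfl | rfl
      · exact Or.inl ⟨a, h0⟩
      · exact Or.inl ⟨b, h1⟩
      · exact Or.inr rfl
  have hMfin : Finite M := by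
    have : Function.Surjective (Sum.elim jF jE) := by
      intro m
      rcases hcov m with ⟨x, hx⟩ | ⟨x, hx⟩
      · exact ⟨Sum.inl x, hx⟩
      · exact ⟨Sum.inr x, hx⟩
    exact Finite.of_surjective _ this
  set F' : Finset M := Finset.univ.map jF.toEmbedding with hF'
  have hmF : ∀ m, m ∈ F' ↔ ∃ x, jF x = m := fun m => by simp [hF']
  set b₀ : Finset M := {jF a, jF b, jE 2} with hb₀
  have hb₀b : IsBlock b₀ := hM.col_iff_isBlock.1 hcol
  have hb₀F : b₀.erase (jE 2) ⊆ F' := by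
    intro m hm
    simp only [hb₀, Finset.mem_erase, Finset.mem_insert, Finset.mem_singleton] at hm
    rw [hmF]
    rcases hm with ⟨h3, rfl | rfl | rfl⟩
    · exact ⟨a, rfl⟩
    · exact ⟨b, rfl⟩
    · exact absurd rfl h3
  -- the new point lies in a single block
  have hfree' : ∀ s, IsBlock s → s ⊆ F' ∨ s = b₀ := by
    intro s hs
    rcases hfree s hs with h | h
    · exact Or.inl fun m hm => (hmF m).2 (h m hm)
    · have hsb : s ⊆ b₀ := by
        intro m hm
        obtain ⟨x, rfl⟩ := h m hm
        have : x = 0 ∨ x = 1 ∨ x = 2 := by clear hm; revert x; decide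
        rcases this with rfl | rfl | rfl
        · simp [hb₀, h0]
        · simp [hb₀, h1]
        · simp [hb₀]
      exact Or.inr (Finset.eq_of_subset_of_card_le hsb
        (by rw [hM.block_card hs, hM.block_card hb₀b]))
  have hFs : Strong F' Set.univ := by
    have hinter : F' ∩ b₀ = {jF a, jF b} := by
      ext m
      simp only [Finset.mem_inter, hmF, hb₀, Finset.mem_insert, Finset.mem_singleton]
      constructor
      · rintro ⟨⟨x, rfl⟩, h | h | h⟩
        · exact Or.inl h
        · exact Or.inr h
        · exact absurd h (h2 x)
      · rintro (rfl | rfl)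
        · exact ⟨⟨a, rfl⟩, by simp⟩
        · exact ⟨⟨b, rfl⟩, by simp⟩
    have hd2 : ∀ X : Finset M, X.card = 2 → delta X = 2 := fun X hX => by
      rw [hM.delta_of_card_le_two hX.le, hX]; norm_num
    have hc2 : ({jF a, jF b} : Finset M).card = 2 := Finset.card_pair (jF.injective.ne hab)
    refine hM.strong_of_free (E := b₀) (fun m => ?_) (fun s hs => ?_) (fun X hX hX' => ?_)
    · rcases hall m with h | h
      · exact Or.inl ((hmF m).2 h)
      · exact Or.inr (by simp [hb₀, h])
    · exact (hfree' s hs).imp id fun h => h.subset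
    · rw [hinter] at hX ⊢
      rw [hd2 _ hc2]
      have h3 := hM.block_card hb₀b
      rcases (Finset.card_le_card hX').lt_or_eq with h4 | h4
      · rw [hd2 X (by have := Finset.card_le_card hX; omega)]
      · rw [Finset.eq_of_subset_of_card_le hX' h4.ge, hM.delta_of_isBlock hb₀b]
  have hpos : ∀ X : Finset M, 0 ≤ delta X := by
    intro X
    refine le_trans ?_ (hM.delta_inter_le hFs X)
    obtain ⟨Z, hZ⟩ := exists_map_eq_of_subset (Finset.inter_subset_right (s₁ := X) (s₂ := F'))
    rw [← hZ.2, hM.delta_map]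
    exact hFpos Z
  refine ⟨M, sM, jF, (inK_iff hμ).2 ⟨hMfin, hM, hpos, fun P hP ι _ g hg => ?_⟩, ⟨F', hmF, hFs⟩,
    _, hcol⟩
  by_contra! hcard
  obtain ⟨k₀⟩ : Nonempty ι := Fintype.card_pos_iff.1 (by omega)
  obtain ⟨A, hA⟩ : ∃ A, ∀ k, P.base.map (g k).toEmbedding = A :=
    ⟨_, fun k => hg.base_eq k k₀⟩
  have hgood : ∀ k, GoodIn A (P.ext.map (g k).toEmbedding) := fun k => hA k ▸ hM.goodIn_pair P (g k)
  by_cases hAF : A ⊆ F'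
  · have : ∃ k, ¬ P.ext.map (g k).toEmbedding ⊆ F' := by
      by_contra! hcon
      refine absurd (hFpack.card_le jF hP hg fun k x => (hmF _).1 ?_) (by omega)
      by_cases hx : x ∈ P.base
      · exact hAF (hA k ▸ Finset.mem_map_of_mem (g k).toEmbedding hx)
      · exact hcon k (Finset.mem_map_of_mem (g k).toEmbedding (Finset.mem_compl.2 hx))
    obtain ⟨k, hk⟩ := this
    have hdis := (hM.subset_or_disjoint hFs (hgood k).toPrim hAF).resolve_left hk
    have hsub : P.ext.map (g k).toEmbedding ⊆ {jE 2} := by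
      intro m hm
      have := Finset.disjoint_left.1 hdis hm
      rw [hmF] at this
      exact Finset.mem_singleton.2 ((hall m).resolve_left this)
    have := Finset.card_le_card hsub
    rw [Finset.card_map, Finset.card_singleton] at this
    omega
  · obtain ⟨c, hcA, hcF⟩ := Finset.not_subset.1 hAF
    have hc2 : c = jE 2 := (hall c).resolve_left (fun h => hcF ((hmF c).2 h))
    have h3 := hM.card_le_of_not_subset hFs (hpos _) hgood hg.disjoint hAF (by
      intro k
      obtain ⟨s, hs, hcs, hsB⟩ := (hgood k).touches c hcA
      obtain ⟨x, hxs, hxB⟩ := Finset.not_disjoint_iff.1 hsB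
      have hsb : s = b₀ := (hfree' s (mem_blocks.1 hs).2).resolve_left fun h => hcF (h hcs)
      refine Finset.not_disjoint_iff.2 ⟨x, hxB, hb₀F (Finset.mem_erase.2 ⟨?_, hsb ▸ hxs⟩)⟩
      rintro rfl
      exact Finset.disjoint_left.1 (hgood k).disjoint (hc2 ▸ hcA) hxB)
    rw [← hA k₀, hM.delta_map] at h3
    have := hμ.delta_le P hP
    omega

end Amalgamation

/-! ### Existence of generic structures -/

section Generic

/-- The structure without blocks. -/
@[reducible] def discreteStructure (X : Type) : tau.Structure X := structureOfBlocks ∅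

theorem discrete_isTripleSystem (X : Type) : @IsTripleSystem X (discreteStructure X) :=
  isTripleSystem_structureOfBlocks _ (by simp) (by simp)

theorem discrete_inK {μ : GoodPairType → ℕ} (hμ : TripleBound μ) (X : Type) [Finite X] :
    @InK μ X (discreteStructure X) := by
  let := discreteStructure X
  have h := discrete_isTripleSystem X
  have hb : ∀ Y : Finset X, blocks Y = ∅ := by
    intro Y
    refine Finset.eq_empty_of_forall_notMem fun s hs => ?_
    exact (isBlock_structureOfBlocks (X := X) ∅ (by simp)).1 (mem_blocks.1 hs).2
  refine (inK_iff hμ).2 ⟨inferInstance, h, fun Y => ?_, fun P _ ι _ g _ => ?_⟩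
  · rw [h.delta_eq, hb]
    simp
  · rcases isEmpty_or_nonempty ι with hι | ⟨⟨k⟩⟩
    · simp [Fintype.card_eq_zero]
    have hp := (h.goodIn_pair P (g k)).toPrim
    obtain ⟨b, hb'⟩ := hp.nonempty
    obtain ⟨s, hs, -⟩ := h.exists_block_of_prim hp hb'
    rw [hb] at hs
    simp at hs

/-- A member of `K_μ` on an initial segment of the natural numbers: a finite approximation of the
generic structure. -/
structure State (μ : GoodPairType → ℕ) where
  n : ℕ
  [str : tau.Structure (Fin n)]
  inK : InK μ (Fin n)
  triple : IsTripleSystem (Fin n)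

variable {μ : GoodPairType → ℕ}

instance (s : State μ) : tau.Structure (Fin s.n) := s.str

/-- States are ordered by strong extension. -/
instance : Preorder (State μ) where
  le s t := ∃ g : Fin s.n ↪[tau] Fin t.n, (∀ x, (g x : ℕ) = x) ∧ StrongEmb g
  le_refl s := ⟨Language.Embedding.refl tau _, fun _ => rfl,
    strongEmb_of_surjective _ fun x => ⟨x, rfl⟩⟩
  le_trans s t u := by
    rintro ⟨g, hg, hgs⟩ ⟨k, hk, hks⟩
    exact ⟨k.comp g, fun x => (hk _).trans (hg x), u.triple.strongEmb_comp hks hgs⟩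

theorem structure_ext_of_col {X : Type} {s t : tau.Structure X}
    (h : ∀ a b c, @Col X s a b c ↔ @Col X t a b c) : s = t := by
  ext n f v
  · exact nomatch f
  · cases f
    have := h (v 0) (v 1) (v 2)
    unfold Col at this
    have hv : ![v 0, v 1, v 2] = v := by
      funext i; fin_cases i <;> rfl
    rwa [hv] at this

instance : Countable (State μ) := by
  let F : State μ → Σ n : ℕ, (Fin n → Fin n → Fin n → Prop) := fun s => ⟨s.n, fun a b c => Col a b c⟩
  refine Function.Injective.countable (f := F) ?_
  rintro ⟨n, h1, h2⟩ ⟨m, k1, k2⟩ h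
  obtain rfl : n = m := congrArg Sigma.fst h
  have h' := eq_of_heq (Sigma.mk.inj h).2
  rename_i s t
  obtain rfl : s = t := structure_ext_of_col fun a b c => by
    have := congrFun (congrFun (congrFun h' a) b) c
    exact iff_of_eq this
  rfl

/-- A strong extension of a state can be renumbered to a larger state. -/
theorem State.exists_extension (hμ : TripleBound μ) (s : State μ) {M : Type} [tau.Structure M]
    (hM : InK μ M) {j : Fin s.n ↪[tau] M} (hj : StrongEmb j) :
    ∃ (t : State μ) (e : M ↪[tau] Fin t.n), s ≤ t ∧ Function.Surjective e ∧
      ∀ x, (e (j x) : ℕ) = x := by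
  have hfin := hM.1.finite
  have := Fintype.ofFinite M
  let f : M → ℕ := fun m => if h : ∃ x, j x = m then h.choose else 0
  have hf : ∀ x, f (j x) = x := by
    intro x
    have h : ∃ y, j y = j x := ⟨x, rfl⟩
    simp only [f, dif_pos h, j.injective h.choose_spec]
  have hcard : s.n ≤ Fintype.card M := by
    simpa using Fintype.card_le_of_injective j j.injective
  obtain ⟨e, he⟩ := Set.MapsTo.exists_equiv_extend_of_card_eq (α := M)
    (t := Finset.range (Fintype.card M)) (by simp) (s := Set.range j) (f := f)
    (by
      rintro _ ⟨x, rfl⟩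
      rw [hf]
      simpa using x.2.trans_le hcard)
    (by
      rintro _ ⟨x, rfl⟩ _ ⟨y, rfl⟩ hxy
      rw [hf, hf] at hxy
      rw [Fin.ext hxy])
  let e' : M ≃ Fin (Fintype.card M) := e.trans
    ⟨fun x => ⟨x.1, Finset.mem_range.1 x.2⟩, fun x => ⟨x.1, Finset.mem_range.2 x.2⟩,
      fun _ => rfl, fun _ => rfl⟩
  let := e'.inducedStructure (L := tau)
  let E : M ↪[tau] Fin (Fintype.card M) := (e'.inducedStructureEquiv (L := tau)).toEmbedding
  let E' : Fin (Fintype.card M) ↪[tau] M := (e'.inducedStructureEquiv (L := tau)).symm.toEmbedding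
  have hE : ∀ m, E m = e' m := fun m => rfl
  have hK : InK μ (Fin (Fintype.card M)) := hM.of_embedding hμ E'
  have hsurj : Function.Surjective E := fun x => ⟨e'.symm x, by rw [hE]; simp⟩
  have hval : ∀ x, ((E (j x) : Fin _) : ℕ) = x := by
    intro x
    rw [hE]
    change (e (j x) : ℕ) = x
    rw [he _ ⟨x, rfl⟩, hf]
  refine ⟨⟨Fintype.card M, hK, hK.isTripleSystem hμ⟩, E, ⟨E.comp j, hval, ?_⟩, hsurj, hval⟩
  exact (hK.isTripleSystem hμ).strongEmb_comp (strongEmb_of_surjective E hsurj) hj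

/-- The empty state. -/
theorem exists_empty_state (hμ : TripleBound μ) : ∃ s : State μ, s.n = 0 :=
  ⟨@State.mk μ 0 (discreteStructure _) (discrete_inK hμ _) (discrete_isTripleSystem _), rfl⟩

theorem strongEmb_of_isEmpty {A M : Type} [tau.Structure A] [tau.Structure M] [IsEmpty A]
    (h : IsTripleSystem M) (hpos : ∀ X : Finset M, 0 ≤ delta X) (i : A ↪[tau] M) :
    StrongEmb i :=
  ⟨∅, fun x => by simp, strong_univ_iff.2 fun X _ => by rw [h.delta_empty]; exact hpos X⟩

/-- The embedding of a structure without points. -/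
def emptyEmbedding (A M : Type) [tau.Structure A] [tau.Structure M] [IsEmpty A] : A ↪[tau] M :=
  embeddingOfCol isEmptyElim (fun a => isEmptyElim a) (fun a => isEmptyElim a)

theorem exists_state_equiv (hμ : TripleBound μ) {M : Type} [tau.Structure M] (hM : InK μ M) :
    ∃ (t : State μ) (e : M ↪[tau] Fin t.n), Function.Surjective e := by
  obtain ⟨s, hs⟩ := exists_empty_state hμ
  have : IsEmpty (Fin s.n) := by rw [hs]; infer_instance
  obtain ⟨t, e, -, he, -⟩ := s.exists_extension hμ hM
    (strongEmb_of_isEmpty (hM.isTripleSystem hμ) hM.1.delta_nonneg (emptyEmbedding (Fin s.n) M))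
  exact ⟨t, e, he⟩

theorem State.exists_large (hμ : TripleBound μ) (m : ℕ) (s : State μ) :
    ∃ t : State μ, m ≤ t.n ∧ s ≤ t := by
  let := discreteStructure (Fin m)
  obtain ⟨z, hz⟩ := exists_empty_state hμ
  have : IsEmpty (Fin z.n) := by rw [hz]; infer_instance
  have hm : InK μ (Fin m) := discrete_inK hμ _
  obtain ⟨M, _, jF, jE, hM, hjF, -, -⟩ := amalgamation hμ _ (Fin z.n) (Fin m) (Fin s.n)
    hm s.inK (emptyEmbedding _ _) (emptyEmbedding _ _)
    (strongEmb_of_isEmpty (discrete_isTripleSystem _) hm.1.delta_nonneg _)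
    (strongEmb_of_isEmpty s.triple s.inK.1.delta_nonneg _) rfl
  obtain ⟨t, e, hst, -, -⟩ := s.exists_extension hμ hM hjF
  refine ⟨t, ?_, hst⟩
  simpa using Fintype.card_le_of_injective (e.comp jE) (e.comp jE).injective

/-- The extension problems: a strong extension of states `A ≤ B`, and a placement of `A` among the
natural numbers. -/
def Task (μ : GoodPairType → ℕ) : Type :=
  Σ (B : State μ) (A : State μ), (Fin A.n ↪[tau] Fin B.n) × (Fin A.n → ℕ)

instance : Countable (Task μ) := by
  have : ∀ B A : State μ, Countable (Fin A.n ↪[tau] Fin B.n) := fun B A =>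
    DFunLike.coe_injective.countable
  unfold Task
  infer_instance

/-- The states which solve a given extension problem. -/
def Task.solved (T : Task μ) : Set (State μ) :=
  {s | (∀ x, T.2.2.2 x < s.n) ∧ ∀ f : Fin T.2.1.n ↪[tau] Fin s.n, (∀ x, (f x : ℕ) = T.2.2.2 x) →
    StrongEmb T.2.2.1 → StrongEmb f →
      ∃ g : Fin T.1.n ↪[tau] Fin s.n, StrongEmb g ∧ ∀ x, g (T.2.2.1 x) = f x}

theorem Task.isCofinal (hμ : TripleBound μ) (T : Task μ) : IsCofinal T.solved := by
  intro s
  obtain ⟨B, A, i, h⟩ := T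
  obtain ⟨m, hm⟩ : ∃ m, ∀ x, h x < m := by
    obtain ⟨m, hm⟩ := (Set.finite_range h).bddAbove
    exact ⟨m + 1, fun x => Nat.lt_succ_of_le (hm ⟨x, rfl⟩)⟩
  obtain ⟨s₁, hs₁, hle⟩ := s.exists_large hμ m
  by_cases hex : ∃ f : Fin A.n ↪[tau] Fin s₁.n, (∀ x, (f x : ℕ) = h x) ∧ StrongEmb i ∧ StrongEmb f
  · obtain ⟨f, hf, hi, hfs⟩ := hex
    obtain ⟨M, _, jF, jE, hM, hjF, hjE, hcomm⟩ := amalgamation hμ _ (Fin A.n) (Fin B.n)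
      (Fin s₁.n) B.inK s₁.inK i f hi hfs rfl
    obtain ⟨t, e, hst, he, hval⟩ := s₁.exists_extension hμ hM hjF
    refine ⟨t, ⟨fun x => ?_, fun f' hf' _ _ => ⟨e.comp jE, ?_, fun x => ?_⟩⟩, hle.trans hst⟩
    · change h x < t.n
      rw [← hf x, ← hval]
      exact Fin.is_lt _
    · exact t.triple.strongEmb_comp (strongEmb_of_surjective e he) hjE
    · apply Fin.ext
      rw [hf' x]
      change (e (jE (i x)) : ℕ) = h x
      rw [← hcomm, hval, hf]
  · refine ⟨s₁, ⟨fun x => (hm x).trans_le hs₁, fun f hf hi hfs => absurd ⟨f, hf, hi, hfs⟩ hex⟩, hle⟩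

/-- The generic structure exists: it is the union of a directed system of states which solves all
extension problems. -/
theorem exists_generic (hμ : TripleBound μ) :
    ∃ (G : Type) (_ : tau.Structure G), IsGeneric μ G := by
  let : Encodable (Task μ ⊕ ℕ) := Encodable.ofCountable _
  obtain ⟨z, -⟩ := exists_empty_state hμ
  let 𝒟 : Task μ ⊕ ℕ → Order.Cofinal (State μ) := Sum.elim
    (fun T => ⟨T.solved, T.isCofinal hμ⟩) (fun m => ⟨{t | m ≤ t.n}, State.exists_large hμ m⟩)
  let I := Order.idealOfCofinals z 𝒟
  have hsolved : ∀ T : Task μ, ∃ s ∈ T.solved, s ∈ I := fun T =>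
    Order.cofinal_meets_idealOfCofinals z 𝒟 (Sum.inl T)
  have hlarge : ∀ m : ℕ, ∃ s : State μ, m ≤ s.n ∧ s ∈ I := fun m =>
    Order.cofinal_meets_idealOfCofinals z 𝒟 (Sum.inr m)
  have hdir : ∀ s ∈ I, ∀ t ∈ I, ∃ u ∈ I, s ≤ u ∧ t ≤ u := fun s hs t ht =>
    I.directed s hs t ht
  have hval : ∀ {s t : State μ} (g : Fin s.n ↪[tau] Fin t.n) (_ : ∀ x, (g x : ℕ) = x)
      (b : Finset (Fin s.n)), (b.map g.toEmbedding).map Fin.valEmbedding =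
        b.map Fin.valEmbedding := by
    intro s t g hg b
    ext x
    simp [hg]
  let T : Set (Finset ℕ) := {b | ∃ s ∈ I, ∃ b₀ : Finset (Fin s.n), IsBlock b₀ ∧
    b₀.map Fin.valEmbedding = b}
  have hT3 : ∀ b ∈ T, b.card = 3 := by
    rintro _ ⟨s, _, b, hb, rfl⟩
    rw [Finset.card_map, s.triple.block_card hb]
  have hT1 : ∀ b ∈ T, ∀ c ∈ T, ∀ x y, x ≠ y → x ∈ b → y ∈ b → x ∈ c → y ∈ c → b = c := by
    rintro _ ⟨s, hs, b, hb, rfl⟩ _ ⟨t, ht, c, hc, rfl⟩ x y hxy hxb hyb hxc hyc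
    obtain ⟨u, -, ⟨g, hg, -⟩, ⟨k, hk, -⟩⟩ := hdir s hs t ht
    rw [← hval g hg] at hxb hyb ⊢
    rw [← hval k hk] at hxc hyc ⊢
    obtain ⟨x, hx, rfl⟩ := Finset.mem_map.1 hxb
    obtain ⟨y, hy, rfl⟩ := Finset.mem_map.1 hyb
    rw [u.triple.block_eq ((isBlock_map g).2 hb) ((isBlock_map k).2 hc)
      (fun e => hxy (by rw [e])) hx hy ((Finset.mem_map' _).1 hxc) ((Finset.mem_map' _).1 hyc)]
  let sG : tau.Structure ℕ := structureOfBlocks T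
  have hG : IsTripleSystem ℕ := isTripleSystem_structureOfBlocks T hT3 hT1
  have hblock : ∀ b : Finset ℕ, IsBlock b ↔ b ∈ T := fun b => isBlock_structureOfBlocks T hT3
  have hcol : ∀ s ∈ I, ∀ a b c : Fin s.n, Col (a : ℕ) (b : ℕ) (c : ℕ) ↔ Col a b c := by
    intro s hs a b c
    have he := map_triple (Fin.valEmbedding (n := s.n)) a b c
    rw [s.triple.col_iff_isBlock]
    refine (hG.col_iff_isBlock.trans (iff_of_eq (congrArg IsBlock he.symm))).trans ?_
    rw [hblock]
    constructor
    · rintro ⟨t, ht, d, hd, hd'⟩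
      obtain ⟨u, -, ⟨g, hg, -⟩, ⟨k, hk, -⟩⟩ := hdir s hs t ht
      rw [← hval g hg, ← hval k hk] at hd'
      have := Finset.map_injective _ hd'
      rw [← isBlock_map g, ← this, isBlock_map]
      exact hd
    · intro h
      exact ⟨s, hs, _, h, rfl⟩
  have hemb : ∀ s ∈ I, ∃ j : Fin s.n ↪[tau] ℕ, ∀ x, j x = x := fun s hs =>
    ⟨embeddingOfCol (fun x => (x : ℕ)) Fin.val_injective (hcol s hs), fun _ => rfl⟩
  have hcontains : ∀ X : Finset ℕ, ∀ s ∈ I, ∃ t ∈ I, s ≤ t ∧ ∀ x ∈ X, x < t.n := by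
    intro X s hs
    obtain ⟨u, hu, huI⟩ := hlarge (X.sup id + 1)
    obtain ⟨t, ht, hst, hut⟩ := hdir s hs u huI
    refine ⟨t, ht, hst, fun x hx => ?_⟩
    obtain ⟨g, -⟩ := hut
    have h1 : u.n ≤ t.n := by simpa using Fintype.card_le_of_injective g g.injective
    have h2 : x ≤ X.sup id := Finset.le_sup (f := id) hx
    omega
  have hstrong : ∀ s ∈ I, ∀ j : Fin s.n ↪[tau] ℕ, (∀ x, j x = x) → StrongEmb j := by
    intro s hs j hj
    refine ⟨Finset.univ.map j.toEmbedding, fun x => by simp, strong_univ_iff.2 fun X hX => ?_⟩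
    obtain ⟨t, ht, ⟨g, hg, hgs⟩, hXt⟩ := hcontains X s hs
    obtain ⟨k, hk⟩ := hemb t ht
    obtain ⟨Y, rfl⟩ := exists_finset_map_eq k.toEmbedding (X := X)
      (fun x hx => ⟨⟨x, hXt x hx⟩, hk _⟩)
    have he : Finset.univ.map j.toEmbedding =
        (Finset.univ.map g.toEmbedding).map k.toEmbedding := by
      ext x
      simp [hj, hk, hg]
    rw [he] at hX ⊢
    rw [hG.delta_map, hG.delta_map]
    exact strong_univ_iff.1 (hgs.strong (by simp)) Y (Finset.map_subset_map.1 hX)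
  refine ⟨ℕ, sG, inferInstance, fun S hS => ?_, fun X => ?_, ?_⟩
  · have := Fintype.ofFinite S
    obtain ⟨t, ht, -, hXt⟩ := hcontains (Finset.univ.map S.subtype.toEmbedding) z
      (Order.mem_idealOfCofinals z _)
    obtain ⟨k, hk⟩ := hemb t ht
    obtain ⟨g, -⟩ := exists_factor k S.subtype (fun x =>
      ⟨⟨S.subtype x, hXt _ (Finset.mem_map_of_mem S.subtype.toEmbedding (Finset.mem_univ x))⟩,
        hk _⟩)
    exact t.inK.of_embedding hμ g
  · obtain ⟨t, ht, -, hXt⟩ := hcontains X z (Order.mem_idealOfCofinals z _)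
    obtain ⟨k, hk⟩ := hemb t ht
    refine ⟨Finset.univ.map k.toEmbedding, fun x hx => ?_, (hstrong t ht k hk).strong (by simp)⟩
    exact Finset.mem_map.2 ⟨⟨x, hXt x hx⟩, Finset.mem_univ _, hk _⟩
  · intro A B _ _ _ _ hB i f hi hf
    rw [isStrongEmbedding_iff] at hi hf
    obtain ⟨sB, eB, heB⟩ := exists_state_equiv hμ hB
    obtain ⟨sA, eA, heA⟩ := exists_state_equiv hμ (hB.of_embedding hμ i)
    obtain ⟨eA', heA'⟩ := exists_factor eA (Language.Embedding.refl tau _) heA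
    have hA1 : ∀ x, eA (eA' x) = x := heA'
    have hA2 : ∀ a, eA' (eA a) = a := fun a => eA.injective (hA1 _)
    have hA3 : Function.Surjective eA' := fun a => ⟨_, hA2 a⟩
    obtain ⟨t, ⟨ht1, ht2⟩, htI⟩ := hsolved
      ⟨sB, sA, (eB.comp i).comp eA', fun x => f (eA' x)⟩
    obtain ⟨k, hk⟩ := hemb t htI
    obtain ⟨f₀, hf₀⟩ := exists_factor k (f.comp eA') (fun x => ⟨⟨f (eA' x), ht1 x⟩, hk _⟩)
    have hA := (hB.isTripleSystem hμ).of_embedding i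
    have hf₀s : StrongEmb f₀ := by
      refine hG.strongEmb_of_comp (j := k) ?_
      have : k.comp f₀ = f.comp eA' := by ext x; exact hf₀ x
      rw [this]
      have := Finite.of_injective i i.injective
      exact hG.strongEmb_comp hf (strongEmb_of_surjective _ hA3)
    have hBfin := hB.1.finite
    have hi₀ : StrongEmb ((eB.comp i).comp eA') :=
      sB.triple.strongEmb_comp (sB.triple.strongEmb_comp (strongEmb_of_surjective _ heB) hi)
        (strongEmb_of_surjective _ hA3)
    obtain ⟨g, hg, hgi⟩ := ht2 f₀ (fun x => by rw [← hk]; exact hf₀ x) hi₀ hf₀s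
    refine ⟨(k.comp g).comp eB, ?_, fun a => ?_⟩
    · rw [isStrongEmbedding_iff]
      exact hG.strongEmb_comp (hG.strongEmb_comp (hstrong t htI k hk) hg)
        (strongEmb_of_surjective _ heB)
    · have h1 : g (eB (i (eA' (eA a)))) = f₀ (eA a) := hgi (eA a)
      rw [hA2] at h1
      change k (g (eB (i a))) = f a
      rw [h1]
      have h2 : k (f₀ (eA a)) = f (eA' (eA a)) := hf₀ _
      rw [h2, hA2]

/-! ### Generic structures are Steiner triple systems -/

theorem IsGeneric.isTripleSystem (hμ : TripleBound μ) {G : Type} [tau.Structure G]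
    (hG : IsGeneric μ G) : IsTripleSystem G := by
  have key : ∀ X : Finset G, IsTripleSystem (sub (X : Set G)) := fun X =>
    (hG.inHatK (sub (X : Set G)) X.finite_toSet).isTripleSystem hμ
  have lift : ∀ (X : Finset G) {a b c : G} (ha : a ∈ X) (hb : b ∈ X) (hc : c ∈ X),
      Col a b c ↔ Col (⟨a, ha⟩ : sub (X : Set G)) ⟨b, hb⟩ ⟨c, hc⟩ := fun X a b c ha hb hc =>
    col_map (sub (X : Set G)).subtype (a := ⟨a, ha⟩) (b := ⟨b, hb⟩) (c := ⟨c, hc⟩)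
  refine ⟨⟨fun a b c h => ?_, fun a b c h => ?_, fun a b c h => ?_, fun a b c d hn h1 h2 => ?_⟩,
    fun a b c d h1 h2 => ?_⟩
  all_goals
    first
    | (have hX := key {a, b, c, d}
       have ha : a ∈ ({a, b, c, d} : Finset G) := by simp
       have hb : b ∈ ({a, b, c, d} : Finset G) := by simp
       have hc : c ∈ ({a, b, c, d} : Finset G) := by simp
       have hd : d ∈ ({a, b, c, d} : Finset G) := by simp
       rw [lift _ ha hb hc] at h1
       rw [lift _ ha hb hd] at h2
       have h3 := hX.third _ _ _ _ h1 h2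
       have h4 : c = d := congrArg Subtype.val h3
       first | exact h4 | exact absurd h4 hn)
    | (have hX := key {a, b, c}
       have ha : a ∈ ({a, b, c} : Finset G) := by simp
       have hb : b ∈ ({a, b, c} : Finset G) := by simp
       have hc : c ∈ ({a, b, c} : Finset G) := by simp
       rw [lift _ ha hb hc] at h
       first
       | exact (lift _ hb ha hc).2 (hX.swap _ _ _ h)
       | exact (lift _ hb hc ha).2 (hX.rotate _ _ _ h)
       | (obtain ⟨h1, h2, h3⟩ := hX.distinct _ _ _ h
          exact ⟨fun e => h1 (Subtype.ext e), fun e => h2 (Subtype.ext e),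
            fun e => h3 (Subtype.ext e)⟩))

/-- In a generic structure every pair of points lies in a block: otherwise a block through them
could be completed over a finite strong set containing them. -/
theorem IsGeneric.exists_col (hμ : TripleBound μ) {G : Type} [tau.Structure G]
    (hG : IsGeneric μ G) {a b : G} (hab : a ≠ b) : ∃ c, Col a b c := by
  by_contra! hno
  obtain ⟨Y, hY, hYs⟩ := hG.exhausted {a, b}
  let S := sub (Y : Set G)
  have hfin : Finite S := Y.finite_toSet
  have := Fintype.ofFinite S
  have hS : InK μ S := hG.inHatK S hfin
  let a' : S := ⟨a, hY (by simp)⟩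
  let b' : S := ⟨b, hY (by simp)⟩
  obtain ⟨M, _, jF, hM, hjF, m, hm⟩ := exists_extend_block hμ hS (a := a') (b := b')
    (fun e => hab (congrArg Subtype.val e))
    (fun c hc => hno c.1 ((col_map S.subtype).2 hc))
  have hMfin := hM.1.finite
  have := Fintype.ofFinite M
  have hSs : StrongEmb S.subtype := ⟨Y, fun x => ⟨fun hx => ⟨⟨x, hx⟩, rfl⟩,
    fun ⟨y, hy⟩ => hy ▸ y.2⟩, hYs⟩
  obtain ⟨g, -, hg⟩ := hG.extension S M hM jF S.subtype ((isStrongEmbedding_iff _).2 hjF)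
    ((isStrongEmbedding_iff _).2 hSs)
  have h1 := (col_map g).2 hm
  rw [hg, hg] at h1
  exact hno _ h1

theorem IsGeneric.isSteinerSystem (hμ : TripleBound μ) {G : Type} [tau.Structure G]
    (hG : IsGeneric μ G) : IsSteinerSystem 3 G := by
  have h := hG.isTripleSystem hμ
  refine ⟨h.toIsLinearSpace, fun a b hab => ?_⟩
  obtain ⟨c, hc⟩ := hG.exists_col hμ hab
  obtain ⟨h1, h2, h3⟩ := h.distinct _ _ _ hc
  have : {x : G | x = a ∨ x = b ∨ Col a b x} = {a, b, c} := by
    ext x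
    simp only [Set.mem_ofPred_eq, Set.mem_insert_iff, Set.mem_singleton_iff]
    refine or_congr_right (or_congr_right ⟨fun hx => h.third _ _ _ _ hx hc, ?_⟩)
    rintro rfl
    exact hc
  rw [this]
  exact Set.encard_eq_three.2 ⟨a, b, c, h1, h2, h3, rfl⟩

end Generic

/-! ### Cycles over two points -/

section Cycles

/-- The points of a family of cycles of length `2 (k + 2)`, indexed by `J`, over two base points:
`base false` and `base true` are the base points, and `pt (j, i, e)` are the points of the `j`-th
cycle, in the order `…, (j, i, false), (j, i, true), (j, i + 1, false), …`. -/
inductive Cyc (J : Type) (k : ℕ) : Type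
  | base : Bool → Cyc J k
  | pt : J × ZMod (k + 2) × Bool → Cyc J k

variable {J : Type} {k : ℕ}

theorem Cyc.pt_injective : Function.Injective (Cyc.pt : _ → Cyc J k) := fun _ _ h => by
  injection h

theorem Cyc.base_injective : Function.Injective (Cyc.base : _ → Cyc J k) := fun _ _ h => by
  injection h

/-- The base points and the points of the cycles, as a disjoint sum. -/
def cycEquiv (J : Type) (k : ℕ) : Cyc J k ≃ Bool ⊕ (J × ZMod (k + 2) × Bool) where
  toFun x := match x with
    | Cyc.base e => Sum.inl e
    | Cyc.pt p => Sum.inr p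
  invFun x := match x with
    | Sum.inl e => Cyc.base e
    | Sum.inr p => Cyc.pt p
  left_inv := by rintro (e | p) <;> rfl
  right_inv := by rintro (e | p) <;> rfl

noncomputable instance [Fintype J] : Fintype (Cyc J k) := Fintype.ofEquiv _ (cycEquiv J k).symm

/-- The map induced by a reindexing of the cycles. -/
def Cyc.map {J' : Type} (f : J → J') : Cyc J k → Cyc J' k
  | Cyc.base e => Cyc.base e
  | Cyc.pt p => Cyc.pt (f p.1, p.2)

/-- The successor of a point of a cycle. -/
def next (p : J × ZMod (k + 2) × Bool) : J × ZMod (k + 2) × Bool :=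
  if p.2.2 then (p.1, p.2.1 + 1, false) else (p.1, p.2.1, true)

theorem next_snd (p : J × ZMod (k + 2) × Bool) : (next p).2.2 = !p.2.2 := by
  obtain ⟨j, i, _ | _⟩ := p <;> rfl

theorem next_fst (p : J × ZMod (k + 2) × Bool) : (next p).1 = p.1 := by
  obtain ⟨j, i, _ | _⟩ := p <;> rfl

theorem next_injective : Function.Injective (next : J × ZMod (k + 2) × Bool → _) := by
  rintro ⟨j, i, _ | _⟩ ⟨j', i', _ | _⟩ h <;> simp_all [next]

theorem next_ne (p : J × ZMod (k + 2) × Bool) : next p ≠ p := by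
  intro h
  have := next_snd p
  rw [h] at this
  simp at this

theorem next_next_ne (p : J × ZMod (k + 2) × Bool) : next (next p) ≠ p := by
  have : Fact (1 < k + 2) := ⟨by omega⟩
  obtain ⟨j, i, _ | _⟩ := p <;> simp [next]

/-- The block through a point of a cycle, its successor and one of the two base points, which
alternate along the cycle. -/
noncomputable def cycBlock (p : J × ZMod (k + 2) × Bool) : Finset (Cyc J k) :=
  {Cyc.base p.2.2, Cyc.pt p, Cyc.pt (next p)}

theorem mem_cycBlock {p : J × ZMod (k + 2) × Bool} {x : Cyc J k} :
    x ∈ cycBlock p ↔ x = Cyc.base p.2.2 ∨ x = Cyc.pt p ∨ x = Cyc.pt (next p) := by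
  simp [cycBlock]

theorem card_cycBlock (p : J × ZMod (k + 2) × Bool) : (cycBlock p).card = 3 := by
  refine Finset.card_eq_three.2 ⟨Cyc.base p.2.2, Cyc.pt p, Cyc.pt (next p), by simp, by simp,
    by simpa using (next_ne p).symm, ?_⟩
  ext x
  simp [mem_cycBlock]

theorem cycBlock_eq {p q : J × ZMod (k + 2) × Bool} {x y : Cyc J k} (hxy : x ≠ y)
    (hxp : x ∈ cycBlock p) (hyp : y ∈ cycBlock p) (hxq : x ∈ cycBlock q)
    (hyq : y ∈ cycBlock q) : p = q := by
  have h1 : p = next q → p.2.2 ≠ q.2.2 := by rintro rfl; simp [next_snd]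
  have h2 : next p = q → p.2.2 ≠ q.2.2 := by rintro rfl; simp [next_snd]
  have h3 : next p = next q → p = q := fun h => next_injective h
  have h4 : p = next q → next p ≠ q := by rintro rfl; exact next_next_ne q
  rw [mem_cycBlock] at hxp hyp hxq hyq
  rcases x with x | x <;> rcases y with y | y <;>
    simp only [Cyc.base.injEq, Cyc.pt.injEq, reduceCtorEq, false_or, or_false] at hxp hyp hxq hyq
  · exact absurd (by rw [hxp, hyp]) hxy
  · have he : p.2.2 = q.2.2 := hxp.symm.trans hxq
    rcases hyp with rfl | rfl <;> rcases hyq with h | h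
    · exact h
    · exact absurd he (h1 h)
    · exact absurd he (h2 h)
    · exact h3 h
  · have he : p.2.2 = q.2.2 := hyp.symm.trans hyq
    rcases hxp with rfl | rfl <;> rcases hxq with h | h
    · exact h
    · exact absurd he (h1 h)
    · exact absurd he (h2 h)
    · exact h3 h
  · rcases hxp with rfl | rfl <;> rcases hxq with h | h
    · exact h
    · rcases hyp with rfl | rfl
      · exact absurd rfl hxy
      · rcases hyq with h' | h'
        · exact absurd h' (h4 h)
        · exact h3 h'
    · rcases hyp with rfl | rfl
      · rcases hyq with h' | h'
        · exact h'
        · exact absurd h (h4 h')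
      · exact absurd rfl hxy
    · exact h3 h

theorem cycBlock_injective : Function.Injective (cycBlock : J × ZMod (k + 2) × Bool → _) := by
  intro p q h
  refine cycBlock_eq (x := Cyc.base p.2.2) (y := Cyc.pt p) (by simp) ?_ ?_ ?_ ?_
  · simp [mem_cycBlock]
  · simp [mem_cycBlock]
  · rw [← h]; simp [mem_cycBlock]
  · rw [← h]; simp [mem_cycBlock]

instance : tau.Structure (Cyc J k) := structureOfBlocks (Set.range cycBlock)

theorem cyc_card_of_mem : ∀ s ∈ Set.range (cycBlock (J := J) (k := k)), s.card = 3 := by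
  rintro _ ⟨p, rfl⟩
  exact card_cycBlock p

theorem cyc_isTripleSystem : IsTripleSystem (Cyc J k) := by
  refine isTripleSystem_structureOfBlocks _ cyc_card_of_mem ?_
  rintro _ ⟨p, rfl⟩ _ ⟨q, rfl⟩ x y hxy h1 h2 h3 h4
  rw [cycBlock_eq hxy h1 h2 h3 h4]

theorem cyc_isBlock {s : Finset (Cyc J k)} : IsBlock s ↔ ∃ p, cycBlock p = s :=
  isBlock_structureOfBlocks _ cyc_card_of_mem

/-- The predimension in a family of cycles: base points, plus points of cycles, minus those which
span a block. -/
theorem cyc_delta [Fintype J] (W : Finset (Cyc J k)) :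
    delta W = ((Finset.univ.filter (fun e : Bool => (Cyc.base e : Cyc J k) ∈ W)).card : ℤ) +
      (Finset.univ.filter (fun p => (Cyc.pt p : Cyc J k) ∈ W)).card -
      (Finset.univ.filter (fun p => cycBlock p ⊆ W)).card := by
  have h1 : (blocks W).card = (Finset.univ.filter (fun p => cycBlock p ⊆ W)).card := by
    rw [← Finset.card_image_of_injective _ (cycBlock_injective (J := J) (k := k))]
    congr 1
    ext s
    simp only [mem_blocks, cyc_isBlock, Finset.mem_image, Finset.mem_filter, Finset.mem_univ,
      true_and]
    constructor
    · rintro ⟨h, p, rfl⟩; exact ⟨p, h, rfl⟩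
    · rintro ⟨p, h, rfl⟩; exact ⟨h, p, rfl⟩
  have h2 : W.card = (Finset.univ.filter (fun e : Bool => (Cyc.base e : Cyc J k) ∈ W)).card +
      (Finset.univ.filter (fun p => (Cyc.pt p : Cyc J k) ∈ W)).card := by
    rw [← Finset.card_map (⟨Cyc.base, Cyc.base_injective⟩ : Bool ↪ Cyc J k),
      ← Finset.card_map (⟨Cyc.pt, Cyc.pt_injective⟩ : J × ZMod (k + 2) × Bool ↪ Cyc J k),
      ← Finset.card_union_of_disjoint]
    · congr 1
      ext x
      rcases x with x | x <;> simp
    · rw [Finset.disjoint_left]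
      rintro (x | x) <;> simp
  rw [cyc_isTripleSystem.delta_eq, h1, h2]
  push_cast
  ring

theorem cyc_blocks_subset [Fintype J] (W : Finset (Cyc J k)) :
    Finset.univ.filter (fun p => cycBlock p ⊆ W) ⊆
      Finset.univ.filter (fun p => (Cyc.pt p : Cyc J k) ∈ W) := by
  intro p hp
  simp only [Finset.mem_filter, Finset.mem_univ, true_and] at hp ⊢
  exact hp (by simp [mem_cycBlock])

theorem cyc_delta_nonneg [Fintype J] (W : Finset (Cyc J k)) : 0 ≤ delta W := by
  rw [cyc_delta]
  have := Finset.card_le_card (cyc_blocks_subset W)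
  omega

/-- The base of the cycles. -/
noncomputable def cycBase (J : Type) (k : ℕ) : Finset (Cyc J k) := {Cyc.base false, Cyc.base true}

theorem inl_mem_cycBase (e : Bool) : (Cyc.base e : Cyc J k) ∈ cycBase J k := by
  cases e <;> simp [cycBase]

theorem inr_notMem_cycBase (p : J × ZMod (k + 2) × Bool) :
    (Cyc.pt p : Cyc J k) ∉ cycBase J k := by
  simp [cycBase]

theorem cyc_delta_of_base_subset [Fintype J] {W : Finset (Cyc J k)} (hW : cycBase J k ⊆ W) :
    delta W = 2 + (Finset.univ.filter (fun p => (Cyc.pt p : Cyc J k) ∈ W)).card -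
      (Finset.univ.filter (fun p => cycBlock p ⊆ W)).card := by
  have : Finset.univ.filter (fun e : Bool => (Cyc.base e : Cyc J k) ∈ W) = Finset.univ := by
    ext e
    simpa using hW (inl_mem_cycBase e)
  rw [cyc_delta, this]
  simp

theorem cyc_delta_base : delta (cycBase J k) = 2 := by
  have : (cycBase J k).card = 2 := Finset.card_pair (by simp)
  rw [cyc_isTripleSystem.delta_of_card_le_two this.le, this]
  norm_num

theorem cyc_strong_base [Fintype J] : Strong (cycBase J k) Set.univ := by
  rw [strong_univ_iff]
  intro W hW
  rw [cyc_delta_base, cyc_delta_of_base_subset hW]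
  have := Finset.card_le_card (cyc_blocks_subset W)
  omega

/-- A set which adds nothing to the predimension of the base is closed under successors. -/
theorem cyc_next_mem [Fintype J] {W : Finset (Cyc J k)} (hW : cycBase J k ⊆ W) (hδ : delta W ≤ 2)
    {p : J × ZMod (k + 2) × Bool} (hp : (Cyc.pt p : Cyc J k) ∈ W) :
    (Cyc.pt (next p) : Cyc J k) ∈ W := by
  rw [cyc_delta_of_base_subset hW] at hδ
  have h1 := Finset.eq_of_subset_of_card_le (cyc_blocks_subset W) (by omega)
  have h2 : p ∈ Finset.univ.filter (fun p => cycBlock p ⊆ W) := by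
    rw [h1]
    simpa using hp
  simp only [Finset.mem_filter, Finset.mem_univ, true_and] at h2
  exact h2 (by simp [mem_cycBlock])

/-- A set closed under successors contains every cycle which it meets. -/
theorem cyc_forall_mem {S : Set (J × ZMod (k + 2) × Bool)} (hS : ∀ p ∈ S, next p ∈ S)
    {p : J × ZMod (k + 2) × Bool} (hp : p ∈ S) (q : J × ZMod (k + 2) × Bool) (hq : q.1 = p.1) :
    q ∈ S := by
  obtain ⟨j, i, e⟩ := p
  obtain ⟨j', i', e'⟩ := q
  obtain rfl : j' = j := hq
  have hfalse : ∀ i, (j', i, true) ∈ S → (j', i + 1, false) ∈ S := fun i h => hS _ h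
  have htrue : ∀ i, (j', i, false) ∈ S → (j', i, true) ∈ S := fun i h => hS _ h
  obtain ⟨i₀, h0⟩ : ∃ i₀, (j', i₀, false) ∈ S := by
    cases e
    · exact ⟨i, hp⟩
    · exact ⟨i + 1, hfalse i hp⟩
  have hn : ∀ n : ℕ, (j', i₀ + n, false) ∈ S := by
    intro n
    induction n with
    | zero => simpa using h0
    | succ n ih =>
      have := hfalse _ (htrue _ ih)
      rwa [add_assoc, ← Nat.cast_succ] at this
  have hall : ∀ i, (j', i, false) ∈ S := by
    intro i
    have := hn (i - i₀).val
    rwa [ZMod.natCast_zmod_val, add_sub_cancel] at this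
  cases e'
  · exact hall i'
  · exact htrue _ (hall i')

/-- The points of the `j`-th cycle. -/
noncomputable def cycle [Fintype J] (j : J) : Finset (Cyc J k) :=
  (Finset.univ.filter (fun p : J × ZMod (k + 2) × Bool => p.1 = j)).map ⟨Cyc.pt, Cyc.pt_injective⟩

theorem inr_mem_cycle [Fintype J] {j : J} {p : J × ZMod (k + 2) × Bool} :
    (Cyc.pt p : Cyc J k) ∈ cycle j ↔ p.1 = j := by
  simp only [cycle, Finset.mem_map, Finset.mem_filter, Finset.mem_univ, true_and,
    Function.Embedding.coeFn_mk, Cyc.pt.injEq, exists_eq_right]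

theorem inl_notMem_cycle [Fintype J] {j : J} {e : Bool} : (Cyc.base e : Cyc J k) ∉ cycle j := by
  simp [cycle]

theorem disjoint_base_cycle [Fintype J] (j : J) : Disjoint (cycBase J k) (cycle j) := by
  rw [Finset.disjoint_left]
  rintro (e | p) h1 h2
  · exact inl_notMem_cycle h2
  · exact inr_notMem_cycBase p h1

theorem cyc_delta_union_cycle [Fintype J] (j : J) :
    delta (cycBase J k ∪ cycle j) = delta (cycBase J k) := by
  rw [cyc_delta_base, cyc_delta_of_base_subset Finset.subset_union_left]
  have : Finset.univ.filter (fun p => cycBlock p ⊆ cycBase J k ∪ cycle j) =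
      Finset.univ.filter (fun p => (Cyc.pt p : Cyc J k) ∈ cycBase J k ∪ cycle j) := by
    refine (cyc_blocks_subset _).antisymm fun p hp => ?_
    simp only [Finset.mem_filter, Finset.mem_univ, true_and, Finset.mem_union, inr_mem_cycle,
      inr_notMem_cycBase, false_or] at hp ⊢
    intro x hx
    rw [mem_cycBlock] at hx
    rw [Finset.mem_union]
    rcases hx with rfl | rfl | rfl
    · exact Or.inl (inl_mem_cycBase _)
    · exact Or.inr (inr_mem_cycle.2 hp)
    · exact Or.inr (inr_mem_cycle.2 ((next_fst p).trans hp))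
  rw [this]
  ring

theorem cyc_prim [Fintype J] (j : J) : Prim (cycBase J k) (cycle j) := by
  refine ⟨⟨Cyc.pt (j, 0, false), inr_mem_cycle.2 rfl⟩, disjoint_base_cycle j,
    cyc_delta_union_cycle j, fun Y hY hne hYne => ?_⟩
  rw [cyc_delta_base]
  by_contra! hle
  refine hYne (hY.antisymm ?_)
  obtain ⟨y, hy⟩ := hne
  rcases y with e | p
  · exact absurd (hY hy) inl_notMem_cycle
  have hp := inr_mem_cycle.1 (hY hy)
  rintro (e | q) hq
  · exact absurd hq inl_notMem_cycle
  have hmem : ∀ r, (Cyc.pt r : Cyc J k) ∈ cycBase J k ∪ Y ↔ (Cyc.pt r : Cyc J k) ∈ Y := by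
    intro r
    simp [inr_notMem_cycBase]
  refine cyc_forall_mem (S := {r | (Cyc.pt r : Cyc J k) ∈ Y}) (fun r hr => ?_) hy q
    ((inr_mem_cycle.1 hq).trans hp.symm)
  exact (hmem _).1 (cyc_next_mem Finset.subset_union_left hle ((hmem _).2 hr))

theorem cyc_isGood [Fintype J] (j : J) : IsGood (cycBase J k) (cycle j) := by
  refine ⟨isZeroPrimitive_iff.2 (cyc_prim j), fun B hB hp => ?_⟩
  rw [isZeroPrimitive_iff] at hp
  -- every block inside the cycle together with the base lies over `B`, so `B` is the whole base
  have hsub : ∀ e : Bool, (Cyc.base e : Cyc J k) ∈ B := by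
    intro e
    have h1 := cyc_isTripleSystem.subset_union_of_block hB.subset (disjoint_base_cycle j)
      hp.delta_eq ((cyc_prim j).le subset_rfl) (s := cycBlock (j, 0, e)) (by
        refine mem_blocks.2 ⟨fun x hx => ?_, cyc_isBlock.2 ⟨_, rfl⟩⟩
        rw [Finset.mem_union]
        rcases mem_cycBlock.1 hx with rfl | rfl | rfl
        · exact Or.inl (inl_mem_cycBase _)
        · exact Or.inr (inr_mem_cycle.2 rfl)
        · exact Or.inr (inr_mem_cycle.2 (next_fst _)))
      (Finset.not_disjoint_iff.2 ⟨Cyc.pt (j, 0, e), by simp [mem_cycBlock],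
        inr_mem_cycle.2 rfl⟩)
    have h2 : (Cyc.base e : Cyc J k) ∈ cycBlock (j, (0 : ZMod (k + 2)), e) := by
      simp [mem_cycBlock]
    exact (Finset.mem_union.1 (h1 h2)).resolve_right inl_notMem_cycle
  refine hB.2 fun x hx => ?_
  rcases x with e | p
  · exact hsub e
  · exact absurd hx (inr_notMem_cycBase p)

/-! ### The good pairs given by cycles -/

theorem IsTripleSystem.isGood_map {M N : Type} [tau.Structure M] [tau.Structure N]
    (h : IsTripleSystem N) (g : M ↪[tau] N) {A B : Finset M} (hg : IsGood A B) :
    IsGood (A.map g.toEmbedding) (B.map g.toEmbedding) := by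
  refine ⟨isZeroPrimitive_iff.2 ((h.prim_map g).2 (isZeroPrimitive_iff.1 hg.1)),
    fun A' hA' hp => ?_⟩
  obtain ⟨A₁, -, rfl⟩ := exists_map_eq_of_subset hA'.subset
  refine hg.2 A₁ (Finset.map_ssubset_map.1 hA') ?_
  exact isZeroPrimitive_iff.2 ((h.prim_map g).1 (isZeroPrimitive_iff.1 hp))

/-- Every good pair in a finite triple system is isomorphic to one on the standard carrier. -/
theorem exists_goodPair {X : Type} [Fintype X] [tau.Structure X] (h : IsTripleSystem X)
    (hpos : ∀ W : Finset X, 0 ≤ delta W) {A B : Finset X} (hg : IsGood A B)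
    (hcov : ∀ x, x ∈ A ∨ x ∈ B) :
    ∃ P : GoodPair, P.n = Fintype.card X ∧
      ∃ q : Fin P.n ↪[tau] X, Function.Surjective q ∧ ∀ x, x ∈ P.base ↔ q x ∈ A := by
  let e := Fintype.equivFin X
  let := e.inducedStructure (L := tau)
  let E : X ↪[tau] Fin (Fintype.card X) := (e.inducedStructureEquiv (L := tau)).toEmbedding
  let E' : Fin (Fintype.card X) ↪[tau] X := (e.inducedStructureEquiv (L := tau)).symm.toEmbedding
  have hE : ∀ x, E x = e x := fun x => rfl
  have hE' : ∀ x, E' x = e.symm x := fun x => rfl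
  have h3 : IsTripleSystem (Fin (Fintype.card X)) := h.of_embedding E'
  have hmem : ∀ (W : Finset X) x, x ∈ W.map E.toEmbedding ↔ E' x ∈ W := by
    intro W x
    simp only [Finset.mem_map, toEmbedding_apply, hE, hE']
    constructor
    · rintro ⟨y, hy, rfl⟩; simpa using hy
    · intro hx; exact ⟨e.symm x, hx, by simp⟩
  have hcompl : (A.map E.toEmbedding)ᶜ = B.map E.toEmbedding := by
    ext x
    rw [Finset.mem_compl, hmem, hmem]
    exact ⟨(hcov _).resolve_left,
      fun h1 h2 => Finset.disjoint_left.1 (isZeroPrimitive_iff.1 hg.1).disjoint h2 h1⟩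
  refine ⟨⟨Fintype.card X, A.map E.toEmbedding, ⟨inferInstance, h3.toIsLinearSpace, fun W => ?_⟩,
    ?_⟩, rfl, E', fun x => ⟨e x, by rw [hE']; simp⟩, hmem A⟩
  · rw [← h.delta_map E']
    exact hpos _
  · rw [hcompl]
    exact h3.isGood_map E hg

/-- Good pairs with the same base and the same range in a structure are isomorphic. -/
theorem GoodPair.type_eq {M : Type} [tau.Structure M] {P Q : GoodPair} (p : Fin P.n ↪[tau] M)
    (q : Fin Q.n ↪[tau] M) {A B : Finset M} (hpA : P.base.map p.toEmbedding = A)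
    (hpB : P.ext.map p.toEmbedding = B) (hqA : Q.base.map q.toEmbedding = A)
    (hqB : Q.ext.map q.toEmbedding = B) : P.type = Q.type := by
  have hrange : ∀ (P Q : GoodPair) (p : Fin P.n ↪[tau] M) (q : Fin Q.n ↪[tau] M),
      P.base.map p.toEmbedding = Q.base.map q.toEmbedding →
      P.ext.map p.toEmbedding = Q.ext.map q.toEmbedding →
      ∀ x, (∃ y, q y = p x) ∧ ∀ y, q y = p x → x ∈ P.base → y ∈ Q.base := by
    intro P Q p q h1 h2 x
    constructor
    · by_cases hx : x ∈ P.base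
      · have := Finset.mem_map_of_mem p.toEmbedding hx
        rw [h1] at this
        obtain ⟨y, -, hy⟩ := Finset.mem_map.1 this
        exact ⟨y, hy⟩
      · have hx' : x ∈ P.ext := Finset.mem_compl.2 hx
        have := Finset.mem_map_of_mem p.toEmbedding hx'
        rw [h2] at this
        obtain ⟨y, -, hy⟩ := Finset.mem_map.1 this
        exact ⟨y, hy⟩
    · intro y hy hx
      have := Finset.mem_map_of_mem p.toEmbedding hx
      rw [h1, toEmbedding_apply, ← hy] at this
      exact (Finset.mem_map' q.toEmbedding).1 this
  have h1 := hrange P Q p q (hpA.trans hqA.symm) (hpB.trans hqB.symm)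
  have h2 := hrange Q P q p (hqA.trans hpA.symm) (hqB.trans hpB.symm)
  obtain ⟨g, hg⟩ := exists_factor q p (fun x => (h1 x).1)
  have hbij : Function.Bijective g := by
    refine ⟨g.injective, fun y => ?_⟩
    obtain ⟨x, hx⟩ := (h2 y).1
    exact ⟨x, q.injective (by rw [hg, hx])⟩
  have hiso : GoodPair.Iso P Q := by
    refine ⟨{ toEquiv := Equiv.ofBijective g hbij
              map_fun' := fun f => nomatch f
              map_rel' := fun r x => g.map_rel r x }, fun x => ?_⟩
    exact ⟨(h1 x).2 _ (hg x), (h2 _).2 x (hg x).symm⟩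
  exact Quotient.sound hiso

theorem exists_cyclePair (k : ℕ) : ∃ P : GoodPair, P.n = Fintype.card (Cyc Unit k) ∧
    ∃ q : Fin P.n ↪[tau] Cyc Unit k, Function.Surjective q ∧
      ∀ x, x ∈ P.base ↔ q x ∈ cycBase Unit k :=
  exists_goodPair cyc_isTripleSystem cyc_delta_nonneg (cyc_isGood ()) (by
    rintro (e | p)
    · exact Or.inl (inl_mem_cycBase e)
    · exact Or.inr (inr_mem_cycle.2 rfl))

/-- The good pair consisting of two base points and one cycle of length `2 (k + 2)`. -/
noncomputable def cyclePair (k : ℕ) : GoodPair := (exists_cyclePair k).choose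

theorem cyclePair_n (k : ℕ) : (cyclePair k).n = 2 + (k + 2) * 2 := by
  rw [cyclePair, (exists_cyclePair k).choose_spec.1, Fintype.card_congr (cycEquiv Unit k)]
  simp [ZMod.card]

/-- Each of the cycles, together with the base, is a copy of the single cycle. -/
theorem exists_cycle_embedding (j : J) : ∃ c : Cyc Unit k ↪[tau] Cyc J k,
    (∀ e, c (Cyc.base e) = Cyc.base e) ∧ ∀ p, c (Cyc.pt p) = Cyc.pt (j, p.2) := by
  let c : Cyc Unit k ↪ Cyc J k := ⟨Cyc.map (fun _ => j), by
    rintro (x | ⟨⟨⟩, x⟩) (y | ⟨⟨⟩, y⟩) h <;> simp_all [Cyc.map]⟩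
  have hc1 : ∀ e, c (Cyc.base e) = Cyc.base e := fun _ => rfl
  have hc2 : ∀ p, c (Cyc.pt p) = Cyc.pt (j, p.2) := fun _ => rfl
  have hnext : ∀ p : Unit × ZMod (k + 2) × Bool, (j, (next p).2) = next (j, p.2) := by
    rintro ⟨⟨⟩, i, _ | _⟩ <;> rfl
  have hblock : ∀ p, (cycBlock p).map c = cycBlock (j, p.2) := by
    intro p
    ext x
    simp only [Finset.mem_map, mem_cycBlock]
    constructor
    · rintro ⟨y, rfl | rfl | rfl, rfl⟩
      · exact Or.inl rfl
      · exact Or.inr (Or.inl rfl)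
      · right; right; rw [hc2, hnext]
    · rintro (rfl | rfl | rfl)
      · exact ⟨_, Or.inl rfl, rfl⟩
      · exact ⟨_, Or.inr (Or.inl rfl), rfl⟩
      · exact ⟨_, Or.inr (Or.inr rfl), by rw [hc2, hnext]⟩
  refine ⟨embeddingOfCol c c.injective fun x y z => ?_, hc1, hc2⟩
  have he := map_triple c x y z
  refine (cyc_isTripleSystem.col_iff_isBlock.trans (iff_of_eq (congrArg IsBlock he.symm))).trans ?_
  rw [cyc_isTripleSystem.col_iff_isBlock, cyc_isBlock, cyc_isBlock]
  constructor
  · rintro ⟨⟨j', p⟩, hp⟩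
    have hj : (Cyc.pt (j', p) : Cyc J k) ∈ cycBlock (j', p) := by simp [mem_cycBlock]
    rw [hp] at hj
    obtain ⟨w, -, hw⟩ := Finset.mem_map.1 hj
    rcases w with w | w
    · rw [hc1] at hw; simp at hw
    · rw [hc2] at hw
      have hjj : j = j' := by simpa using congrArg Prod.fst (Cyc.pt_injective hw)
      refine ⟨((), p), Finset.map_injective c ?_⟩
      rw [hblock, ← hp, hjj]
  · rintro ⟨p, hp⟩
    exact ⟨(j, p.2), by rw [← hblock, hp]⟩

theorem exists_cyclePair_embedding [Fintype J] (j : J) : ∃ g : Fin (cyclePair k).n ↪[tau] Cyc J k,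
    (cyclePair k).base.map g.toEmbedding = cycBase J k ∧
    (cyclePair k).ext.map g.toEmbedding = cycle j ∧
    ∀ x ∈ (cyclePair k).base, (g x).map (fun _ => ()) =
      (exists_cyclePair k).choose_spec.2.choose x := by
  obtain ⟨c, hc1, hc2⟩ := exists_cycle_embedding (k := k) j
  set q : Fin (cyclePair k).n ↪[tau] Cyc Unit k := (exists_cyclePair k).choose_spec.2.choose
    with hq
  obtain ⟨hq1, hq2⟩ : Function.Surjective q ∧ ∀ x, x ∈ (cyclePair k).base ↔ q x ∈ cycBase Unit k :=
    (exists_cyclePair k).choose_spec.2.choose_spec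
  refine ⟨c.comp q, ?_, ?_, fun x hx => ?_⟩
  · ext x
    simp only [Finset.mem_map, toEmbedding_apply]
    constructor
    · rintro ⟨y, hy, rfl⟩
      have hy' := (hq2 y).1 hy
      change c (q y) ∈ _
      rcases hqy : q y with e | p
      · rw [hc1]; exact inl_mem_cycBase e
      · rw [hqy] at hy'; exact absurd hy' (inr_notMem_cycBase p)
    · intro hx
      rcases x with e | p
      · obtain ⟨y, hy⟩ := hq1 (Cyc.base e)
        refine ⟨y, (hq2 y).2 (hy ▸ inl_mem_cycBase e), ?_⟩
        change c (q y) = _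
        rw [hy, hc1]
      · exact absurd hx (inr_notMem_cycBase p)
  · ext x
    simp only [Finset.mem_map, toEmbedding_apply]
    constructor
    · rintro ⟨y, hy, rfl⟩
      have hy' : q y ∉ cycBase Unit k := fun h => Finset.mem_compl.1 hy ((hq2 y).2 h)
      change c (q y) ∈ _
      rcases hqy : q y with e | p
      · rw [hqy] at hy'; exact absurd (inl_mem_cycBase e) hy'
      · rw [hc2]; exact inr_mem_cycle.2 rfl
    · intro hx
      rcases x with e | ⟨j', p⟩
      · exact absurd hx inl_notMem_cycle
      · have hj : j' = j := inr_mem_cycle.1 hx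
        obtain ⟨y, hy⟩ := hq1 (Cyc.pt ((), p))
        refine ⟨y, Finset.mem_compl.2 fun h => ?_, ?_⟩
        · have h' := (hq2 y).1 h
          rw [hy] at h'
          exact inr_notMem_cycBase _ h'
        · change c (q y) = _
          rw [hy, hc2, hj]
  · have hx' := (hq2 x).1 hx
    change (c (q x)).map (fun _ => ()) = q x
    rcases hqx : q x with e | p
    · rw [hc1]; rfl
    · rw [hqx] at hx'; exact absurd hx' (inr_notMem_cycBase p)

/-- The cycles form a packing of the cycle pair. -/
theorem exists_packing_cyc [Fintype J] : ∃ g : J → (Fin (cyclePair k).n ↪[tau] Cyc J k),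
    IsPacking (cyclePair k) g := by
  choose g hg1 hg2 hg3 using fun j : J => exists_cyclePair_embedding (k := k) j
  refine ⟨g, fun i j x hx => ?_, fun i j hij => ?_⟩
  · have h := (hg3 i x hx).trans (hg3 j x hx).symm
    have hmem : ∀ j, g j x ∈ cycBase J k := fun j => by
      rw [← hg1 j]
      exact Finset.mem_map_of_mem (g j).toEmbedding hx
    have hi := hmem i
    have hj := hmem j
    rcases hgi : g i x with e | p
    · rcases hgj : g j x with e' | p'
      · rw [hgi, hgj] at h
        exact congrArg Cyc.base (Cyc.base_injective h)
      · rw [hgj] at hj; exact absurd hj (inr_notMem_cycBase p')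
    · rw [hgi] at hi; exact absurd hi (inr_notMem_cycBase p)
  · rw [hg2, hg2, Finset.disjoint_left]
    rintro (e | p) h1 h2
    · exact inl_notMem_cycle h1
    · exact hij ((inr_mem_cycle.1 h1).symm.trans (inr_mem_cycle.1 h2))

/-- In a family of cycles the only large packings are those of the cycle pair: a copy with a point
of a cycle in its base has to meet one of the two blocks through that point, and a copy over the
base points alone is one of the cycles. -/
theorem cyc_packing [Fintype J] {P : GoodPair} {ι : Type} [Fintype ι]
    {g : ι → (Fin P.n ↪[tau] Cyc J k)} (hg : IsPacking P g) :
    Fintype.card ι ≤ 4 ∨ (Fintype.card ι ≤ Fintype.card J ∧ P.type = (cyclePair k).type) := by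
  rcases isEmpty_or_nonempty ι with hι | ⟨⟨k₀⟩⟩
  · left; simp [Fintype.card_eq_zero]
  have h := cyc_isTripleSystem (J := J) (k := k)
  set B : ι → Finset (Cyc J k) := fun l => P.ext.map (g l).toEmbedding with hB
  obtain ⟨A, hA⟩ : ∃ A, ∀ l, P.base.map (g l).toEmbedding = A :=
    ⟨_, fun l => hg.base_eq l k₀⟩
  have hgood : ∀ l, GoodIn A (B l) := fun l => hA l ▸ h.goodIn_pair P (g l)
  by_cases hAb : A ⊆ cycBase J k
  · right
    have key : ∀ l, ∃ j, cycle j = B l ∧ A = cycBase J k := by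
      intro l
      have hnsub : ¬ B l ⊆ cycBase J k := by
        intro hsub
        have h1 : (A ∪ B l).card ≤ 2 := by
          refine (Finset.card_le_card (Finset.union_subset hAb hsub)).trans ?_
          exact (Finset.card_pair (by simp)).le
        have h2 := (hgood l).delta_eq
        rw [h.delta_of_card_le_two h1, h.delta_of_card_le_two
          ((Finset.card_le_card Finset.subset_union_left).trans h1),
          Finset.card_union_of_disjoint (hgood l).disjoint] at h2
        have h3 := (hgood l).nonempty.card_pos
        omega
      have hdis := (h.subset_or_disjoint cyc_strong_base (hgood l).toPrim hAb).resolve_left hnsub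
      have hle : delta (cycBase J k ∪ B l) ≤ 2 := by
        have h1 := h.delta_union_add_inter_le (cycBase J k) (A ∪ B l)
        rw [← Finset.union_assoc, Finset.union_eq_left.2 hAb, Finset.inter_union_distrib_left,
          Finset.inter_eq_right.2 hAb, Finset.disjoint_iff_inter_eq_empty.1 hdis.symm,
          Finset.union_empty, (hgood l).delta_eq, cyc_delta_base] at h1
        linarith
      have hmem : ∀ r, (Cyc.pt r : Cyc J k) ∈ cycBase J k ∪ B l ↔
          (Cyc.pt r : Cyc J k) ∈ B l := fun r => by simp [inr_notMem_cycBase]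
      obtain ⟨b, hb⟩ := (hgood l).nonempty
      rcases b with e | p
      · exact absurd (inl_mem_cycBase e) (Finset.disjoint_left.1 hdis hb)
      have hsub : cycle p.1 ⊆ B l := by
        rintro (e | q) hq
        · exact absurd hq inl_notMem_cycle
        · refine cyc_forall_mem (S := {r | (Cyc.pt r : Cyc J k) ∈ B l}) (fun r hr => ?_) hb q
            (inr_mem_cycle.1 hq)
          exact (hmem _).1 (cyc_next_mem Finset.subset_union_left hle ((hmem _).2 hr))
      have hAeq : A = cycBase J k := by
        refine hAb.antisymm fun x hx => ?_
        rcases x with e | q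
        · have h1 := h.subset_union_of_block hAb hdis.symm (hgood l).delta_eq
            (strong_univ_iff.1 cyc_strong_base _ Finset.subset_union_left)
            (s := cycBlock (p.1, 0, e)) (by
              refine mem_blocks.2 ⟨fun x hx => ?_, cyc_isBlock.2 ⟨_, rfl⟩⟩
              rw [Finset.mem_union]
              rcases mem_cycBlock.1 hx with rfl | rfl | rfl
              · exact Or.inl (inl_mem_cycBase _)
              · exact Or.inr (hsub (inr_mem_cycle.2 rfl))
              · exact Or.inr (hsub (inr_mem_cycle.2 (next_fst _))))
            (Finset.not_disjoint_iff.2 ⟨Cyc.pt (p.1, 0, e), by simp [mem_cycBlock],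
              hsub (inr_mem_cycle.2 rfl)⟩)
          have h2 : (Cyc.base e : Cyc J k) ∈ cycBlock (p.1, (0 : ZMod (k + 2)), e) := by
            simp [mem_cycBlock]
          exact (Finset.mem_union.1 (h1 h2)).resolve_right
            (Finset.disjoint_right.1 hdis (inl_mem_cycBase e))
        · exact absurd hx (inr_notMem_cycBase q)
      refine ⟨p.1, ?_, hAeq⟩
      by_contra hne
      have h1 := (hgood l).lt (cycle p.1) hsub (cyc_prim p.1).nonempty hne
      rw [hAeq, cyc_delta_union_cycle] at h1
      exact lt_irrefl _ h1
    choose j hj hA' using key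
    refine ⟨Fintype.card_le_of_injective j fun l m hlm => ?_, ?_⟩
    · by_contra hne
      have h1 := hg.disjoint l m hne
      change Disjoint (B l) (B m) at h1
      rw [← hj l, ← hj m, hlm, disjoint_self] at h1
      exact (cyc_prim (k := k) (j m)).nonempty.ne_empty h1
    · obtain ⟨q, hq1, hq2, -⟩ := exists_cyclePair_embedding (k := k) (j k₀)
      exact GoodPair.type_eq (g k₀) q ((hA k₀).trans (hA' k₀)) (hj k₀).symm hq1 hq2
  · left
    obtain ⟨x, hxA, hx⟩ := Finset.not_subset.1 hAb
    rcases x with e | c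
    · exact absurd (inl_mem_cycBase e) hx
    obtain ⟨c', hc'⟩ := (Finite.injective_iff_surjective.1 (next_injective (J := J) (k := k))) c
    set N : Finset (Cyc J k) := (cycBlock c).erase (Cyc.pt c) ∪ (cycBlock c').erase (Cyc.pt c)
      with hN
    have hNcard : N.card ≤ 4 := by
      refine (Finset.card_union_le _ _).trans ?_
      rw [Finset.card_erase_of_mem (by simp [mem_cycBlock]),
        Finset.card_erase_of_mem (by simp [mem_cycBlock, hc']), card_cycBlock, card_cycBlock]
    have hex : ∀ l, ∃ y ∈ N, y ∈ B l := by
      intro l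
      obtain ⟨s, hs, hcs, hsB⟩ := (hgood l).touches _ hxA
      obtain ⟨y, hys, hyB⟩ := Finset.not_disjoint_iff.1 hsB
      have hyc : y ≠ Cyc.pt c := by
        rintro rfl
        exact Finset.disjoint_left.1 (hgood l).disjoint hxA hyB
      obtain ⟨p, rfl⟩ := cyc_isBlock.1 (mem_blocks.1 hs).2
      refine ⟨y, ?_, hyB⟩
      rw [hN, Finset.mem_union]
      rw [mem_cycBlock] at hcs
      rcases hcs with h1 | h1 | h1
      · simp at h1
      · obtain rfl := Cyc.pt_injective h1
        exact Or.inl (Finset.mem_erase.2 ⟨hyc, hys⟩)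
      · have h2 : p = c' := next_injective (by rw [hc', ← Cyc.pt_injective h1])
        rw [← h2]
        exact Or.inr (Finset.mem_erase.2 ⟨hyc, hys⟩)
    choose y hyN hyB using hex
    have hinj : Function.Injective y := by
      intro l m hlm
      by_contra hne
      exact Finset.disjoint_left.1 (hg.disjoint l m hne) (hyB l) (hlm ▸ hyB m)
    have h1 : (Finset.univ.image y).card ≤ N.card :=
      Finset.card_le_card (Finset.image_subset_iff.2 fun l _ => hyN l)
    rw [Finset.card_image_of_injective _ hinj, Finset.card_univ] at h1
    omega

end Cycles

/-! ### Embeddability of a finite structure is a first-order property -/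

section Theories

/-- Elementarily equivalent structures have the same finite substructures: that `D` embeds is
expressed by an existential sentence, the diagram of `D`. -/
theorem exists_embedding_of_completeTheory_eq {D G H : Type} [tau.Structure D] [tau.Structure G]
    [tau.Structure H] [Finite D] (h : tau.completeTheory G = tau.completeTheory H)
    (e : D ↪[tau] G) : Nonempty (D ↪[tau] H) := by
  let v : D → tau.Term (Empty ⊕ D) := fun a => Language.Term.var (Sum.inr a)
  let R : D × D × D → tau.Formula (Empty ⊕ D) := fun p =>
    Language.Relations.formula (L := tau) (n := 3) TauRel.R ![v p.1, v p.2.1, v p.2.2]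
  let lit : (D × D × D) ⊕ (D × D) → tau.Formula (Empty ⊕ D) := Sum.elim
    (fun p => if Col p.1 p.2.1 p.2.2 then R p else (R p).not)
    (fun p => if p.1 = p.2 then ⊤ else ((v p.1).equal (v p.2)).not)
  let φ : tau.Sentence := (Language.Formula.iInf lit).iExs D
  have hR : ∀ (M : Type) [tau.Structure M] (w : Empty ⊕ D → M) (p : D × D × D),
      (R p).Realize w ↔ Col (w (Sum.inr p.1)) (w (Sum.inr p.2.1)) (w (Sum.inr p.2.2)) := by
    intro M _ w p
    refine (Language.Formula.realize_rel (L := tau)).trans ?_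
    refine iff_of_eq (congrArg _ ?_)
    funext i
    fin_cases i <;> rfl
  have key : ∀ (M : Type) [tau.Structure M], M ⊨ φ ↔ Nonempty (D ↪[tau] M) := by
    intro M _
    simp only [φ, Language.Sentence.Realize, Language.Formula.realize_iExs,
      Language.Formula.realize_iInf]
    constructor
    · rintro ⟨w, hw⟩
      refine ⟨embeddingOfCol w (fun a b hab => ?_) (fun a b c => ?_)⟩
      · by_contra hne
        have := hw (Sum.inr (a, b))
        simp only [lit, Sum.elim_inr, if_neg hne, Language.Formula.realize_not,
          Language.Formula.realize_equal] at this
        exact this hab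
      · have := hw (Sum.inl (a, b, c))
        simp only [lit, Sum.elim_inl] at this
        split_ifs at this with hc
        · rw [hR] at this
          exact iff_of_true this hc
        · rw [Language.Formula.realize_not, hR] at this
          exact iff_of_false this hc
    · rintro ⟨g⟩
      refine ⟨g, ?_⟩
      rintro (p | p)
      · simp only [lit, Sum.elim_inl]
        split_ifs with hc
        · rw [hR]
          exact (col_map g).2 hc
        · rw [Language.Formula.realize_not, hR]
          exact fun h => hc ((col_map g).1 h)
      · simp only [lit, Sum.elim_inr]
        split_ifs with hc
        · simp
        · rw [Language.Formula.realize_not, Language.Formula.realize_equal]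
          exact fun h => hc (g.injective h)
  have h1 : φ ∈ tau.completeTheory G := (key G).2 ⟨e⟩
  rw [h] at h1
  exact (key H).1 h1

/-! ### Continuum many bounds -/

/-- The number of points of a good pair of a given type. -/
def GoodPairType.size : GoodPairType → ℕ :=
  Quotient.lift (fun P : GoodPair => P.n) (by
    rintro P Q ⟨e, -⟩
    simpa using Fintype.card_congr e.toEquiv)

theorem GoodPair.size_type (P : GoodPair) : P.type.size = P.n := rfl

/-- The bound attached to a set `S` of natural numbers: `1` on `α`, and generous elsewhere, with one
more copy allowed for the `k`-th cycle pair when `k ∈ S`. -/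
noncomputable def bound (S : Set ℕ) (q : GoodPairType) : ℕ :=
  if q = alphaPair.type then 1 else
    q.size + 4 + if ∃ k ∈ S, q = (cyclePair k).type then 1 else 0

theorem cyclePair_type_injective : Function.Injective (fun k => (cyclePair k).type) := by
  intro k l h
  have := congrArg GoodPairType.size h
  simp only [GoodPair.size_type, cyclePair_n] at this
  omega

theorem cyclePair_type_ne (k : ℕ) : (cyclePair k).type ≠ alphaPair.type := by
  intro h
  have := congrArg GoodPairType.size h
  simp only [GoodPair.size_type, cyclePair_n, alphaPair] at this
  omega

theorem GoodPair.card_ext_of_type_eq {P Q : GoodPair} (h : P.type = Q.type) :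
    P.ext.card = Q.ext.card := by
  obtain ⟨e, he⟩ : GoodPair.Iso P Q := Quotient.exact h
  refine Finset.card_bij (fun x _ => e x) (fun x hx => ?_) (fun x _ y _ hxy => e.injective hxy)
    (fun y hy => ⟨e.symm y, ?_, by simp⟩)
  · exact Finset.mem_compl.2 fun h' => Finset.mem_compl.1 hx ((he x).2 h')
  · refine Finset.mem_compl.2 fun h' => Finset.mem_compl.1 hy ?_
    have := (he _).1 h'
    simpa using this

theorem bound_of_two_le (S : Set ℕ) {P : GoodPair} (hP : 2 ≤ P.ext.card) :
    bound S P.type = P.n + 4 + if ∃ k ∈ S, P.type = (cyclePair k).type then 1 else 0 := by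
  rw [bound, if_neg, GoodPair.size_type]
  intro h
  have h1 := GoodPair.card_ext_of_type_eq h
  have h2 : alphaPair.ext.card = 1 := by decide
  omega

theorem bound_cyclePair (S : Set ℕ) (k : ℕ) :
    bound S (cyclePair k).type = (cyclePair k).n + 4 + if k ∈ S then 1 else 0 := by
  rw [bound, if_neg (cyclePair_type_ne k), GoodPair.size_type]
  congr 2
  refine propext ⟨?_, fun h => ⟨k, h, rfl⟩⟩
  rintro ⟨l, hl, h⟩
  rwa [cyclePair_type_injective h]

theorem bound_tripleBound (S : Set ℕ) : TripleBound (bound S) where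
  alpha := if_pos rfl
  pos P := by
    rw [bound]
    split_ifs <;> omega
  delta_le P hP := by
    rw [bound_of_two_le S hP]
    have h1 := delta_le_card P.base
    have h2 : P.base.card ≤ P.n := by simpa using Finset.card_le_univ P.base
    push_cast
    split_ifs <;> omega

theorem bound_admissible (S : Set ℕ) : bound S ∈ admissible := fun P =>
  ⟨(bound_tripleBound S).delta_le P, fun _ => (bound_tripleBound S).pos P⟩

theorem bound_injective : Function.Injective bound := by
  intro S T h
  ext k
  have := congrFun h (cyclePair k).type
  rw [bound_cyclePair, bound_cyclePair] at this
  by_cases h1 : k ∈ S <;> by_cases h2 : k ∈ T <;> simp_all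

/-- The family of cycles which separates the bounds: one more cycle than is allowed when `k` is not
in the index set. -/
abbrev Witness (k : ℕ) : Type := Cyc (Fin ((cyclePair k).n + 5)) k

theorem witness_inK {S : Set ℕ} {k : ℕ} (hk : k ∈ S) : InK (bound S) (Witness k) := by
  refine (inK_iff (bound_tripleBound S)).2 ⟨inferInstance, cyc_isTripleSystem, cyc_delta_nonneg,
    fun P hP ι _ g hg => ?_⟩
  rcases cyc_packing hg with h | ⟨h1, h2⟩
  · rw [bound_of_two_le S hP]
    omega
  · rw [h2, bound_cyclePair, if_pos hk]
    simpa using h1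

theorem not_witness_inK {S : Set ℕ} {k : ℕ} (hk : k ∉ S) : ¬ InK (bound S) (Witness k) := by
  intro h
  obtain ⟨g, hg⟩ := exists_packing_cyc (J := Fin ((cyclePair k).n + 5)) (k := k)
  have h1 := (chi_le_iff (cyclePair k) _).1 (h.2 (cyclePair k)) _ g hg
  rw [bound_cyclePair, if_neg hk] at h1
  simp at h1

/-- Every member of `K_μ` embeds into a generic structure. -/
theorem IsGeneric.exists_embedding {μ : GoodPairType → ℕ} (hμ : TripleBound μ) {G : Type}
    [tau.Structure G] (hG : IsGeneric μ G) {D : Type} [tau.Structure D] (hD : InK μ D) :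
    Nonempty (D ↪[tau] G) := by
  have hfin := hD.1.finite
  have := Fintype.ofFinite D
  let := discreteStructure Empty
  have hG3 := hG.isTripleSystem hμ
  have hpos : ∀ X : Finset G, 0 ≤ delta X := by
    intro X
    have h1 := hG.inHatK (sub (X : Set G)) X.finite_toSet
    obtain ⟨Z, hZ⟩ := exists_finset_map_eq (sub (X : Set G)).subtype.toEmbedding (X := X)
      (fun x hx => ⟨⟨x, hx⟩, rfl⟩)
    rw [← hZ, hG3.delta_map]
    exact h1.1.delta_nonneg Z
  obtain ⟨g, -, -⟩ := hG.extension Empty D hD (emptyEmbedding Empty D) (emptyEmbedding Empty G)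
    ((isStrongEmbedding_iff _).2
      (strongEmb_of_isEmpty (hD.isTripleSystem hμ) hD.1.delta_nonneg _))
    ((isStrongEmbedding_iff _).2 (strongEmb_of_isEmpty hG3 hpos _))
  exact ⟨g⟩

/-- Every finite structure which embeds into a generic structure is in `K_μ`. -/
theorem IsGeneric.inK_of_embedding {μ : GoodPairType → ℕ} (hμ : TripleBound μ) {G : Type}
    [tau.Structure G] (hG : IsGeneric μ G) {D : Type} [tau.Structure D] [Finite D]
    (e : D ↪[tau] G) : InK μ D := by
  have hfin : Finite (sub (Set.range e)) := (Set.finite_range e)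
  obtain ⟨g, -⟩ := exists_factor (sub (Set.range e)).subtype e (fun x => ⟨⟨e x, x, rfl⟩, rfl⟩)
  exact (hG.inHatK _ hfin).of_embedding hμ g

theorem completeTheory_ne_of_mem {S T : Set ℕ} {k : ℕ} (hS : k ∈ S) (hT : k ∉ T) {G H : Type}
    [tau.Structure G] [tau.Structure H] (hG : IsGeneric (bound S) G)
    (hH : IsGeneric (bound T) H) : tau.completeTheory G ≠ tau.completeTheory H := by
  intro h
  obtain ⟨e⟩ := hG.exists_embedding (bound_tripleBound S) (witness_inK hS)
  obtain ⟨f⟩ := exists_embedding_of_completeTheory_eq h e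
  exact not_witness_inK hT (hH.inK_of_embedding (bound_tripleBound T) f)

end Theories

end SteinerGeneric

open SteinerGeneric in
theorem mainTheorem5 :
    ∃ V : Set (GoodPairType → ℕ),
      V ⊆ admissible ∧
      Cardinal.mk V = 2 ^ Cardinal.aleph0 ∧
      (∀ μ ∈ V, ∃ (G : Type) (_ : tau.Structure G), IsGeneric μ G) ∧
      (∃ α : GoodPair, α.IsAlpha ∧
        ∀ μ ∈ V, ∀ (G : Type) [tau.Structure G], IsGeneric μ G →
          IsSteinerSystem (μ α.type + 2) G) ∧
      (∀ μ ∈ V, ∀ ν ∈ V, μ ≠ ν →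
        ∀ (G H : Type) [tau.Structure G] [tau.Structure H],
          IsGeneric μ G → IsGeneric ν H →
            tau.completeTheory G ≠ tau.completeTheory H) := by
  refine ⟨Set.range bound, ?_, ?_, ?_, ⟨alphaPair, alphaPair_isAlpha, ?_⟩, ?_⟩
  · rintro _ ⟨S, rfl⟩
    exact bound_admissible S
  · rw [Cardinal.mk_range_eq _ bound_injective, Cardinal.mk_set, Cardinal.mk_nat]
  · rintro _ ⟨S, rfl⟩
    exact exists_generic (bound_tripleBound S)
  · rintro _ ⟨S, rfl⟩ G _ hG
    rw [(bound_tripleBound S).alpha]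
    exact hG.isSteinerSystem (bound_tripleBound S)
  · rintro _ ⟨S, rfl⟩ _ ⟨T, rfl⟩ hST G H _ _ hG hH
    have hne : S ≠ T := fun e => hST (by rw [e])
    obtain ⟨k, hk⟩ : ∃ k, ¬ (k ∈ S ↔ k ∈ T) := by
      by_contra! hcon
      exact hne (Set.ext hcon)
    by_cases hS : k ∈ S
    · exact completeTheory_ne_of_mem hS (fun hT => hk (iff_of_true hS hT)) hG hH
    · have hT : k ∈ T := by
        by_contra hT
        exact hk (iff_of_false hS hT)
      exact (completeTheory_ne_of_mem hT hS hH hG).symm
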